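/- **Setting.** Work in $\mathbb R^{n+1}$, $n\ge 2$; $\delta(X)=\operatorname{dist}(X,\partial\Omega)$. A nonempty connected open set $\Omega$ is a *1-sided NTA domain* with constants $c_0\in(0,1)$, $C_1,C_2>1$ if * (Corkscrew) for all $x\in\partial\Omega$, $0<r<\operatorname{diam}(\partial\Omega)$ there is a ball $B(X,c_0r)\subset B(x,r)\cap\Omega$; * (Harnack chains) any $X,X'\in\Omega$ are joined by balls $B_1,\dots,B_N\subset\Omega$ with $X\in B_1$, $X'\in B_N$, $B_k\cap B_{k+1}\ne\emptyset$, $C_2^{-1}\operatorname{diam}B_k\le\operatorname{dist}(B_k,\partial\Omega)\le C_2\operatorname{diam}B_k$, and $N\le C_1\big(2+\log_2^+\frac{|X-X'|}{\min\{\delta(X),\delta(X')\}}\big)$. It satisfies the *CDC* with constant $c_1>0$ if for all $x\in\partial\Omega$, $0<r<\operatorname{diam}(\partial\Omega)$ $$\frac{\operatorname{Cap}_2(\overline{B(x,r)}\setminus\Omega,B(x,2r))}{\operatorname{Cap}_2(\overline{B(x,r)},B(x,2r))}\ge c_1,\qquad \operatorname{Cap}_2(K,D)=\inf\Big\{\iint_D|\nabla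 v|^2:\ v\in C_0^\infty(D),\ v\ge1\text{ on }K\Big\}.$$ **Construction.** Let $C,A\ge1$. Let $\Omega$ be a 1-sided NTA domain (constants $c_0,C_1,C_2$) satisfying the CDC (constant $c_1$). * *Grid.* For each $k\in\mathbb Z$ let $\mathbb D_k$ be a partition of $\partial\Omega$ into Borel "cubes" such that for $m\le k$ cubes $Q\in\mathbb D_k$, $Q'\in\mathbb D_m$ satisfy $Q\subset Q'$ or $Q\cap Q'=\emptyset$, for $m<k$ each $Q\in\mathbb D_k$ lies in a unique $Q'\in\mathbb D_m$, and each $Q\in\mathbb D_k$ has a center $x_Q\in\partial\Omega$ with $B(x_Q,C^{-1}2^{-k})\cap\partial\Omega\subset Q\subset B(x_Q,C2^{-k})\cap\partial\Omega$. Write $k(Q)=k$, $\ell(Q)=2^{-k}$, $r_Q=\ell(Q)/(2C)$; equal sets of different generations are different cubes. $\mathbb D$ consists of all cubes with $\ell(Q)\le400A\operatorname{diam}(\partial\Omega)$. * *Whitney cubes.* Let $\mathcal W$ be a family of closed dyadic cubes with non-overlapping interiors and union $\Omega$ such that $4\operatorname{diam}(I)\le\operatorname{dist}(4I,\partial\Omega)$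 and $\operatorname{dist}(I,\partial\Omega)\le40\operatorname{diam}(I)$. Let $X(I)$ be the center and $2^{-k_I}$ the side length of $I$, and $I^*=(1+\lambda)I$. * *Whitney regions.* For $Q\in\mathbb D$ let $X_Q$ be a Corkscrew point relative to $B(x_Q,r_Q)$: $B(X_Q,\frac{c_0}{400A}r_Q)\subset B(x_Q,r_Q)\cap\Omega$. Given $m_0\in\mathbb N$, $K>0$, let $\mathcal W_Q$ be the set of $I\in\mathcal W$ with $|k_I-k(Q)|\le m_0$ and $\operatorname{dist}(I,Q)\le K\ell(Q)$. For each $I\in\mathcal W_Q$ fix a Harnack chain in $\Omega$ from $X(I)$ to $X_Q$ (constants $C_1,C_2$). Let $\mathcal W_Q^*$ be the set of all cubes of $\mathcal W$ meeting a ball of one of these chains, and $U_Q=\bigcup_{I\in\mathcal W_Q^*}I^*$. * *Regions.* $\mathbb D_Q$ is the set of cubes $Q'\in\mathbb D$ with $Q'\subset Q$, $k(Q')\ge k(Q)$. For a (possibly empty) family $\mathcal F\subset\mathbb D$ of pairwise disjoint cubes, $\mathbb D_{\mathcal F}=\mathbb D\setminus\bigcup_{P\in\mathcal F}\mathbb D_P$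 and $\mathbb D_{\mathcal F,Q}=\mathbb D_Q\cap\mathbb D_{\mathcal F}$. Put $$T_Q=\operatorname{int}\bigcup_{Q'\in\mathbb D_Q}U_{Q'},\quad \Omega_{\mathcal F}=\operatorname{int}\bigcup_{Q'\in\mathbb D_{\mathcal F}}U_{Q'},\quad \Omega_{\mathcal F,Q}=\operatorname{int}\bigcup_{Q'\in\mathbb D_{\mathcal F,Q}}U_{Q'}.$$ For $\Delta=B(x,r)\cap\partial\Omega$ with $x\in\partial\Omega$, $0<r<A\operatorname{diam}(\partial\Omega)$, let $k(\Delta)$ be the integer with $2^{-k(\Delta)-1}<200r\le2^{-k(\Delta)}$, let $\mathbb D^\Delta$ be the set of $Q\in\mathbb D$ with $k(Q)=k(\Delta)$ and $Q\cap B(x,2r)\neq\emptyset$, and $$T_\Delta=\operatorname{int}\bigcup_{Q\in\mathbb D^\Delta}\big(\overline{T_Q}\cap\Omega\big).$$ **Theorem.** Let $n\ge2$. There is $\lambda_0\in(0,1)$ depending only on $n$, and for all $c_0,C_1,C_2,c_1$ and $C,A\ge1$ there are thresholds for $m_0$ and $K$ depending only on $n,c_0,C_1,C_2,c_1,C,A$,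 such that whenever $0<\lambda<\lambda_0$ and $m_0,K$ are at least these thresholds, the following holds with constants $c_0',C_1',C_2',c_1'$ depending only on $n,c_0,C_1,C_2,c_1$ and the fixed construction parameters $C,A,\lambda,m_0,K$. For every 1-sided NTA domain $\Omega\subset\mathbb R^{n+1}$ with constants $c_0,C_1,C_2$ satisfying the CDC with constant $c_1$, and for all choices in the construction above, the sets * $T_Q$ for all $Q\in\mathbb D$, * $T_\Delta$ for all $\Delta=\Delta(x,r)$, $x\in\partial\Omega$, $0<r<A\operatorname{diam}(\partial\Omega)$, * $\Omega_{\mathcal F}$ for all pairwise disjoint $\mathcal F\subset\mathbb D$ with $\mathbb D_{\mathcal F}\ne\emptyset$, * $\Omega_{\mathcal F,Q}$ for all $Q\in\mathbb D$ and pairwise disjoint $\mathcal F\subset\mathbb D$ with $\mathbb D_{\mathcal F,Q}\ne\emptyset$ are 1-sided NTA domains with constants $c_0',C_1',C_2'$ and satisfy the CDC with constant $c_1'$. (A grid as above exists for some $C$ depending only on $n$; so $C,A,\lambda,m_0,K$ can be fixed depending only on $n$ and the constants of $\Omega$, and then so do the constants of the new domains.) -/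

import Mathlib

open scoped ContDiff ENNReal
open MeasureTheory

noncomputable section

namespace Sawtooth

/-- The ambient space `ℝ^{n+1}` with its Euclidean norm. -/
abbrev Pt (n : ℕ) := EuclideanSpace ℝ (Fin (n + 1))

/-- The Euclidean distance `inf {|a - b| : a ∈ A, b ∈ B}` between two (nonempty) sets. -/
def setDist {n : ℕ} (A B : Set (Pt n)) : ℝ :=
  sInf {d : ℝ | ∃ a ∈ A, ∃ b ∈ B, d = dist a b}

/-! ### 1-sided NTA domains and the capacity density condition -/

/-- The Corkscrew condition with constant `c₀`. The diameter is taken in `[0, ∞]`. -/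
def CorkscrewCondition {n : ℕ} (Ω : Set (Pt n)) (c₀ : ℝ) : Prop :=
  0 < c₀ ∧ c₀ < 1 ∧
  ∀ x ∈ frontier Ω, ∀ r : ℝ, 0 < r → ENNReal.ofReal r < Metric.ediam (frontier Ω) →
    ∃ X : Pt n, Metric.ball X (c₀ * r) ⊆ Metric.ball x r ∩ Ω

/-- The balls `B(z₁, ρ₁), …, B(z_N, ρ_N)` listed in `L` form a Harnack chain in `Ω` from `X` to
`X'` with constants `C₁, C₂`. Here `diam B(z, ρ) = 2ρ` and `δ(X) = dist(X, ∂Ω)`. -/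
def IsHarnackChain {n : ℕ} (Ω : Set (Pt n)) (C₁ C₂ : ℝ) (X X' : Pt n)
    (L : List (Pt n × ℝ)) : Prop :=
  (∀ B ∈ L, 0 < B.2 ∧ Metric.ball B.1 B.2 ⊆ Ω ∧
    C₂⁻¹ * (2 * B.2) ≤ setDist (Metric.ball B.1 B.2) (frontier Ω) ∧
    setDist (Metric.ball B.1 B.2) (frontier Ω) ≤ C₂ * (2 * B.2)) ∧
  (∃ B ∈ L.head?, X ∈ Metric.ball B.1 B.2) ∧
  (∃ B ∈ L.getLast?, X' ∈ Metric.ball B.1 B.2) ∧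
  L.IsChain (fun B B' => (Metric.ball B.1 B.2 ∩ Metric.ball B'.1 B'.2).Nonempty) ∧
  (L.length : ℝ) ≤ C₁ * (2 + max 0 (Real.logb 2
    (dist X X' / min (Metric.infDist X (frontier Ω)) (Metric.infDist X' (frontier Ω)))))

/-- The Harnack Chain condition with constants `C₁, C₂`. -/
def HarnackChainCondition {n : ℕ} (Ω : Set (Pt n)) (C₁ C₂ : ℝ) : Prop :=
  1 < C₁ ∧ 1 < C₂ ∧
  ∀ X ∈ Ω, ∀ X' ∈ Ω, ∃ L : List (Pt n × ℝ), IsHarnackChain Ω C₁ C₂ X X' L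

/-- 1-sided NTA domains: nonempty connected open sets satisfying the Corkscrew and the Harnack
Chain conditions. -/
def IsOneSidedNTA {n : ℕ} (Ω : Set (Pt n)) (c₀ C₁ C₂ : ℝ) : Prop :=
  IsOpen Ω ∧ IsConnected Ω ∧ CorkscrewCondition Ω c₀ ∧ HarnackChainCondition Ω C₁ C₂

/-- The capacity `Cap₂(K, D)`: the infimum of `∬_D |∇v|²` over `v ∈ C₀^∞(D)` with `v ≥ 1` on `K`. -/
def cap₂ {n : ℕ} (K D : Set (Pt n)) : ℝ≥0∞ :=
  ⨅ (v : Pt n → ℝ) (_ : ContDiff ℝ ∞ v ∧ HasCompactSupport v ∧ tsupport v ⊆ D ∧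
      ∀ x ∈ K, 1 ≤ v x),
    ∫⁻ X in D, ‖fderiv ℝ v X‖ₑ ^ 2

/-- The capacity density condition with constant `c₁`. -/
def CapacityDensity {n : ℕ} (Ω : Set (Pt n)) (c₁ : ℝ) : Prop :=
  0 < c₁ ∧
  ∀ x ∈ frontier Ω, ∀ r : ℝ, 0 < r → ENNReal.ofReal r < Metric.ediam (frontier Ω) →
    ENNReal.ofReal c₁ ≤
      cap₂ (Metric.closedBall x r \ Ω) (Metric.ball x (2 * r)) /
        cap₂ (Metric.closedBall x r) (Metric.ball x (2 * r))

/-! ### Dyadic grids on a closed set -/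

/-- A dyadic grid on `E` with constant `C`: for each `k ∈ ℤ` a family `gen k` of Borel subsets of
`E`, and a center `x_Q` for each cube `Q` of each generation. -/
structure DyadicGrid {n : ℕ} (E : Set (Pt n)) (C : ℝ) where
  gen : ℤ → Set (Set (Pt n))
  center : ℤ → Set (Pt n) → Pt n
  measurable : ∀ k, ∀ Q ∈ gen k, MeasurableSet Q
  cover : ∀ k, ⋃₀ gen k = E
  nested : ∀ m k, m ≤ k → ∀ Q ∈ gen k, ∀ Q' ∈ gen m, Q ⊆ Q' ∨ Disjoint Q Q'
  ancestor : ∀ m k, m < k → ∀ Q ∈ gen k, ∃! Q', Q' ∈ gen m ∧ Q ⊆ Q'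
  center_mem : ∀ k, ∀ Q ∈ gen k, center k Q ∈ E
  inner : ∀ k, ∀ Q ∈ gen k, Metric.ball (center k Q) (C⁻¹ * (2 : ℝ) ^ (-k)) ∩ E ⊆ Q
  outer : ∀ k, ∀ Q ∈ gen k, Q ⊆ Metric.ball (center k Q) (C * (2 : ℝ) ^ (-k)) ∩ E

/-- A cube of a dyadic grid is a set together with its generation `k(Q)`: equal sets of different
generations are different cubes. -/
abbrev Cube (n : ℕ) := ℤ × Set (Pt n)

/-- The length `ℓ(Q) = 2^{-k(Q)}`. -/
def Cube.len {n : ℕ} (Q : Cube n) : ℝ := (2 : ℝ) ^ (-Q.1)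

/-- The grid `𝔻(E)`: the cubes with `ℓ(Q) ≤ 400 A diam(E)`, which are all cubes if `E` is
unbounded. -/
def DyadicGrid.cubes {n : ℕ} {E : Set (Pt n)} {C : ℝ} (G : DyadicGrid E C) (A : ℝ) :
    Set (Cube n) :=
  {Q | Q.2 ∈ G.gen Q.1 ∧ ENNReal.ofReal Q.len ≤ ENNReal.ofReal (400 * A) * Metric.ediam E}

/-! ### Whitney decompositions -/

/-- The pair `(k, j)` stands for the closed dyadic cube with side length `2^{-k}` and lower corner
`2^{-k} j`. -/
abbrev WCube (n : ℕ) := ℤ × (Fin (n + 1) → ℤ)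

/-- The side length `ℓ(I) = 2^{-k_I}`. -/
def WCube.len {n : ℕ} (I : WCube n) : ℝ := (2 : ℝ) ^ (-I.1)

/-- The center `X(I)`. -/
def WCube.center {n : ℕ} (I : WCube n) : Pt n :=
  WithLp.toLp 2 (fun i => ((I.2 i : ℝ) + 1 / 2) * I.len)

/-- The closed cube `tI` concentric with `I` of side length `t ℓ(I)`. -/
def WCube.dilate {n : ℕ} (t : ℝ) (I : WCube n) : Set (Pt n) :=
  {x | ∀ i, |x i - I.center i| ≤ t * I.len / 2}

/-- The closed cube `I` itself. -/
def WCube.toSet {n : ℕ} (I : WCube n) : Set (Pt n) := I.dilate 1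

/-- `W` is a Whitney decomposition of `Ω`. (That touching cubes of `W` have comparable diameters
follows from `lower` and `upper`.) -/
structure IsWhitney {n : ℕ} (Ω : Set (Pt n)) (W : Set (WCube n)) : Prop where
  cover : (⋃ I ∈ W, I.toSet) = Ω
  nonoverlapping : W.Pairwise (fun I J => Disjoint (interior I.toSet) (interior J.toSet))
  lower : ∀ I ∈ W, 4 * Metric.diam I.toSet ≤ setDist (I.dilate 4) (frontier Ω)
  upper : ∀ I ∈ W, setDist I.toSet (frontier Ω) ≤ 40 * Metric.diam I.toSet

/-- The family `𝒲_Q` of those Whitney cubes `I` with `k(Q) - m₀ ≤ k_I ≤ k(Q) + m₀` and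
`dist(I, Q) ≤ K 2^{-k(Q)}`. -/
def whitneyNear {n : ℕ} (W : Set (WCube n)) (m₀ : ℕ) (K : ℝ) (Q : Cube n) : Set (WCube n) :=
  {I | I ∈ W ∧ Q.1 - m₀ ≤ I.1 ∧ I.1 ≤ Q.1 + m₀ ∧ setDist I.toSet Q.2 ≤ K * Q.len}

/-! ### Whitney regions, Carleson boxes and sawtooth regions -/

/-- The choices made in the construction of the Whitney regions over `Ω`, a 1-sided NTA domain with
constants `c₀, C₁, C₂`: a dyadic grid on `∂Ω` with constant `C`, a Whitney decomposition of `Ω`,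
a Corkscrew point `X_Q` relative to `Δ_Q = Δ(x_Q, r_Q)`, `r_Q = ℓ(Q)/(2C)`, for each cube `Q`, and,
for each `I ∈ 𝒲_Q`, a Harnack chain in `Ω` from `X(I)` to `X_Q`. As `r_Q` may exceed `diam(∂Ω)` by
a factor less than `400 A`, the Corkscrew constant is `c₀/(400 A)`. -/
structure Construction {n : ℕ} (Ω : Set (Pt n)) (c₀ C₁ C₂ C A : ℝ) (m₀ : ℕ) (K : ℝ) where
  grid : DyadicGrid (frontier Ω) C
  W : Set (WCube n)
  whitney : IsWhitney Ω W
  X : Cube n → Pt n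
  corkscrew : ∀ Q ∈ grid.cubes A,
    Metric.ball (X Q) (c₀ / (400 * A) * (Q.len / (2 * C))) ⊆
      Metric.ball (grid.center Q.1 Q.2) (Q.len / (2 * C)) ∩ Ω
  chain : Cube n → WCube n → List (Pt n × ℝ)
  isChain : ∀ Q ∈ grid.cubes A, ∀ I ∈ whitneyNear W m₀ K Q,
    IsHarnackChain Ω C₁ C₂ I.center (X Q) (chain Q I)

namespace Construction

variable {n : ℕ} {Ω : Set (Pt n)} {c₀ C₁ C₂ C A : ℝ} {m₀ : ℕ} {K : ℝ}

/-- The dyadic grid `𝔻 = 𝔻(∂Ω)`. -/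
def 𝔻 (S : Construction Ω c₀ C₁ C₂ C A m₀ K) : Set (Cube n) := S.grid.cubes A

/-- The augmented family `𝒲_Q^*` of all Whitney cubes that meet some ball of the Harnack chain
from `X(I)` to `X_Q`, for some `I ∈ 𝒲_Q`. -/
def wStar (S : Construction Ω c₀ C₁ C₂ C A m₀ K) (Q : Cube n) : Set (WCube n) :=
  {J | J ∈ S.W ∧ ∃ I ∈ whitneyNear S.W m₀ K Q, ∃ B ∈ S.chain Q I,
    (J.toSet ∩ Metric.ball B.1 B.2).Nonempty}

/-- The Whitney region `U_Q = ⋃_{I ∈ 𝒲_Q^*} I^*`, where `I^* = (1 + t) I`. -/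
def U (S : Construction Ω c₀ C₁ C₂ C A m₀ K) (t : ℝ) (Q : Cube n) : Set (Pt n) :=
  ⋃ I ∈ S.wStar Q, I.dilate (1 + t)

/-- The discretized Carleson region `𝔻_Q`: the cubes of `𝔻` contained in `Q`, of the same or a
later generation. -/
def below (S : Construction Ω c₀ C₁ C₂ C A m₀ K) (Q : Cube n) : Set (Cube n) :=
  {Q' | Q' ∈ S.𝔻 ∧ Q.1 ≤ Q'.1 ∧ Q'.2 ⊆ Q.2}

/-- The global discretized sawtooth `𝔻_𝓕`. -/
def globalSaw (S : Construction Ω c₀ C₁ C₂ C A m₀ K) (F : Set (Cube n)) : Set (Cube n) :=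
  S.𝔻 \ ⋃ Q ∈ F, S.below Q

/-- The local discretized sawtooth `𝔻_{𝓕,Q}`. -/
def localSaw (S : Construction Ω c₀ C₁ C₂ C A m₀ K) (F : Set (Cube n)) (Q : Cube n) :
    Set (Cube n) :=
  S.below Q \ ⋃ Q' ∈ F, S.below Q'

/-- The Carleson box `T_Q`. -/
def carlesonBox (S : Construction Ω c₀ C₁ C₂ C A m₀ K) (t : ℝ) (Q : Cube n) : Set (Pt n) :=
  interior (⋃ Q' ∈ S.below Q, S.U t Q')

/-- The global sawtooth region `Ω_𝓕`. -/
def globalSawtooth (S : Construction Ω c₀ C₁ C₂ C A m₀ K) (t : ℝ) (F : Set (Cube n)) :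
    Set (Pt n) :=
  interior (⋃ Q' ∈ S.globalSaw F, S.U t Q')

/-- The local sawtooth region `Ω_{𝓕,Q}`. -/
def localSawtooth (S : Construction Ω c₀ C₁ C₂ C A m₀ K) (t : ℝ) (F : Set (Cube n))
    (Q : Cube n) : Set (Pt n) :=
  interior (⋃ Q' ∈ S.localSaw F Q, S.U t Q')

/-- The cubes `𝔻^Δ` associated with `Δ = Δ(x, r)`: the cubes `Q` of the generation `k` determined
by `2^{-k-1} < 200 r ≤ 2^{-k}` that meet `2Δ = Δ(x, 2r)`. -/
def ballCubes (S : Construction Ω c₀ C₁ C₂ C A m₀ K) (x : Pt n) (r : ℝ) : Set (Cube n) :=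
  {Q | Q ∈ S.𝔻 ∧ (2 : ℝ) ^ (-Q.1 - 1) < 200 * r ∧ 200 * r ≤ (2 : ℝ) ^ (-Q.1) ∧
    (Q.2 ∩ (Metric.ball x (2 * r) ∩ frontier Ω)).Nonempty}

/-- The Carleson box `T_Δ`, `Δ = Δ(x, r)`: the interior of the union of the closures, relative to
`Ω`, of the boxes `T_Q`, `Q ∈ 𝔻^Δ`. -/
def ballBox (S : Construction Ω c₀ C₁ C₂ C A m₀ K) (t : ℝ) (x : Pt n) (r : ℝ) : Set (Pt n) :=
  interior (⋃ Q ∈ S.ballCubes x r, closure (S.carlesonBox t Q) ∩ Ω)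

end Construction

/-- `D` is a 1-sided NTA domain satisfying the CDC, with the indicated constants. -/
def IsNTAWithCDC {n : ℕ} (D : Set (Pt n)) (c₀ C₁ C₂ c₁ : ℝ) : Prop :=
  IsOneSidedNTA D c₀ C₁ C₂ ∧ CapacityDensity D c₁

end Sawtooth

end

open Sawtooth

/-! Every region of the theorem is a union of open fattened Whitney cubes, `cubeUnion (S.family E)
t`, where `E` is a collection of grid cubes and `S.family E` is the union of the families 𝒲_Q^*, Q ∈
E. This rests on dyadic rigidity: parallel faces of two dyadic cubes coincide or differ by at least
the smaller side length, so for small t fattened cubes that come close to each other overlap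
substantially (`IsWhitney.exists_overlap`), and a point at positive distance from ∂Ω lying in none
of the open cubes has nearby a ball, of radius proportional to the scale, that misses all closed
ones (`IsWhitney.exists_ball_disjoint`). The latter identifies the interiors and closures of the
construction and also yields exterior balls.

The only property of `E` needed for the geometry is `IsCoherent`: `E` contains the ancestors of its
cubes up to its first generation, if there is one, and the cubes of that generation are mutually
near. The thresholds for m₀ and K serve only to get `IsWide`: X_Q lies in a cube of 𝒲_{Q'} whenever
Q' is Q, its parent or a neighbor of the same generation, so that the chain chosen inside U_{Q'}
joins X_Q to X_{Q'}.

Harnack chains are handled as chains of points with hops shorter than half the distance to the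
boundary (`Reach`). Two points at distance d much smaller than their Whitney cubes lie in
overlapping cubes, and cones over a ball of radius comparable to d in the overlap join them
(`exists_reach_of_cone`). Otherwise one goes from each point to the center of its cube, to X_Q, and
up through the ancestors until the size d or the first generation is reached; the two ancestors are
then neighbors (`exists_harnack`). Corkscrew points are found by the same climb, or inside a single
large cube (`exists_corkscrew`).

For the capacity density at x in the new boundary and scale r, either ∂Ω is within r/2 of x, and the
condition for Ω is transferred from a smaller ball, or there is an exterior ball of radius
comparable to r (`exists_capacityDensity`). The capacity comparisons use cutoffs and a Poincaré
inequality obtained from the Sobolev inequality, which requires dimension n + 1 ≥ 3. -/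

noncomputable section

namespace Sawtooth

/-! ### Chains of points and Harnack chains -/

/-- The positive part of the binary logarithm. -/
def posLog (u : ℝ) : ℝ := max 0 (Real.logb 2 u)

theorem posLog_nonneg (u : ℝ) : 0 ≤ posLog u := le_max_left _ _

theorem logb_le_posLog (u : ℝ) : Real.logb 2 u ≤ posLog u := le_max_right _ _

theorem posLog_mono {u v : ℝ} (hu : 0 ≤ u) (h : u ≤ v) : posLog u ≤ posLog v := by
  rcases hu.eq_or_lt with rfl | hu
  · simp [posLog]
  · exact max_le_max le_rfl (Real.logb_le_logb_of_le (by norm_num) hu h)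

theorem posLog_mul_le {a u : ℝ} (ha : 0 < a) (hu : 0 ≤ u) : posLog (a * u) ≤ posLog a + posLog u := by
  rcases hu.eq_or_lt with rfl | hu
  · simp [posLog]
  · apply max_le (add_nonneg (posLog_nonneg _) (posLog_nonneg _))
    rw [Real.logb_mul ha.ne' hu.ne']
    exact add_le_add (logb_le_posLog _) (logb_le_posLog _)

/-- Two points that are close to each other compared to their distance to the boundary. -/
def Hop {n : ℕ} (D : Set (Pt n)) (x y : Pt n) : Prop :=
  x ∈ D ∧ y ∈ D ∧ dist x y < Metric.infDist x (frontier D) / 2 ∧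
    dist x y < Metric.infDist y (frontier D) / 2

/-- `y` is reached from `x` by `N` hops. -/
inductive Reach {n : ℕ} (D : Set (Pt n)) : ℕ → Pt n → Pt n → Prop
  | refl (x : Pt n) (hx : x ∈ D) : Reach D 0 x x
  | step {N : ℕ} {x y z : Pt n} (h : Hop D x y) (h' : Reach D N y z) : Reach D (N + 1) x z

section
variable {n : ℕ} {D : Set (Pt n)} {x y z : Pt n} {N M : ℕ}

theorem infDist_frontier_pos (hD : IsOpen D) (hf : (frontier D).Nonempty) (hx : x ∈ D) :
    0 < Metric.infDist x (frontier D) := by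
  refine (isClosed_frontier.notMem_iff_infDist_pos hf).1 fun h => ?_
  rw [hD.frontier_eq] at h
  exact h.2 hx

/-- A ball missing the frontier is connected, hence cannot meet both the interior and the exterior
of `D`. If the frontier is empty, `Metric.infDist` is 0 and the ball is empty. -/
theorem ball_infDist_frontier_subset (hx : x ∈ D) :
    Metric.ball x (Metric.infDist x (frontier D)) ⊆ D := by
  by_contra hn
  obtain ⟨y, hy, hyD⟩ := Set.not_subset.1 hn
  have hpos : 0 < Metric.infDist x (frontier D) := Metric.pos_of_mem_ball hy
  have hd : ∀ w ∈ Metric.ball x (Metric.infDist x (frontier D)), w ∉ frontier D :=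
    fun w hw => Set.disjoint_left.1 Metric.disjoint_ball_infDist hw
  have hcl : ∀ w ∈ Metric.ball x (Metric.infDist x (frontier D)), w ∈ closure D →
      w ∈ interior D := fun w hw hc => by
    by_contra hi
    exact hd w hw ⟨hc, hi⟩
  obtain ⟨z, -, hz, hz'⟩ := (convex_ball x (Metric.infDist x (frontier D))).isPreconnected
    (interior D) (closure D)ᶜ isOpen_interior isClosed_closure.isOpen_compl
    (fun w hw => by
      by_cases hc : w ∈ closure D
      · exact Or.inl (hcl w hw hc)
      · exact Or.inr hc)
    ⟨x, Metric.mem_ball_self hpos, hcl x (Metric.mem_ball_self hpos) (subset_closure hx)⟩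
    ⟨y, hy, fun hc => hyD (interior_subset (hcl y hy hc))⟩
  exact hz' (subset_closure (interior_subset hz))

theorem le_infDist_frontier {r : ℝ} (hD : IsOpen D) (hf : (frontier D).Nonempty)
    (h : Metric.ball x r ⊆ D) : r ≤ Metric.infDist x (frontier D) := by
  rw [Metric.le_infDist hf]
  intro y hy
  by_contra hlt
  rw [not_le] at hlt
  rw [hD.frontier_eq] at hy
  exact hy.2 (h (by rw [Metric.mem_ball']; exact hlt))

theorem Hop.symm (h : Hop D x y) : Hop D y x := by
  obtain ⟨h1, h2, h3, h4⟩ := h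
  exact ⟨h2, h1, by rwa [dist_comm], by rwa [dist_comm]⟩

theorem Hop.refl (hD : IsOpen D) (hf : (frontier D).Nonempty) (hx : x ∈ D) : Hop D x x := by
  have := infDist_frontier_pos hD hf hx
  refine ⟨hx, hx, ?_, ?_⟩ <;> rw [dist_self] <;> positivity

theorem Reach.mem_left (h : Reach D N x y) : x ∈ D := by
  cases h with
  | refl _ hx => exact hx
  | step h _ => exact h.1

theorem Reach.trans (h : Reach D N x y) (h' : Reach D M y z) : Reach D (N + M) x z := by
  induction h with
  | refl => simpa using h'
  | step h1 _ ih =>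
    rw [add_right_comm]
    exact Reach.step h1 (ih h')

theorem Reach.single (h : Hop D x y) : Reach D 1 x y := Reach.step h (Reach.refl y h.2.1)

theorem Reach.symm (h : Reach D N x y) : Reach D N y x := by
  induction h with
  | refl x hx => exact Reach.refl x hx
  | step h1 _ ih => exact ih.trans (Reach.single h1.symm)

/-- Chains can be padded by trivial hops, so uniform bounds may be stated with a fixed number of
hops. -/
theorem Reach.mono (hD : IsOpen D) (hf : (frontier D).Nonempty) (h : Reach D N x y)
    (hNM : N ≤ M) : Reach D M x y := by
  induction M, hNM using Nat.le_induction with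
  | base => exact h
  | succ M _ ih => exact Reach.step (Hop.refl hD hf ih.mem_left) ih

theorem Reach.of_seq (m : ℕ) (f : ℕ → Pt n) (h0 : f 0 ∈ D)
    (h : ∀ i < m, Hop D (f i) (f (i + 1))) : Reach D m (f 0) (f m) := by
  induction m with
  | zero => exact Reach.refl _ h0
  | succ m ih =>
    exact (ih fun i hi => h i (hi.trans (Nat.lt_succ_self m))).trans
      (Reach.single (h m (Nat.lt_succ_self m)))

/-- The balls of half the distance to the boundary along a chain of points form a Harnack chain. -/
theorem Reach.exists_list (hD : IsOpen D) (hf : (frontier D).Nonempty) (h : Reach D N x y) :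
    ∃ L : List (Pt n × ℝ), L.length = N + 1 ∧
      (∀ B ∈ L, B.1 ∈ D ∧ B.2 = Metric.infDist B.1 (frontier D) / 2) ∧
      L.head? = some (x, Metric.infDist x (frontier D) / 2) ∧
      L.getLast? = some (y, Metric.infDist y (frontier D) / 2) ∧
      L.IsChain (fun B B' => (Metric.ball B.1 B.2 ∩ Metric.ball B'.1 B'.2).Nonempty) := by
  induction h with
  | refl x hx => exact ⟨[(x, Metric.infDist x (frontier D) / 2)], by simp [hx]⟩
  | @step N x y z h1 _ ih =>
    obtain ⟨L, hL, hB, hh, hl, hc⟩ := ih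
    refine ⟨(x, Metric.infDist x (frontier D) / 2) :: L, by simp [hL], ?_, by simp, ?_, ?_⟩
    · intro B hBm
      rcases List.mem_cons.1 hBm with rfl | h'
      · exact ⟨h1.1, rfl⟩
      · exact hB B h'
    · rw [List.getLast?_cons, hl]; simp
    · rw [List.isChain_cons]
      refine ⟨fun B hBm => ?_, hc⟩
      rw [hh, Option.mem_some_iff] at hBm
      subst hBm
      refine ⟨y, ?_, ?_⟩
      · rw [Metric.mem_ball']; exact h1.2.2.1
      · exact Metric.mem_ball_self (half_pos (infDist_frontier_pos hD hf h1.2.1))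

theorem setDist_le {A B : Set (Pt n)} {a b : Pt n} (ha : a ∈ A) (hb : b ∈ B) :
    setDist A B ≤ dist a b :=
  csInf_le ⟨0, by rintro _ ⟨a, _, b, _, rfl⟩; exact dist_nonneg⟩ ⟨a, ha, b, hb, rfl⟩

theorem le_setDist {A B : Set (Pt n)} {d : ℝ} (hA : A.Nonempty) (hB : B.Nonempty)
    (h : ∀ a ∈ A, ∀ b ∈ B, d ≤ dist a b) : d ≤ setDist A B := by
  obtain ⟨a, ha⟩ := hA
  obtain ⟨b, hb⟩ := hB
  refine le_csInf ⟨_, a, ha, b, hb, rfl⟩ ?_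
  rintro _ ⟨a, ha, b, hb, rfl⟩
  exact h a ha b hb

theorem exists_dist_lt_of_setDist_lt {A B : Set (Pt n)} {d : ℝ} (hA : A.Nonempty) (hB : B.Nonempty)
    (h : setDist A B < d) : ∃ a ∈ A, ∃ b ∈ B, dist a b < d := by
  obtain ⟨a, ha⟩ := hA
  obtain ⟨b, hb⟩ := hB
  obtain ⟨_, ⟨a, ha, b, hb, rfl⟩, hd⟩ := exists_lt_of_csInf_lt
    (s := {d : ℝ | ∃ a ∈ A, ∃ b ∈ B, d = dist a b}) ⟨_, a, ha, b, hb, rfl⟩ h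
  exact ⟨a, ha, b, hb, hd⟩

/-- The ball of radius δ(z)/2 about z has diameter δ(z) and distance between δ(z)/2 and δ(z) to the
frontier, so 2 serves as the second constant. A chain of `N` hops has `N + 1` balls. -/
theorem Reach.exists_isHarnackChain (hD : IsOpen D) (hf : (frontier D).Nonempty) {C₁ : ℝ}
    (h : Reach D N x y)
    (hN : (N : ℝ) + 1 ≤ C₁ * (2 + posLog
      (dist x y / min (Metric.infDist x (frontier D)) (Metric.infDist y (frontier D))))) :
    ∃ L : List (Pt n × ℝ), IsHarnackChain D C₁ 2 x y L := by
  have hx := h.mem_left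
  have hy := h.symm.mem_left
  obtain ⟨L, hL, hB, hh, hl, hc⟩ := h.exists_list hD hf
  refine ⟨L, fun B hBL => ?_, ?_, ?_, hc, ?_⟩
  · obtain ⟨hBD, hB2⟩ := hB B hBL
    have hpos := infDist_frontier_pos hD hf hBD
    have hsub := ball_infDist_frontier_subset hBD
    refine ⟨by rw [hB2]; positivity, ?_, ?_, ?_⟩
    · refine (Metric.ball_subset_ball ?_).trans hsub
      rw [hB2]; linarith
    · refine le_setDist ⟨B.1, Metric.mem_ball_self (by rw [hB2]; positivity)⟩ hf ?_
      intro a ha b hb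
      have h1 := Metric.infDist_le_dist_of_mem (x := B.1) hb
      have h2 := Metric.mem_ball'.1 ha
      have h3 := dist_triangle B.1 a b
      rw [hB2] at h2 ⊢
      linarith
    · obtain ⟨b, hb, hb'⟩ := isClosed_frontier.exists_infDist_eq_dist hf B.1
      refine (setDist_le (Metric.mem_ball_self (by rw [hB2]; positivity)) hb).trans ?_
      rw [← hb', hB2]
      linarith
  · exact ⟨_, hh, Metric.mem_ball_self (half_pos (infDist_frontier_pos hD hf hx))⟩
  · exact ⟨_, hl, Metric.mem_ball_self (half_pos (infDist_frontier_pos hD hf hy))⟩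
  · rw [hL]; push_cast; exact hN

theorem isConnected_of_reach (hD : IsOpen D) (hf : (frontier D).Nonempty) (hne : D.Nonempty)
    (h : ∀ x ∈ D, ∀ y ∈ D, ∃ N, Reach D N x y) : IsConnected D := by
  refine ⟨hne, isPreconnected_of_forall_pair fun x hx y hy => ?_⟩
  obtain ⟨N, hN⟩ := h x hx y hy
  induction hN with
  | refl x _ => exact ⟨{x}, by simpa using hx, rfl, rfl, isPreconnected_singleton⟩
  | @step N x w z h1 _ ih =>
    obtain ⟨t, ht, hwt, hzt, htc⟩ := ih h1.2.1 hy
    have hpos := infDist_frontier_pos hD hf h1.1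
    refine ⟨Metric.ball x (Metric.infDist x (frontier D)) ∪ t,
      Set.union_subset (ball_infDist_frontier_subset h1.1) ht,
      Or.inl (Metric.mem_ball_self hpos), Or.inr hzt, ?_⟩
    refine IsPreconnected.union w ?_ hwt (convex_ball _ _).isPreconnected htc
    rw [Metric.mem_ball']
    have := h1.2.2.1
    linarith

/-- A segment at distance at least `s` from the boundary. -/
theorem reach_of_segment {s : ℝ}
    (h : ∀ w ∈ segment ℝ x y, w ∈ D ∧ s ≤ Metric.infDist w (frontier D)) {m : ℕ}
    (hm : dist x y < m * (s / 2)) : Reach D m x y := by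
  have hm0 : 0 < m := by
    rcases Nat.eq_zero_or_pos m with rfl | h'
    · have := dist_nonneg (x := x) (y := y)
      simp at hm; linarith
    · exact h'
  have hm0' : (0 : ℝ) < m := by exact_mod_cast hm0
  have hmem : ∀ i : ℕ, i ≤ m → AffineMap.lineMap x y ((i : ℝ) / m) ∈ segment ℝ x y := by
    intro i hi
    rw [segment_eq_image_lineMap]
    refine ⟨(i : ℝ) / m, ⟨by positivity, ?_⟩, rfl⟩
    rw [div_le_one hm0']
    exact_mod_cast hi
  have := Reach.of_seq (D := D) m (fun i => AffineMap.lineMap x y ((i : ℝ) / m))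
    (h _ (hmem 0 (Nat.zero_le _))).1 (fun i hi => ?_)
  · simpa [hm0'.ne'] using this
  · have h1 := h _ (hmem i hi.le)
    have h2 := h _ (hmem (i + 1) hi)
    have hd : dist (AffineMap.lineMap x y ((i : ℝ) / m) : Pt n)
        (AffineMap.lineMap x y (((i + 1 : ℕ) : ℝ) / m)) < s / 2 := by
      rw [dist_lineMap_lineMap, Real.dist_eq]
      have : (i : ℝ) / m - ((i + 1 : ℕ) : ℝ) / m = -(1 / m) := by
        push_cast; ring
      rw [this, abs_neg, abs_of_pos (by positivity), one_div, inv_mul_lt_iff₀ hm0']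
      exact hm
    exact ⟨h1.1, h2.1, by linarith [h1.2], by linarith [h2.2]⟩

end

/-- Reaching the vertex ball of a cone: `D` contains the balls `B(p_τ, τ s)`, where `p_τ` runs
through the segment from `x` to `z`. -/
theorem exists_reach_of_cone {M : ℝ} (hM : 1 ≤ M) :
    ∃ c : ℝ, 0 < c ∧ ∀ {n : ℕ} {D : Set (Pt n)} {x z : Pt n} {s : ℝ}, IsOpen D →
      (frontier D).Nonempty → x ∈ D → 0 < s → dist x z ≤ M * s →
      (∀ τ : ℝ, 0 < τ → τ ≤ 1 → Metric.ball (AffineMap.lineMap x z τ) (τ * s) ⊆ D) →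
      ∃ N : ℕ, (N : ℝ) ≤ c * (1 + posLog (s / Metric.infDist x (frontier D))) ∧ Reach D N x z := by
  -- Passing from τ to qτ moves the point by at most (q - 1) τ M s = τ s/4, within half the radius τ
  -- s of the ball at p_τ; the climb from τ to 1 takes about log_q(1/τ) hops.
  set q : ℝ := 1 + 1 / (4 * M) with hq
  have hq1 : 1 < q := by
    have : 0 < 1 / (4 * M) := by positivity
    linarith
  have hlq : 0 < Real.logb 2 q := Real.logb_pos (by norm_num) hq1
  refine ⟨2 + (1 + posLog (4 * M)) / Real.logb 2 q, by
    have := posLog_nonneg (4 * M); positivity, ?_⟩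
  intro n D x z s hD hf hx hs hxz hball
  set δ := Metric.infDist x (frontier D) with hδ
  have hδ0 : 0 < δ := infDist_frontier_pos hD hf hx
  have hM0 : 0 < M := by linarith
  have hmemD : ∀ τ : ℝ, 0 < τ → τ ≤ 1 → AffineMap.lineMap x z τ ∈ D ∧
      τ * s ≤ Metric.infDist (AffineMap.lineMap x z τ) (frontier D) := fun τ h1 h2 =>
    ⟨hball τ h1 h2 (Metric.mem_ball_self (by positivity)), le_infDist_frontier hD hf (hball τ h1 h2)⟩
  have climb : ∀ k : ℕ, ∀ τ : ℝ, 0 < τ → τ ≤ 1 → 1 ≤ q ^ k * τ →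
      Reach D k (AffineMap.lineMap x z τ) z := by
    intro k
    induction k with
    | zero =>
      intro τ h0 h1 h2
      have : τ = 1 := le_antisymm h1 (by simpa using h2)
      subst this
      simpa using Reach.refl _ (hmemD 1 one_pos le_rfl).1
    | succ k ih =>
      intro τ h0 h1 h2
      have hσ0 : 0 < min 1 (q * τ) := lt_min one_pos (by positivity)
      have hτσ : τ ≤ min 1 (q * τ) := le_min h1 (by nlinarith)
      refine Reach.step ?_ (ih (min 1 (q * τ)) hσ0 (min_le_left _ _) ?_)
      · have hd : dist (AffineMap.lineMap x z τ : Pt n) (AffineMap.lineMap x z (min 1 (q * τ))) ≤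
            τ * s / 4 := by
          rw [dist_lineMap_lineMap, Real.dist_eq, abs_sub_comm, abs_of_nonneg (by linarith)]
          have h3 : min 1 (q * τ) - τ ≤ 1 / (4 * M) * τ := by
            have := min_le_right 1 (q * τ)
            rw [hq] at this ⊢
            linarith
          calc _ ≤ 1 / (4 * M) * τ * (M * s) := by gcongr
            _ = _ := by field_simp
        have e1 := hmemD τ h0 h1
        have e2 := hmemD _ hσ0 (min_le_left 1 (q * τ))
        have : 0 < τ * s := by positivity
        have h5 : τ * s ≤ min 1 (q * τ) * s := by gcongr
        exact ⟨e1.1, e2.1, by linarith, by linarith⟩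
      · rcases min_choice 1 (q * τ) with h | h <;> rw [h]
        · rw [mul_one]; exact one_le_pow₀ hq1.le
        · rw [← mul_assoc, ← pow_succ]; exact h2
  -- The cone degenerates at the vertex, so the first hop leaves x using only the distance δ of x to
  -- the frontier: it has length at most δ/4.
  set τ₀ : ℝ := min 1 (δ / (4 * M * s)) with hτ₀
  have hτ₀0 : 0 < τ₀ := lt_min one_pos (by positivity)
  have hτ₀1 : τ₀ ≤ 1 := min_le_left _ _
  have hfirst : Hop D x (AffineMap.lineMap x z τ₀) := by
    have hd : dist x (AffineMap.lineMap x z τ₀) ≤ δ / 4 := by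
      rw [dist_left_lineMap, Real.norm_of_nonneg hτ₀0.le]
      calc _ ≤ δ / (4 * M * s) * (M * s) := by gcongr; exact min_le_right _ _
        _ = _ := by field_simp
    have h1 : δ ≤ Metric.infDist (AffineMap.lineMap x z τ₀) (frontier D) +
        dist x (AffineMap.lineMap x z τ₀) := Metric.infDist_le_infDist_add_dist
    exact ⟨hx, (hmemD _ hτ₀0 hτ₀1).1, by rw [← hδ]; linarith, by linarith⟩
  set k : ℕ := ⌈Real.logb 2 (1 / τ₀) / Real.logb 2 q⌉₊ with hk
  have hlog0 : 0 ≤ Real.logb 2 (1 / τ₀) :=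
    Real.logb_nonneg (by norm_num) (by rw [one_le_div hτ₀0]; exact hτ₀1)
  have hk1 : (k : ℝ) < Real.logb 2 (1 / τ₀) / Real.logb 2 q + 1 :=
    Nat.ceil_lt_add_one (by positivity)
  have hk2 : Real.logb 2 (1 / τ₀) / Real.logb 2 q ≤ k := Nat.le_ceil _
  have hreach := climb k τ₀ hτ₀0 hτ₀1 (by
    rw [div_le_iff₀ hlq, ← Real.logb_pow, Real.logb_le_logb (by norm_num) (by positivity)
      (by positivity), div_le_iff₀ hτ₀0] at hk2
    exact hk2)
  refine ⟨k + 1, ?_, Reach.step hfirst hreach⟩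
  have hlog : Real.logb 2 (1 / τ₀) ≤ posLog (4 * M) + posLog (s / δ) := by
    rcases min_choice 1 (δ / (4 * M * s)) with h | h
    · rw [hτ₀, h]
      simpa using add_nonneg (posLog_nonneg _) (posLog_nonneg _)
    · rw [hτ₀, h, one_div_div, mul_div_assoc]
      exact (logb_le_posLog _).trans (posLog_mul_le (by positivity) (by positivity))
  have p1 := posLog_nonneg (4 * M)
  have p2 := posLog_nonneg (s / δ)
  have h6 : Real.logb 2 (1 / τ₀) / Real.logb 2 q ≤
      (posLog (4 * M) + posLog (s / δ)) / Real.logb 2 q := by gcongr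
  have h7 : (posLog (4 * M) + posLog (s / δ)) / Real.logb 2 q ≤
      (1 + posLog (4 * M)) / Real.logb 2 q * (1 + posLog (s / δ)) := by
    rw [div_mul_eq_mul_div]
    gcongr
    nlinarith [mul_nonneg p1 p2]
  push_cast
  nlinarith

/-! ### Geometry of Whitney cubes -/

/-- The diameter of the unit cube of `ℝ^{n+1}`. -/
def unitDiam (n : ℕ) : ℝ := Real.sqrt (n + 1)

theorem one_le_unitDiam (n : ℕ) : 1 ≤ unitDiam n := by
  rw [unitDiam, Real.one_le_sqrt]
  have : (0 : ℝ) ≤ n := Nat.cast_nonneg n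
  linarith

theorem unitDiam_pos (n : ℕ) : 0 < unitDiam n := one_pos.trans_le (one_le_unitDiam n)

theorem abs_sub_apply_le_dist {n : ℕ} (x y : Pt n) (i : Fin (n + 1)) : |x i - y i| ≤ dist x y := by
  rw [dist_eq_norm]
  simpa using PiLp.norm_apply_le (x - y) i

theorem dist_le_of_abs_sub_apply_le {n : ℕ} {x y : Pt n} {a : ℝ} (ha : 0 ≤ a)
    (h : ∀ i, |x i - y i| ≤ a) : dist x y ≤ unitDiam n * a := by
  rw [EuclideanSpace.dist_eq, unitDiam, ← Real.sqrt_sq ha, ← Real.sqrt_mul (by positivity)]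
  apply Real.sqrt_le_sqrt
  calc ∑ i, dist (x i) (y i) ^ 2 ≤ ∑ _i : Fin (n + 1), a ^ 2 := by
        apply Finset.sum_le_sum
        intro i _
        rw [Real.dist_eq]
        exact pow_le_pow_left₀ (abs_nonneg _) (h i) 2
    _ = _ := by simp

theorem WCube.len_pos {n : ℕ} (I : WCube n) : 0 < I.len := zpow_pos (by norm_num) _

theorem WCube.center_apply {n : ℕ} (I : WCube n) (i : Fin (n + 1)) :
    I.center i = ((I.2 i : ℝ) + 1 / 2) * I.len := rfl

theorem WCube.dilate_mono {n : ℕ} (I : WCube n) {a b : ℝ} (h : a ≤ b) : I.dilate a ⊆ I.dilate b := by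
  intro x hx i
  refine (hx i).trans ?_
  have := I.len_pos
  gcongr

theorem WCube.center_mem_dilate {n : ℕ} (I : WCube n) {a : ℝ} (ha : 0 ≤ a) :
    I.center ∈ I.dilate a := by
  intro i
  have := I.len_pos
  rw [sub_self, abs_zero]
  positivity

/-- The open cube concentric with `I` of side length `a ℓ(I)`. -/
def WCube.openDilate {n : ℕ} (a : ℝ) (I : WCube n) : Set (Pt n) :=
  {x | ∀ i, |x i - I.center i| < a * I.len / 2}

theorem WCube.isOpen_openDilate {n : ℕ} (I : WCube n) (a : ℝ) : IsOpen (I.openDilate a) := by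
  have : I.openDilate a = ⋂ i, {x : Pt n | |x i - I.center i| < a * I.len / 2} := by
    ext x; simp [WCube.openDilate]
  rw [this]
  exact isOpen_iInter_of_finite fun i => isOpen_lt (by fun_prop) continuous_const

theorem WCube.openDilate_subset {n : ℕ} (I : WCube n) (a : ℝ) : I.openDilate a ⊆ I.dilate a :=
  fun _ hx i => (hx i).le

theorem WCube.dilate_subset_openDilate {n : ℕ} (I : WCube n) {a b : ℝ} (h : a < b) :
    I.dilate a ⊆ I.openDilate b := by
  intro x hx i
  refine (hx i).trans_lt ?_
  have := I.len_pos
  gcongr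

theorem WCube.dist_le_of_mem_dilate {n : ℕ} {I : WCube n} {a b : ℝ} {x y : Pt n}
    (hx : x ∈ I.dilate a) (hy : y ∈ I.dilate b) :
    dist x y ≤ unitDiam n * ((a + b) * I.len / 2) := by
  have h : ∀ i, |x i - y i| ≤ (a + b) * I.len / 2 := by
    intro i
    have h1 := hx i
    have h2 := hy i
    rw [abs_le] at *
    constructor <;> linarith [h1.1, h1.2, h2.1, h2.2]
  exact dist_le_of_abs_sub_apply_le ((abs_nonneg _).trans (h 0)) h

theorem WCube.isBounded_dilate {n : ℕ} (I : WCube n) (a : ℝ) : Bornology.IsBounded (I.dilate a) :=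
  Metric.isBounded_iff.2 ⟨_, fun _ hx _ hy => I.dist_le_of_mem_dilate hx hy⟩

theorem WCube.diam_toSet {n : ℕ} (I : WCube n) : Metric.diam I.toSet = unitDiam n * I.len := by
  have hl := I.len_pos
  apply le_antisymm
  · apply Metric.diam_le_of_forall_dist_le (by have := unitDiam_pos n; positivity)
    intro x hx y hy
    refine (I.dist_le_of_mem_dilate hx hy).trans (le_of_eq ?_)
    ring
  · set x : Pt n := WithLp.toLp 2 (fun i => I.center i + I.len / 2) with hx
    set y : Pt n := WithLp.toLp 2 (fun i => I.center i - I.len / 2) with hy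
    have hxm : x ∈ I.toSet := by
      intro i
      rw [hx]
      simp only [add_sub_cancel_left]
      rw [abs_of_pos (by positivity), one_mul]
    have hym : y ∈ I.toSet := by
      intro i
      rw [hy]
      simp only [sub_sub_cancel_left]
      rw [abs_neg, abs_of_pos (by positivity), one_mul]
    refine le_trans (le_of_eq ?_) (Metric.dist_le_diam_of_mem (I.isBounded_dilate 1) hxm hym)
    rw [EuclideanSpace.dist_eq]
    have : ∀ i, dist (x i) (y i) = I.len := by
      intro i
      rw [Real.dist_eq, hx, hy]
      simp only
      rw [show I.center i + I.len / 2 - (I.center i - I.len / 2) = I.len by ring, abs_of_pos hl]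
    simp only [this]
    simp only [Finset.sum_const, Finset.card_univ, Fintype.card_fin, nsmul_eq_mul]
    rw [Real.sqrt_mul (by positivity), Real.sqrt_sq hl.le, unitDiam]
    push_cast
    rfl

/-- Distinct dyadic numbers of generations `k` and `l` differ at least by the finer mesh. -/
theorem dyadic_gap (k l p q : ℤ)
    (h : 0 < (p : ℝ) * (2 : ℝ) ^ (-k) - q * (2 : ℝ) ^ (-l)) :
    min ((2 : ℝ) ^ (-k)) ((2 : ℝ) ^ (-l)) ≤ (p : ℝ) * (2 : ℝ) ^ (-k) - q * (2 : ℝ) ^ (-l) := by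
  -- The coarser mesh is an integer multiple of the finer one, so the difference is a positive
  -- integer times the finer mesh.
  have aux : ∀ a b : ℤ, a ≤ b → ∃ N : ℤ, (2 : ℝ) ^ (-a) = N * (2 : ℝ) ^ (-b) := by
    intro a b hab
    obtain ⟨d, hd⟩ := Int.eq_ofNat_of_zero_le (sub_nonneg.2 hab)
    refine ⟨2 ^ d, ?_⟩
    have : -a = (d : ℤ) + -b := by rw [← hd]; ring
    rw [this, zpow_add₀ (by norm_num), zpow_natCast]
    push_cast; rfl
  have fin : ∀ (z : ℤ) (u : ℝ), 0 < u → 0 < (z : ℝ) * u → u ≤ z * u := by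
    intro z u hu hz
    have h1 : (0 : ℝ) < z := (pos_iff_pos_of_mul_pos hz).2 hu
    have h2 : (1 : ℝ) ≤ z := by
      have : 0 < z := by exact_mod_cast h1
      exact_mod_cast this
    nlinarith
  rcases le_total k l with hkl | hkl
  · obtain ⟨N, hN⟩ := aux k l hkl
    have e : (p : ℝ) * (2 : ℝ) ^ (-k) - q * (2 : ℝ) ^ (-l) = ((p * N - q : ℤ) : ℝ) * 2 ^ (-l) := by
      rw [hN]; push_cast; ring
    rw [e] at h ⊢
    exact (min_le_right _ _).trans (fin _ _ (zpow_pos (by norm_num) _) h)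
  · obtain ⟨N, hN⟩ := aux l k hkl
    have e : (p : ℝ) * (2 : ℝ) ^ (-k) - q * (2 : ℝ) ^ (-l) = ((p - q * N : ℤ) : ℝ) * 2 ^ (-k) := by
      rw [hN]; push_cast; ring
    rw [e] at h ⊢
    exact (min_le_left _ _).trans (fin _ _ (zpow_pos (by norm_num) _) h)

/-- The gap between the upper face of `I` and the lower face of `J` in direction `i`. -/
theorem WCube.face_gap {n : ℕ} (I J : WCube n) (i : Fin (n + 1))
    (h : 0 < (J.center i - J.len / 2) - (I.center i + I.len / 2)) :
    min I.len J.len ≤ (J.center i - J.len / 2) - (I.center i + I.len / 2) := by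
  have e : (J.center i - J.len / 2) - (I.center i + I.len / 2) =
      ((J.2 i : ℤ) : ℝ) * (2 : ℝ) ^ (-J.1) - ((I.2 i + 1 : ℤ) : ℝ) * (2 : ℝ) ^ (-I.1) := by
    rw [WCube.center_apply, WCube.center_apply, WCube.len, WCube.len]
    push_cast
    ring
  rw [e] at h ⊢
  rw [min_comm]
  exact dyadic_gap _ _ _ _ h

/-! ### Whitney cubes: distance to the boundary, exterior balls and overlaps. -/

section
variable {n : ℕ} {Ω : Set (Pt n)} {W : Set (WCube n)} {I J : WCube n} {x y z : Pt n} {t : ℝ}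

theorem IsWhitney.le_infDist (hW : IsWhitney Ω W) (hf : (frontier Ω).Nonempty) (hI : I ∈ W)
    (ht : t ≤ 1) (hz : z ∈ I.dilate (1 + t)) :
    4 * unitDiam n * I.len ≤ Metric.infDist z (frontier Ω) := by
  rw [Metric.le_infDist hf]
  intro y hy
  have := hW.lower I hI
  rw [I.diam_toSet] at this
  refine le_trans (by linarith) (setDist_le (I.dilate_mono (by linarith) hz) hy)

theorem IsWhitney.infDist_le (hW : IsWhitney Ω W) (hf : (frontier Ω).Nonempty) (hI : I ∈ W)
    (ht : t ≤ 1) (hz : z ∈ I.dilate (1 + t)) :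
    Metric.infDist z (frontier Ω) ≤ 42 * unitDiam n * I.len := by
  have h : setDist (I.dilate 1) (frontier Ω) ≤ 40 * (unitDiam n * I.len) := by
    rw [← I.diam_toSet]; exact hW.upper I hI
  have hpos : 0 < unitDiam n * I.len := mul_pos (unitDiam_pos n) I.len_pos
  -- The infimum in `setDist` is approached up to half a diameter: 40 + 1/2, plus 3/2 for the way
  -- from z to I, gives 42.
  obtain ⟨a, ha, b, hb, hab⟩ := exists_dist_lt_of_setDist_lt
    (d := 40 * (unitDiam n * I.len) + unitDiam n * I.len / 2)
    ⟨I.center, I.center_mem_dilate one_pos.le⟩ hf (by linarith)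
  have h1 := I.dist_le_of_mem_dilate hz ha
  have h2 := Metric.infDist_le_dist_of_mem (x := z) hb
  have h3 := dist_triangle z a b
  have h4 : unitDiam n * ((1 + t + 1) * I.len / 2) ≤ 3 / 2 * (unitDiam n * I.len) := by
    nlinarith
  nlinarith

theorem IsWhitney.dilate_subset (hW : IsWhitney Ω W) (hf : (frontier Ω).Nonempty) (hI : I ∈ W)
    (ht : t ≤ 1) : I.dilate (1 + t) ⊆ Ω := by
  intro z hz
  have hc : I.center ∈ Ω := by
    rw [← hW.cover]
    exact Set.mem_biUnion hI (I.center_mem_dilate one_pos.le)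
  have h1 := hW.le_infDist hf hI (t := 0) (by norm_num) (z := I.center)
    (I.center_mem_dilate (by norm_num))
  apply ball_infDist_frontier_subset hc
  rw [Metric.mem_ball]
  have h2 := I.dist_le_of_mem_dilate hz (I.center_mem_dilate (a := 0) le_rfl)
  have hpos : 0 < unitDiam n * I.len := mul_pos (unitDiam_pos n) I.len_pos
  nlinarith

theorem IsWhitney.exists_mem (hW : IsWhitney Ω W) (hx : x ∈ Ω) : ∃ I ∈ W, x ∈ I.toSet := by
  rw [← hW.cover] at hx
  simpa using hx

/-- The union of the open fattened cubes of the family `V`. -/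
def cubeUnion {n : ℕ} (V : Set (WCube n)) (t : ℝ) : Set (Pt n) := ⋃ I ∈ V, I.openDilate (1 + t)

theorem isOpen_cubeUnion (V : Set (WCube n)) (t : ℝ) : IsOpen (cubeUnion V t) :=
  isOpen_biUnion fun I _ => I.isOpen_openDilate _

theorem openDilate_subset_cubeUnion {V : Set (WCube n)} (hI : I ∈ V) :
    I.openDilate (1 + t) ⊆ cubeUnion V t := Set.subset_biUnion_of_mem (u := fun I : WCube n =>
      I.openDilate (1 + t)) hI

theorem mem_cubeUnion {V : Set (WCube n)} :
    x ∈ cubeUnion V t ↔ ∃ I ∈ V, x ∈ I.openDilate (1 + t) := by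
  simp [cubeUnion]

/-- Exterior corkscrew: a point of `Ω` outside of all open fattened cubes of a subfamily of `W` is
close to a ball missing all closed fattened cubes of the subfamily. -/
theorem IsWhitney.exists_ball_disjoint (hW : IsWhitney Ω W) (hf : (frontier Ω).Nonempty)
    {V : Set (WCube n)} (hV : V ⊆ W) (ht0 : 0 < t) (ht : t ≤ 1 / 64)
    (hxV : x ∉ cubeUnion V t) {s : ℝ} (hs : 0 < s) (hsδ : s ≤ Metric.infDist x (frontier Ω)) :
    ∃ y, Metric.ball y (s / (800 * unitDiam n)) ⊆ Metric.ball x s ∧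
      ∀ J ∈ V, Disjoint (Metric.ball y (s / (800 * unitDiam n))) (J.dilate (1 + t)) := by
  classical
  set κ := unitDiam n with hκ
  have hκ1 : 1 ≤ κ := one_le_unitDiam n
  set ε := s / (400 * κ) with hε
  have hε0 : 0 < ε := by positivity
  have hεκ : κ * ε = s / 400 := by rw [hε]; field_simp
  have hε2 : s / (800 * κ) = ε / 2 := by rw [hε]; field_simp; norm_num
  set δ := Metric.infDist x (frontier Ω) with hδ
  have hδ0 : 0 < δ := hs.trans_le hsδ
  -- Only cubes of size comparable to δ can meet the ball to be constructed.
  let near : WCube n → Prop := fun J => δ ≤ 43 * κ * J.len ∧ 3 * κ * J.len ≤ δ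
  -- Each coordinate of x is shifted by ε/2: downwards if some fattened cube of comparable size
  -- begins within ε above x, upwards otherwise.
  let low : Fin (n + 1) → Prop := fun i => ∃ J ∈ V, near J ∧
    x i ≤ J.center i - (1 + t) * J.len / 2 ∧ J.center i - (1 + t) * J.len / 2 ≤ x i + ε
  let v : Fin (n + 1) → ℝ := fun i => if low i then -1 else 1
  have hv : ∀ i, |v i| = 1 := by
    intro i
    by_cases h : low i <;> simp [v, h]
  set y : Pt n := WithLp.toLp 2 (fun i => x i + ε / 2 * v i) with hy
  have hyi : ∀ i, y i = x i + ε / 2 * v i := fun i => rfl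
  have hclose : ∀ w ∈ Metric.ball y (ε / 2), ∀ i, |w i - y i| < ε / 2 := fun w hw i =>
    (abs_sub_apply_le_dist w y i).trans_lt hw
  have hwx : ∀ w ∈ Metric.ball y (ε / 2), dist w x ≤ s / 400 := by
    intro w hw
    rw [← hεκ]
    apply dist_le_of_abs_sub_apply_le hε0.le
    intro i
    have h1 := hclose w hw i
    have h2 : |y i - x i| = ε / 2 := by
      rw [hyi, add_sub_cancel_left, abs_mul, hv, abs_of_pos (by positivity), mul_one]
    have := abs_sub_le (w i) (y i) (x i)
    linarith
  refine ⟨y, ?_, ?_⟩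
  · intro w hw
    rw [hε2] at hw
    rw [Metric.mem_ball]
    have := hwx w hw
    linarith
  · intro J hJ
    rw [hε2, Set.disjoint_left]
    intro w hw hwJ
    have hwd := hwx w hw
    have b1 := hW.le_infDist hf (hV hJ) (by linarith) hwJ
    have b2 := hW.infDist_le hf (hV hJ) (by linarith) hwJ
    have b3 : Metric.infDist w (frontier Ω) ≤ δ + dist w x := Metric.infDist_le_infDist_add_dist
    have b4 : δ ≤ Metric.infDist w (frontier Ω) + dist w x := by
      rw [dist_comm]; exact Metric.infDist_le_infDist_add_dist
    have hJl := J.len_pos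
    have hκl : 0 < κ * J.len := by positivity
    have hnear : near J := by
      constructor <;> nlinarith
    have hxJ : x ∉ J.openDilate (1 + t) := fun h => hxV (openDilate_subset_cubeUnion hJ h)
    simp only [WCube.openDilate, Set.mem_ofPred_eq, not_forall, not_lt] at hxJ
    obtain ⟨i, hi⟩ := hxJ
    have hwJi := abs_le.1 (hwJ i)
    have hci := abs_lt.1 (hclose w hw i)
    rw [hyi] at hci
    rcases le_abs.1 hi with hi | hi
    · by_cases hlow : low i
      · have hvi : v i = -1 := if_pos hlow
        rw [hvi] at hci
        obtain ⟨J', hJ', hnear', hl1, hl2⟩ := hlow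
        have hJl' := J'.len_pos
        -- Here x is pinched in direction i: the fattened J ends at most ε below x and the fattened
        -- J' begins at most ε above it. The faces of the original cubes would then have a positive
        -- gap of at most t(ℓ(J) + ℓ(J'))/2 + 2ε, which is less than the smaller side and
        -- contradicts `face_gap`.
        have g0 : (J'.center i - J'.len / 2) - (J.center i + J.len / 2) ≥ t * (J.len + J'.len) / 2 := by
          nlinarith
        have g1 : (J'.center i - J'.len / 2) - (J.center i + J.len / 2) ≤
            t * (J.len + J'.len) / 2 + 2 * ε := by
          nlinarith
        have g2 := WCube.face_gap J J' i (lt_of_lt_of_le (by positivity) g0)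
        have g3 := g2.trans g1
        have g4 : κ * min J.len J'.len ≤ κ * (t * (J.len + J'.len) / 2 + 2 * ε) := by gcongr
        have g5 : δ ≤ 43 * (κ * min J.len J'.len) := by
          rcases min_choice J.len J'.len with h | h <;> rw [h]
          · linarith [hnear.1]
          · linarith [hnear'.1]
        have g6 : t * (κ * (J.len + J'.len)) ≤ 1 / 64 * (2 / 3 * δ) := by
          have : κ * (J.len + J'.len) ≤ 2 / 3 * δ := by linarith [hnear.2, hnear'.2]
          exact mul_le_mul ht this (by positivity) (by norm_num)
        nlinarith
      · have hvi : v i = 1 := if_neg hlow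
        rw [hvi] at hci
        linarith
    -- If x lies below J in direction i, then J itself forces the downward shift, and the ball stays
    -- below J.
    · have hlow : low i := ⟨J, hJ, hnear, by linarith, by
        rcases abs_eq (by norm_num : (0 : ℝ) ≤ 1) |>.1 (hv i) with h | h <;> rw [h] at hci <;>
          linarith⟩
      have hvi : v i = -1 := if_pos hlow
      rw [hvi] at hci
      linarith

/-- An interior point of the union of closed cubes that lies in no open cube would have, inside any
neighborhood, a ball missing all closed cubes. -/
theorem IsWhitney.interior_iUnion_dilate (hW : IsWhitney Ω W) (hΩ : IsOpen Ω)
    (hf : (frontier Ω).Nonempty) {V : Set (WCube n)} (hV : V ⊆ W) (ht0 : 0 < t) (ht : t ≤ 1 / 64) :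
    interior (⋃ J ∈ V, J.dilate (1 + t)) = cubeUnion V t := by
  apply Set.Subset.antisymm
  · intro x hx
    by_contra hxV
    obtain ⟨r, hr, hball⟩ := Metric.mem_nhds_iff.1 (mem_interior_iff_mem_nhds.1 hx)
    have hxΩ : x ∈ Ω := by
      obtain ⟨J, hJ, hxJ⟩ := Set.mem_iUnion₂.1 (interior_subset hx)
      exact hW.dilate_subset hf (hV hJ) (by linarith) hxJ
    have hδ := infDist_frontier_pos hΩ hf hxΩ
    obtain ⟨y, hy, hd⟩ := hW.exists_ball_disjoint hf hV ht0 ht hxV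
      (s := min r (Metric.infDist x (frontier Ω))) (lt_min hr hδ) (min_le_right _ _)
    have hyy : y ∈ Metric.ball y (min r (Metric.infDist x (frontier Ω)) / (800 * unitDiam n)) :=
      Metric.mem_ball_self (div_pos (lt_min hr hδ) (mul_pos (by norm_num) (unitDiam_pos n)))
    obtain ⟨J, hJ, hyJ⟩ := Set.mem_iUnion₂.1
      (hball (Metric.ball_subset_ball (min_le_left _ _) (hy hyy)))
    exact Set.disjoint_left.1 (hd J hJ) hyy hyJ
  · refine interior_maximal ?_ (isOpen_cubeUnion V t)
    exact Set.iUnion₂_mono fun J _ => J.openDilate_subset _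

/-- Cones with vertex in an open cube over a ball inside the cube. -/
theorem WCube.ball_lineMap_subset {a s τ : ℝ} (hx : x ∈ J.openDilate a)
    (hz : ∀ i, |z i - J.center i| ≤ a * J.len / 2 - s) (hτ0 : 0 < τ) (hτ1 : τ ≤ 1) :
    Metric.ball (AffineMap.lineMap x z τ) (τ * s) ⊆ J.openDilate a := by
  intro w hw i
  have h1 := abs_lt.1 ((abs_sub_apply_le_dist w (AffineMap.lineMap x z τ) i).trans_lt hw)
  have h2 := abs_lt.1 (hx i)
  have h3 := abs_le.1 (hz i)
  have h4 : (AffineMap.lineMap x z τ : Pt n) i = (1 - τ) * x i + τ * z i := by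
    rw [AffineMap.lineMap_apply_module]; simp
  rw [h4] at h1
  rw [abs_lt]
  constructor
  · nlinarith [mul_nonneg (sub_nonneg.2 hτ1) (by linarith [h2.1] : 0 ≤ x i - J.center i + a * J.len / 2),
      mul_nonneg hτ0.le (by linarith [h3.1] : 0 ≤ z i - J.center i + (a * J.len / 2 - s))]
  · nlinarith [mul_nonneg (sub_nonneg.2 hτ1) (by linarith [h2.2] : 0 ≤ a * J.len / 2 - (x i - J.center i)),
      mul_nonneg hτ0.le (by linarith [h3.2] : 0 ≤ (a * J.len / 2 - s) - (z i - J.center i))]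

/-- Two intervals, one containing `x` and one containing `x'`, with a large overlap. -/
theorem exists_overlap_point {a₁ a₂ b₁ b₂ x x' d s : ℝ} (hx : a₁ ≤ x ∧ x ≤ a₂)
    (hx' : b₁ ≤ x' ∧ x' ≤ b₂) (hd : |x - x'| ≤ d) (hs : 0 ≤ s) (ha : 2 * s ≤ a₂ - a₁)
    (hb : 2 * s ≤ b₂ - b₁) (hab : 2 * s ≤ a₂ - b₁) (hba : 2 * s ≤ b₂ - a₁) :
    ∃ z, a₁ + s ≤ z ∧ z ≤ a₂ - s ∧ b₁ + s ≤ z ∧ z ≤ b₂ - s ∧ |z - x| ≤ d + s := by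
  obtain ⟨d1, d2⟩ := abs_le.1 hd
  -- The point `x` clamped to the intersection of the two intervals shrunk by `s`.
  refine ⟨max (max a₁ b₁ + s) (min x (min a₂ b₂ - s)), ?_⟩
  rcases max_cases a₁ b₁ with ⟨e1, _⟩ | ⟨e1, _⟩ <;> rcases min_cases a₂ b₂ with ⟨e2, _⟩ | ⟨e2, _⟩ <;>
    rw [e1, e2] <;>
    refine ⟨le_trans ?_ (le_max_left _ _), max_le ?_ ((min_le_right _ _).trans ?_),
      le_trans ?_ (le_max_left _ _), max_le ?_ ((min_le_right _ _).trans ?_), abs_le.2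
        ⟨?_, sub_le_iff_le_add.2 (max_le ?_ ((min_le_left _ _).trans ?_))⟩⟩ <;>
    first
      | linarith
      | (rw [neg_le_sub_iff_le_add]
         rcases min_cases x (a₂ - s) with ⟨e3, _⟩ | ⟨e3, _⟩ <;>
           rcases min_cases x (b₂ - s) with ⟨e4, _⟩ | ⟨e4, _⟩ <;>
           simp only [e3, e4] <;>
           first
             | linarith [le_max_right (a₁ + s) x, le_max_right (a₁ + s) (a₂ - s), le_max_right (a₁ + s) (b₂ - s)]
             | linarith [le_max_right (b₁ + s) x, le_max_right (b₁ + s) (a₂ - s), le_max_right (b₁ + s) (b₂ - s)])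

/-- Fattened Whitney cubes containing points close to each other have a large overlap near these
points. -/
theorem IsWhitney.exists_overlap (hW : IsWhitney Ω W) (hf : (frontier Ω).Nonempty) (hI : I ∈ W)
    (hJ : J ∈ W) (ht0 : 0 < t) (ht : t ≤ 1 / 256) (hx : x ∈ I.dilate (1 + t))
    (hy : y ∈ J.dilate (1 + t)) (hxy : 0 < dist x y) (hd : dist x y ≤ I.len / 56) :
    ∃ (z : Pt n) (s : ℝ), 0 < s ∧ s ≤ dist x y ∧ dist x y ≤ s / t ∧
      (∀ i, |z i - I.center i| ≤ (1 + t) * I.len / 2 - s) ∧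
      (∀ i, |z i - J.center i| ≤ (1 + t) * J.len / 2 - s) ∧
      dist x z ≤ 3 * unitDiam n * dist x y ∧ dist y z ≤ 3 * unitDiam n * dist x y := by
  set κ := unitDiam n with hκ
  have hκ1 : 1 ≤ κ := one_le_unitDiam n
  set d := dist x y with hdd
  have hIl := I.len_pos
  have hJl := J.len_pos
  have a1 := hW.le_infDist hf hI (by linarith) hx
  have a2 := hW.infDist_le hf hI (by linarith) hx
  have b1 := hW.le_infDist hf hJ (by linarith) hy
  have b2 := hW.infDist_le hf hJ (by linarith) hy
  have c1 : Metric.infDist x (frontier Ω) ≤ Metric.infDist y (frontier Ω) + d :=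
    Metric.infDist_le_infDist_add_dist
  have c2 : Metric.infDist y (frontier Ω) ≤ Metric.infDist x (frontier Ω) + d := by
    rw [hdd, dist_comm]; exact Metric.infDist_le_infDist_add_dist
  have r1 : I.len ≤ 14 * J.len := by
    have : κ * I.len ≤ κ * (14 * J.len) := by nlinarith
    exact le_of_mul_le_mul_left this (by positivity)
  have r2 : J.len ≤ 11 * I.len := by
    have : κ * J.len ≤ κ * (11 * I.len) := by nlinarith
    exact le_of_mul_le_mul_left this (by positivity)
  have hmin : I.len / 14 ≤ min I.len J.len := le_min (by linarith) (by linarith)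
  have htI : t * I.len ≤ 1 / 256 * I.len := by gcongr
  have htJ : t * J.len ≤ 1 / 256 * J.len := by gcongr
  have htI0 : 0 < t * I.len := by positivity
  have htJ0 : 0 < t * J.len := by positivity
  -- The assumption d ≤ ℓ(I)/56 gives t d ≤ s, so s is comparable to d; the first entry keeps 2s
  -- below the overlap t(ℓ(I) + ℓ(J))/2.
  set s := min (t * I.len / 56) d with hs
  have hs0 : 0 < s := lt_min (by positivity) hxy
  have hs1 : s ≤ t * I.len / 56 := min_le_left _ _
  have hsd : s ≤ d := min_le_right _ _
  have key : ∀ i, ∃ z, I.center i - (1 + t) * I.len / 2 + s ≤ z ∧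
      z ≤ I.center i + (1 + t) * I.len / 2 - s ∧ J.center i - (1 + t) * J.len / 2 + s ≤ z ∧
      z ≤ J.center i + (1 + t) * J.len / 2 - s ∧ |z - x i| ≤ d + s := by
    intro i
    have hxi := abs_le.1 (hx i)
    have hyi := abs_le.1 (hy i)
    have hdi : |x i - y i| ≤ d := abs_sub_apply_le_dist x y i
    have hdi' := abs_le.1 hdi
    -- A gap between the original cubes would be at least ℓ(I)/14, too much for d ≤ ℓ(I)/56 and t ≤
    -- 1/256. Hence their projections meet and the fattened projections overlap.
    have q1 : (J.center i - J.len / 2) - (I.center i + I.len / 2) ≤ 0 := by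
      by_contra hneg
      have := WCube.face_gap I J i (not_le.1 hneg)
      linarith
    have q2 : (I.center i - I.len / 2) - (J.center i + J.len / 2) ≤ 0 := by
      by_contra hneg
      have := WCube.face_gap J I i (not_le.1 hneg)
      rw [min_comm] at this
      linarith
    refine exists_overlap_point (x' := y i) ⟨by linarith, by linarith⟩ ⟨by linarith, by linarith⟩ hdi
      hs0.le ?_ ?_ ?_ ?_ <;> linarith
  choose f hf1 hf2 hf3 hf4 hf5 using key
  have hxz : dist x (WithLp.toLp 2 f : Pt n) ≤ κ * (2 * d) := by
    apply dist_le_of_abs_sub_apply_le (by positivity)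
    intro i
    rw [abs_sub_comm]
    have := hf5 i
    change |f i - x i| ≤ _
    linarith
  refine ⟨WithLp.toLp 2 f, s, hs0, hsd, ?_, ?_, ?_, ?_, ?_⟩
  · rw [le_div_iff₀ ht0]
    refine le_min ?_ ?_
    · calc d * t ≤ I.len / 56 * t := by gcongr
        _ = _ := by ring
    · nlinarith
  · intro i
    rw [abs_le]
    have h1 := hf1 i
    have h2 := hf2 i
    constructor <;> simp only <;> linarith
  · intro i
    rw [abs_le]
    have h1 := hf3 i
    have h2 := hf4 i
    constructor <;> simp only <;> linarith
  · nlinarith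
  · have := dist_triangle_left y (WithLp.toLp 2 f : Pt n) x
    nlinarith

end

/-! ### Capacity estimates -/

theorem enorm_sq_eq_ofReal {F : Type*} [NormedAddCommGroup F] (a : F) :
    ‖a‖ₑ ^ 2 = ENNReal.ofReal (‖a‖ ^ 2) := by
  rw [ENNReal.ofReal_pow (norm_nonneg _), ofReal_norm]

theorem lintegral_sq_eq_eLpNorm_sq {n : ℕ} {F : Type*} [NormedAddCommGroup F] (f : Pt n → F) :
    ∫⁻ X, ‖f X‖ₑ ^ 2 = eLpNorm f 2 volume ^ 2 := by
  have h := eLpNorm_nnreal_pow_eq_lintegral (f := f) (μ := (volume : Measure (Pt n)))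
    (p := 2) (by norm_num)
  have e : ((2 : NNReal) : ℝ≥0∞) = 2 := rfl
  have e' : ((2 : NNReal) : ℝ) = 2 := rfl
  rw [e, e'] at h
  simpa using h.symm

/-- Sobolev's inequality controls the norm of v in L^{p'}, and Hölder's inequality on the ball of
radius 2r, whose volume to the power 1/N is proportional to r, passes to L². -/
theorem exists_poincare_const {n : ℕ} (hn : 2 ≤ n) :
    ∃ P : ℝ≥0∞, P ≠ ⊤ ∧ ∀ (x : Pt n) (r : ℝ), 0 < r → ∀ v : Pt n → ℝ, ContDiff ℝ ∞ v →
      HasCompactSupport v → tsupport v ⊆ Metric.ball x (2 * r) →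
      ∫⁻ X, ‖v X‖ₑ ^ 2 ≤ P * ENNReal.ofReal r ^ 2 * ∫⁻ X, ‖fderiv ℝ v X‖ₑ ^ 2 := by
  set N : ℝ := (n : ℝ) + 1 with hN
  have hN3 : 3 ≤ N := by
    have : (2 : ℝ) ≤ n := by exact_mod_cast hn
    linarith
  have hfr : (Module.finrank ℝ (Pt n) : ℝ) = N := by simp [hN]
  -- The Sobolev conjugate of 2 in dimension N = n + 1; it is finite because N ≥ 3.
  set p' : NNReal := Real.toNNReal (1 / 2 - 1 / N)⁻¹ with hp'
  have hpos : 0 < 1 / 2 - 1 / N := by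
    have : 1 / N ≤ 1 / 3 := one_div_le_one_div_of_le (by norm_num) hN3
    linarith
  have hp'v : (p' : ℝ) = (1 / 2 - 1 / N)⁻¹ := Real.coe_toNNReal _ (inv_pos.2 hpos).le
  set S : NNReal := SNormLESNormFDerivOfEqConst ℝ (volume : Measure (Pt n)) 2
  set b : ℝ≥0∞ := volume (Metric.ball (0 : Pt n) 1) with hb
  have hbt : b ≠ ⊤ := measure_ball_lt_top.ne
  refine ⟨((S : ℝ≥0∞) * (2 * b ^ (1 / N))) ^ 2, ?_, ?_⟩
  · refine ENNReal.pow_ne_top (ENNReal.mul_ne_top ENNReal.coe_ne_top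
      (ENNReal.mul_ne_top (by simp) (ENNReal.rpow_ne_top_of_nonneg (by positivity) hbt)))
  intro x r hr v hv hvc hvs
  rw [lintegral_sq_eq_eLpNorm_sq, lintegral_sq_eq_eLpNorm_sq, ← mul_pow, ← mul_pow]
  gcongr
  have hsub : Function.support v ⊆ Metric.ball x (2 * r) := (subset_tsupport v).trans hvs
  have h1 : eLpNorm v 2 volume = eLpNorm v 2 (volume.restrict (Metric.ball x (2 * r))) :=
    (eLpNorm_restrict_eq_of_support_subset hsub).symm
  have h2 : eLpNorm v 2 (volume.restrict (Metric.ball x (2 * r))) ≤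
      eLpNorm v p' (volume.restrict (Metric.ball x (2 * r))) *
        (volume.restrict (Metric.ball x (2 * r))) Set.univ ^
          (1 / (2 : ℝ≥0∞).toReal - 1 / (p' : ℝ≥0∞).toReal) := by
    apply eLpNorm_le_eLpNorm_mul_rpow_measure_univ
    · have : (2 : NNReal) ≤ p' := by
        rw [← NNReal.coe_le_coe, hp'v]
        rw [le_inv_comm₀ (by norm_num) hpos]
        have : 0 < 1 / N := by positivity
        simp only [NNReal.coe_ofNat]; linarith
      exact_mod_cast this
    · exact hv.continuous.aestronglyMeasurable
  have h3 : eLpNorm v p' volume ≤ S * eLpNorm (fderiv ℝ v) (2 : NNReal) volume := by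
    refine eLpNorm_le_eLpNorm_fderiv_of_eq volume (p := 2) (p' := p')
      (hv.of_le (by exact_mod_cast le_top)) hvc ?_ ?_ ?_
    · norm_num
    · simp
    · rw [hp'v, hfr]; simp
  have h4 : volume (Metric.ball x (2 * r)) ^ (1 / N) = ENNReal.ofReal r * (2 * b ^ (1 / N)) := by
    rw [Measure.addHaar_ball volume x (by positivity : 0 ≤ 2 * r), ← hb,
      ENNReal.mul_rpow_of_nonneg _ _ (by positivity), ENNReal.ofReal_rpow_of_nonneg (by positivity)
      (by positivity)]
    have : ((2 * r) ^ Module.finrank ℝ (Pt n)) ^ (1 / N) = 2 * r := by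
      rw [← Real.rpow_natCast, hfr, ← Real.rpow_mul (by positivity)]
      rw [mul_one_div_cancel (by positivity), Real.rpow_one]
    rw [this, ENNReal.ofReal_mul (by norm_num)]
    simp only [ENNReal.ofReal_ofNat]
    ring
  have h5 : (1 / (2 : ℝ≥0∞).toReal - 1 / (p' : ℝ≥0∞).toReal) = 1 / N := by
    simp [hp'v]
  rw [h5, Measure.restrict_apply_univ, h4] at h2
  rw [h1]
  refine h2.trans ?_
  have h6 : eLpNorm v p' (volume.restrict (Metric.ball x (2 * r))) ≤
      S * eLpNorm (fderiv ℝ v) 2 volume :=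
    (eLpNorm_mono_measure _ Measure.restrict_le_self).trans h3
  calc _ ≤ (S * eLpNorm (fderiv ℝ v) 2 volume) * (ENNReal.ofReal r * (2 * b ^ (1 / N))) := by
        gcongr
    _ = _ := by ring

theorem exists_cutoff_const (n : ℕ) :
    ∃ b : ℝ, 0 < b ∧ ∀ (x : Pt n) (r : ℝ), 0 < r → ∃ φ : Pt n → ℝ, ContDiff ℝ ∞ φ ∧
      HasCompactSupport φ ∧ tsupport φ ⊆ Metric.ball x (2 * r) ∧
      (∀ y ∈ Metric.closedBall x r, φ y = 1) ∧ (∀ y, |φ y| ≤ 1) ∧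
      ∀ y, ‖fderiv ℝ φ y‖ ≤ b / r := by
  let f : ContDiffBump (0 : Pt n) := ⟨1, 3 / 2, by norm_num, by norm_num⟩
  have hf : ContDiff ℝ ∞ f := f.contDiff
  have hcont : Continuous (fderiv ℝ f) := hf.continuous_fderiv (by simp)
  have hcs : HasCompactSupport (fderiv ℝ f) := f.hasCompactSupport.fderiv ℝ
  obtain ⟨b, hb⟩ := hcs.exists_bound_of_continuous hcont
  refine ⟨max b 1, by positivity, fun x r hr => ?_⟩
  set g : Pt n → Pt n := fun y => r⁻¹ • (y - x) with hg
  have hgd : ContDiff ℝ ∞ g := (contDiff_id.sub contDiff_const).const_smul _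
  have hsupp : tsupport (fun y => f (g y)) ⊆ Metric.closedBall x (3 / 2 * r) := by
    apply closure_minimal _ Metric.isClosed_closedBall
    intro y hy
    by_contra h
    apply hy
    apply f.zero_of_le_dist
    rw [Metric.mem_closedBall, not_le, dist_eq_norm] at h
    change 3 / 2 ≤ dist (g y) 0
    rw [dist_zero_right, norm_smul, norm_inv, Real.norm_of_nonneg hr.le, inv_mul_eq_div,
      le_div_iff₀ hr]
    exact h.le
  refine ⟨fun y => f (g y), hf.comp hgd, ?_, ?_, ?_, ?_, ?_⟩
  · exact HasCompactSupport.of_support_subset_isCompact (isCompact_closedBall x (3 / 2 * r))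
      ((subset_tsupport _).trans hsupp)
  · exact hsupp.trans (Metric.closedBall_subset_ball (by linarith))
  · intro y hy
    apply f.one_of_mem_closedBall
    rw [Metric.mem_closedBall, dist_eq_norm] at hy
    change dist (g y) 0 ≤ 1
    rw [dist_zero_right, norm_smul, norm_inv, Real.norm_of_nonneg hr.le, inv_mul_eq_div,
      div_le_one hr]
    exact hy
  · intro y
    rw [abs_of_nonneg f.nonneg]
    exact f.le_one
  · intro y
    have hg' : HasFDerivAt g (r⁻¹ • ContinuousLinearMap.id ℝ (Pt n)) y :=
      ((hasFDerivAt_id y).sub_const x).const_smul r⁻¹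
    have hf' := (hf.differentiable (by simp) (g y)).hasFDerivAt
    have := (hf'.comp y hg').fderiv
    change ‖fderiv ℝ (f ∘ g) y‖ ≤ _
    rw [this, ContinuousLinearMap.comp_smul, ContinuousLinearMap.comp_id, norm_smul, norm_inv,
      Real.norm_of_nonneg hr.le, inv_mul_eq_div]
    gcongr
    exact (hb _).trans (le_max_left _ _)

/-- The class of competitors in the definition of the capacity. -/
def IsCompetitor {n : ℕ} (K D : Set (Pt n)) (v : Pt n → ℝ) : Prop :=
  ContDiff ℝ ∞ v ∧ HasCompactSupport v ∧ tsupport v ⊆ D ∧ ∀ x ∈ K, 1 ≤ v x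

theorem setLIntegral_fderiv_eq {n : ℕ} {v : Pt n → ℝ} {D : Set (Pt n)} (h : tsupport v ⊆ D) :
    ∫⁻ X in D, ‖fderiv ℝ v X‖ₑ ^ 2 = ∫⁻ X, ‖fderiv ℝ v X‖ₑ ^ 2 := by
  apply setLIntegral_eq_of_support_subset
  intro X hX
  apply h
  apply support_fderiv_subset ℝ
  intro h0
  apply hX
  simp only [h0, enorm_sq_eq_ofReal, norm_zero]
  simp

theorem cap₂_le {n : ℕ} {K D : Set (Pt n)} {v : Pt n → ℝ} (h : IsCompetitor K D v) :
    cap₂ K D ≤ ∫⁻ X, ‖fderiv ℝ v X‖ₑ ^ 2 := by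
  rw [← setLIntegral_fderiv_eq h.2.2.1]
  exact iInf₂_le v h

theorem le_cap₂ {n : ℕ} {K D : Set (Pt n)} {a : ℝ≥0∞}
    (h : ∀ v, IsCompetitor K D v → a ≤ ∫⁻ X, ‖fderiv ℝ v X‖ₑ ^ 2) : a ≤ cap₂ K D := by
  refine le_iInf₂ fun v hv => ?_
  rw [setLIntegral_fderiv_eq hv.2.2.1]
  exact h v hv

theorem cap₂_mono {n : ℕ} {K K' D : Set (Pt n)} (h : K ⊆ K') : cap₂ K D ≤ cap₂ K' D :=
  le_cap₂ fun _ hv => cap₂_le ⟨hv.1, hv.2.1, hv.2.2.1, fun x hx => hv.2.2.2 x (h hx)⟩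

theorem volume_ball_eq {n : ℕ} (x : Pt n) {r : ℝ} (hr : 0 ≤ r) :
    volume (Metric.ball x r) =
      ENNReal.ofReal (r ^ (n + 1) * (volume (Metric.ball (0 : Pt n) 1)).toReal) := by
  rw [Measure.addHaar_ball volume x hr, ENNReal.ofReal_mul (by positivity),
    ENNReal.ofReal_toReal measure_ball_lt_top.ne]
  simp

theorem exists_poincare_real {n : ℕ} (hn : 2 ≤ n) :
    ∃ P : ℝ, 0 < P ∧ ∀ (x : Pt n) (r : ℝ), 0 < r → ∀ v : Pt n → ℝ, ContDiff ℝ ∞ v →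
      HasCompactSupport v → tsupport v ⊆ Metric.ball x (2 * r) →
      ∫⁻ X, ‖v X‖ₑ ^ 2 ≤ ENNReal.ofReal (P * r ^ 2) * ∫⁻ X, ‖fderiv ℝ v X‖ₑ ^ 2 := by
  obtain ⟨P, hP, h⟩ := exists_poincare_const hn
  refine ⟨P.toReal + 1, by positivity, fun x r hr v h1 h2 h3 => (h x r hr v h1 h2 h3).trans ?_⟩
  rw [ENNReal.ofReal_mul (by positivity), ENNReal.ofReal_pow hr.le]
  gcongr
  rw [ENNReal.le_ofReal_iff_toReal_le hP (by positivity)]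
  linarith

theorem exists_cap₂_closedBall_le (n : ℕ) :
    ∃ u : ℝ, 0 < u ∧ ∀ (x : Pt n) (r : ℝ), 0 < r →
      cap₂ (Metric.closedBall x r) (Metric.ball x (2 * r)) ≤
        ENNReal.ofReal (u * (r ^ (n + 1) / r ^ 2)) := by
  obtain ⟨b, hb, h⟩ := exists_cutoff_const n
  set β := (volume (Metric.ball (0 : Pt n) 1)).toReal with hβ
  have hβ0 : 0 ≤ β := ENNReal.toReal_nonneg
  refine ⟨b ^ 2 * 2 ^ (n + 1) * β + 1, by positivity, fun x r hr => ?_⟩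
  obtain ⟨φ, h1, h2, h3, h4, h5, h6⟩ := h x r hr
  have hcomp : IsCompetitor (Metric.closedBall x r) (Metric.ball x (2 * r)) φ :=
    ⟨h1, h2, h3, fun y hy => (h4 y hy).ge⟩
  refine (cap₂_le hcomp).trans ?_
  rw [← setLIntegral_fderiv_eq h3]
  have h7 : ∫⁻ X in Metric.ball x (2 * r), ‖fderiv ℝ φ X‖ₑ ^ 2 ≤
      ∫⁻ X in Metric.ball x (2 * r), ENNReal.ofReal ((b / r) ^ 2) := by
    apply lintegral_mono
    intro X
    simp only
    rw [enorm_sq_eq_ofReal]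
    apply ENNReal.ofReal_le_ofReal
    gcongr
    exact h6 X
  refine h7.trans ?_
  rw [setLIntegral_const, volume_ball_eq x (by positivity), ← ENNReal.ofReal_mul (by positivity)]
  apply ENNReal.ofReal_le_ofReal
  rw [← hβ]
  have : 0 ≤ r ^ (n + 1) / r ^ 2 := by positivity
  calc _ = b ^ 2 * 2 ^ (n + 1) * β * (r ^ (n + 1) / r ^ 2) := by rw [mul_pow, div_pow]; ring
    _ ≤ _ := by nlinarith

/-- A competitor is at least 1 on the small ball, so its squared L² norm is at least the volume of
that ball; the Poincaré inequality at scale r turns this into a bound for the energy. The position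
of y relative to x plays no role. -/
theorem exists_le_cap₂_closedBall {n : ℕ} (hn : 2 ≤ n) :
    ∃ l : ℝ, 0 < l ∧ ∀ (x y : Pt n) (r ρ : ℝ), 0 < r → 0 < ρ →
      ENNReal.ofReal (l * (ρ ^ (n + 1) / r ^ 2)) ≤
        cap₂ (Metric.closedBall y ρ) (Metric.ball x (2 * r)) := by
  obtain ⟨P, hP, h⟩ := exists_poincare_real hn
  set β := (volume (Metric.ball (0 : Pt n) 1)).toReal with hβ
  have hβ0 : 0 < β :=
    ENNReal.toReal_pos (Metric.measure_ball_pos volume _ one_pos).ne' measure_ball_lt_top.ne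
  refine ⟨β / P, by positivity, fun x y r ρ hr hρ => le_cap₂ fun v hv => ?_⟩
  have h1 := h x r hr v hv.1 hv.2.1 hv.2.2.1
  have h2 : ENNReal.ofReal (ρ ^ (n + 1) * β) ≤ ∫⁻ X, ‖v X‖ₑ ^ 2 := by
    rw [← volume_ball_eq y hρ.le]
    calc volume (Metric.ball y ρ) = ∫⁻ X in Metric.ball y ρ, 1 := by simp
      _ ≤ ∫⁻ X in Metric.ball y ρ, ‖v X‖ₑ ^ 2 := by
          apply setLIntegral_mono' measurableSet_ball
          intro X hX
          have := hv.2.2.2 X (Metric.ball_subset_closedBall hX)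
          rw [enorm_sq_eq_ofReal, ← ENNReal.ofReal_one]
          apply ENNReal.ofReal_le_ofReal
          rw [Real.norm_eq_abs, sq_abs]
          nlinarith
      _ ≤ _ := setLIntegral_le_lintegral _ _
  have h3 := h2.trans h1
  have h4 : (β / P * (ρ ^ (n + 1) / r ^ 2)) = (P * r ^ 2)⁻¹ * (ρ ^ (n + 1) * β) := by
    field_simp
  rw [h4, ENNReal.ofReal_mul (by positivity), ENNReal.ofReal_inv_of_pos (by positivity)]
  rw [ENNReal.inv_mul_le_iff (by simp; positivity) (by simp)]
  exact h3

/-- A competitor v for the ball of radius 2r, multiplied by a cutoff φ at scale r', becomes one for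
the ball of radius 2r'. The energy of φv is bounded by that of v and by ∫v²/r'², and the Poincaré
inequality controls the latter at the cost of (r/r')². -/
theorem exists_cap₂_le_cap₂ {n : ℕ} (hn : 2 ≤ n) :
    ∃ m : ℝ, 0 < m ∧ ∀ (x x' : Pt n) (r r' : ℝ) (K : Set (Pt n)), 0 < r' → r' ≤ r →
      K ⊆ Metric.closedBall x' r' →
      cap₂ K (Metric.ball x' (2 * r')) ≤
        ENNReal.ofReal (m * (r / r') ^ 2) * cap₂ K (Metric.ball x (2 * r)) := by
  obtain ⟨P, hP, h⟩ := exists_poincare_real hn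
  obtain ⟨b, hb, hcut⟩ := exists_cutoff_const n
  refine ⟨2 + 2 * b ^ 2 * P, by positivity, fun x x' r r' K hr' hrr hK => ?_⟩
  have hr : 0 < r := hr'.trans_le hrr
  obtain ⟨φ, h1, h2, h3, h4, h5, h6⟩ := hcut x' r' hr'
  set c := (2 + 2 * b ^ 2 * P) * (r / r') ^ 2 with hc
  have hcpos : 0 < c := by positivity
  -- The constant is moved to the left so that the infimum over competitors stands alone on the
  -- right.
  rw [← ENNReal.inv_mul_le_iff (by simp [hcpos]) (by simp)]
  refine le_cap₂ fun v hv => ?_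
  rw [ENNReal.inv_mul_le_iff (by simp [hcpos]) (by simp)]
  have hcomp : IsCompetitor K (Metric.ball x' (2 * r')) (fun y => φ y * v y) := by
    refine ⟨h1.mul hv.1, h2.mul_right, (tsupport_mul_subset_left).trans h3, fun y hy => ?_⟩
    simp only [h4 y (hK hy), one_mul]
    exact hv.2.2.2 y hy
  refine (cap₂_le hcomp).trans ?_
  have key : ∀ X, ‖fderiv ℝ (fun y => φ y * v y) X‖ₑ ^ 2 ≤
      ENNReal.ofReal 2 * ‖fderiv ℝ v X‖ₑ ^ 2 + ENNReal.ofReal (2 * (b / r') ^ 2) * ‖v X‖ₑ ^ 2 := by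
    intro X
    simp only [enorm_sq_eq_ofReal]
    rw [← ENNReal.ofReal_mul (by positivity), ← ENNReal.ofReal_mul (by positivity),
      ← ENNReal.ofReal_add (by positivity) (by positivity)]
    apply ENNReal.ofReal_le_ofReal
    rw [fderiv_fun_mul (h1.differentiable (by simp) X) (hv.1.differentiable (by simp) X)]
    have ha : ‖φ X • fderiv ℝ v X‖ ≤ ‖fderiv ℝ v X‖ := by
      rw [norm_smul]
      exact mul_le_of_le_one_left (norm_nonneg _) (h5 X)
    have hb' : ‖v X • fderiv ℝ φ X‖ ≤ (b / r') * ‖v X‖ := by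
      rw [norm_smul, mul_comm]
      exact mul_le_mul_of_nonneg_right (h6 X) (norm_nonneg _)
    have hab := (norm_add_le (φ X • fderiv ℝ v X) (v X • fderiv ℝ φ X)).trans (add_le_add ha hb')
    have := pow_le_pow_left₀ (norm_nonneg _) hab 2
    refine this.trans ?_
    nlinarith [sq_nonneg (‖fderiv ℝ v X‖ - (b / r') * ‖v X‖)]
  have hm : Measurable fun X => ‖fderiv ℝ v X‖ₑ ^ 2 :=
    ((hv.1.continuous_fderiv (by simp)).enorm.measurable.pow_const 2)
  have h8 := h x r hr v hv.1 hv.2.1 hv.2.2.1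
  calc ∫⁻ X, ‖fderiv ℝ (fun y => φ y * v y) X‖ₑ ^ 2
      ≤ ∫⁻ X, (ENNReal.ofReal 2 * ‖fderiv ℝ v X‖ₑ ^ 2 +
          ENNReal.ofReal (2 * (b / r') ^ 2) * ‖v X‖ₑ ^ 2) := lintegral_mono key
    _ = ENNReal.ofReal 2 * (∫⁻ X, ‖fderiv ℝ v X‖ₑ ^ 2) +
          ENNReal.ofReal (2 * (b / r') ^ 2) * ∫⁻ X, ‖v X‖ₑ ^ 2 := by
        rw [lintegral_add_left (hm.const_mul _), lintegral_const_mul' _ _ ENNReal.ofReal_ne_top,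
          lintegral_const_mul' _ _ ENNReal.ofReal_ne_top]
    _ ≤ ENNReal.ofReal 2 * (∫⁻ X, ‖fderiv ℝ v X‖ₑ ^ 2) +
          ENNReal.ofReal (2 * (b / r') ^ 2) *
            (ENNReal.ofReal (P * r ^ 2) * ∫⁻ X, ‖fderiv ℝ v X‖ₑ ^ 2) := by gcongr
    _ = ENNReal.ofReal (2 + 2 * (b / r') ^ 2 * (P * r ^ 2)) * ∫⁻ X, ‖fderiv ℝ v X‖ₑ ^ 2 := by
        rw [ENNReal.ofReal_add (by positivity) (by positivity), add_mul,
          ENNReal.ofReal_mul (p := 2 * (b / r') ^ 2) (by positivity), mul_assoc]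
    _ ≤ _ := by
        gcongr
        have : 1 ≤ (r / r') ^ 2 := one_le_pow₀ ((one_le_div hr').2 hrr)
        rw [hc, add_mul]
        have e : 2 * (b / r') ^ 2 * (P * r ^ 2) = 2 * b ^ 2 * P * (r / r') ^ 2 := by
          rw [div_pow, div_pow]; ring
        rw [e]
        linarith

/-- Capacity density at a scale from capacity density at a comparable scale inside. -/
theorem exists_cap_ratio_of_cap_ratio {n : ℕ} (hn : 2 ≤ n) {θ c₁ : ℝ} (hθ : 0 < θ) (hθ1 : θ ≤ 1)
    (hc₁ : 0 < c₁) :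
    ∃ c : ℝ, 0 < c ∧ ∀ (x x' : Pt n) (r : ℝ) (K K' : Set (Pt n)), 0 < r → K' ⊆ K →
      K' ⊆ Metric.closedBall x' (θ * r) →
      ENNReal.ofReal c₁ ≤ cap₂ K' (Metric.ball x' (2 * (θ * r))) /
        cap₂ (Metric.closedBall x' (θ * r)) (Metric.ball x' (2 * (θ * r))) →
      ENNReal.ofReal c ≤ cap₂ K (Metric.ball x (2 * r)) /
        cap₂ (Metric.closedBall x r) (Metric.ball x (2 * r)) := by
  obtain ⟨u, hu, hu'⟩ := exists_cap₂_closedBall_le n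
  obtain ⟨l, hl, hl'⟩ := exists_le_cap₂_closedBall hn
  obtain ⟨m, hm, hm'⟩ := exists_cap₂_le_cap₂ hn
  -- The reference capacity of the small ball is bounded below by `l`, the passage to the large ball
  -- costs m(1/θ)², and the reference capacity of the large ball is bounded above by `u`; the common
  -- factor r^{n+1}/r² cancels.
  refine ⟨c₁ * (l * (θ ^ (n + 1) / θ ^ 2)) / (m * (1 / θ) ^ 2 * u), by positivity, ?_⟩
  intro x x' r K K' hr hKK hK' hcd
  have hr' : 0 < θ * r := by positivity
  set q := r ^ (n + 1) / r ^ 2 with hq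
  have hq0 : 0 < q := by positivity
  have hq' : (θ * r) ^ (n + 1) / (θ * r) ^ 2 = (θ ^ (n + 1) / θ ^ 2) * q := by
    rw [hq, mul_pow, mul_pow]; field_simp
  have e1 := hl' x' x' (θ * r) (θ * r) hr' hr'
  have e2 := hu' x r hr
  have e3 := hm' x x' r (θ * r) K' hr' (by nlinarith) hK'
  have e3' := e3.trans (mul_le_mul_right (cap₂_mono (D := Metric.ball x (2 * r)) hKK) _)
  have hne : cap₂ (Metric.closedBall x' (θ * r)) (Metric.ball x' (2 * (θ * r))) ≠ 0 := by
    refine ((ENNReal.ofReal_pos.2 ?_).trans_le e1).ne'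
    positivity
  have hnt : cap₂ (Metric.closedBall x' (θ * r)) (Metric.ball x' (2 * (θ * r))) ≠ ⊤ :=
    ((hu' x' (θ * r) hr').trans_lt ENNReal.ofReal_lt_top).ne
  rw [ENNReal.le_div_iff_mul_le (Or.inl hne) (Or.inl hnt)] at hcd
  have e4 : ENNReal.ofReal (c₁ * (l * (θ ^ (n + 1) / θ ^ 2)) * q) ≤
      ENNReal.ofReal (m * (1 / θ) ^ 2) * cap₂ K (Metric.ball x (2 * r)) := by
    have : r / (θ * r) = 1 / θ := by field_simp
    rw [this] at e3'
    refine le_trans ?_ (hcd.trans e3')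
    rw [hq'] at e1
    refine le_trans ?_ (mul_le_mul_right e1 _)
    rw [← ENNReal.ofReal_mul (by positivity)]
    apply le_of_eq; congr 1; ring
  refine (ENNReal.le_div_iff_mul_le (Or.inr ?_) (Or.inl ?_)).2 ?_
  · intro h0
    rw [h0, mul_zero] at e4
    have : 0 < c₁ * (l * (θ ^ (n + 1) / θ ^ 2)) * q := by positivity
    exact absurd e4 (by simpa using this)
  · exact (e2.trans_lt ENNReal.ofReal_lt_top).ne
  · refine (mul_le_mul_right e2 _).trans ?_
    have hM : 0 < m * (1 / θ) ^ 2 := by positivity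
    rw [← ENNReal.inv_mul_le_iff (ENNReal.ofReal_pos.2 hM).ne' (by simp)] at e4
    refine le_trans (le_of_eq ?_) e4
    rw [← ENNReal.ofReal_inv_of_pos hM, ← ENNReal.ofReal_mul (by positivity),
      ← ENNReal.ofReal_mul (by positivity)]
    congr 1
    rw [← hq]
    field_simp

/-- Capacity density at a scale from a ball of comparable radius in the complement. -/
theorem exists_cap_ratio_of_ball {n : ℕ} (hn : 2 ≤ n) {θ : ℝ} (hθ : 0 < θ) :
    ∃ c : ℝ, 0 < c ∧ ∀ (x y : Pt n) (r : ℝ) (K : Set (Pt n)), 0 < r →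
      Metric.closedBall y (θ * r) ⊆ K →
      ENNReal.ofReal c ≤ cap₂ K (Metric.ball x (2 * r)) /
        cap₂ (Metric.closedBall x r) (Metric.ball x (2 * r)) := by
  obtain ⟨u, hu, hu'⟩ := exists_cap₂_closedBall_le n
  obtain ⟨l, hl, hl'⟩ := exists_le_cap₂_closedBall hn
  refine ⟨l * θ ^ (n + 1) / u, by positivity, fun x y r K hr hK => ?_⟩
  have e1 := (hl' x y r (θ * r) hr (by positivity)).trans (cap₂_mono hK)
  have e2 := hu' x r hr
  have h0 : 0 < l * ((θ * r) ^ (n + 1) / r ^ 2) := by positivity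
  refine (ENNReal.le_div_iff_mul_le (Or.inr ((ENNReal.ofReal_pos.2 h0).trans_le e1).ne')
    (Or.inl (e2.trans_lt ENNReal.ofReal_lt_top).ne)).2 ?_
  refine (mul_le_mul_right e2 _).trans (le_trans (le_of_eq ?_) e1)
  rw [← ENNReal.ofReal_mul (by positivity)]
  congr 1
  rw [mul_pow]
  field_simp

/-! ### Harnack chains and Whitney regions -/

/-- The conditions on a single ball of a Harnack chain. -/
def IsHarnackBall {n : ℕ} (Ω : Set (Pt n)) (C₂ : ℝ) (B : Pt n × ℝ) : Prop :=
  0 < B.2 ∧ Metric.ball B.1 B.2 ⊆ Ω ∧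
    C₂⁻¹ * (2 * B.2) ≤ setDist (Metric.ball B.1 B.2) (frontier Ω) ∧
    setDist (Metric.ball B.1 B.2) (frontier Ω) ≤ C₂ * (2 * B.2)

section
variable {n : ℕ} {Ω : Set (Pt n)} {C₁ C₂ : ℝ} {B B' : Pt n × ℝ} {w : Pt n}

theorem IsHarnackBall.two_mul_le (h : IsHarnackBall Ω C₂ B) (hf : (frontier Ω).Nonempty)
    (hC : 1 < C₂) (hw : w ∈ Metric.ball B.1 B.2) :
    2 * B.2 ≤ C₂ * Metric.infDist w (frontier Ω) := by
  have h1 := h.2.2.1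
  rw [inv_mul_le_iff₀ (by linarith)] at h1
  refine h1.trans (mul_le_mul_of_nonneg_left ?_ (by linarith))
  rw [Metric.le_infDist hf]
  intro y hy
  exact setDist_le hw hy

theorem IsHarnackBall.infDist_le (h : IsHarnackBall Ω C₂ B) (hf : (frontier Ω).Nonempty)
    (hw : w ∈ Metric.ball B.1 B.2) :
    Metric.infDist w (frontier Ω) ≤ 2 * (C₂ + 1) * B.2 := by
  refine le_of_forall_pos_le_add fun ε hε => ?_
  obtain ⟨a, ha, b, hb, hab⟩ := exists_dist_lt_of_setDist_lt ⟨w, hw⟩ hf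
    (lt_of_le_of_lt h.2.2.2 (lt_add_of_pos_right _ hε))
  have h1 := Metric.infDist_le_dist_of_mem (x := w) hb
  have h2 := dist_triangle w a b
  have h3 := dist_triangle_right w a B.1
  rw [Metric.mem_ball] at hw ha
  linarith

theorem IsHarnackBall.radius_le (h : IsHarnackBall Ω C₂ B) (h' : IsHarnackBall Ω C₂ B')
    (hf : (frontier Ω).Nonempty) (hC : 1 < C₂)
    (hne : (Metric.ball B.1 B.2 ∩ Metric.ball B'.1 B'.2).Nonempty) :
    B'.2 ≤ C₂ * (C₂ + 1) * B.2 := by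
  obtain ⟨w, hw, hw'⟩ := hne
  have h1 := h'.two_mul_le hf hC hw'
  have h2 := h.infDist_le hf hw
  nlinarith [h.1]

/-- Intersecting balls of a chain have radii comparable up to the factor Λ = C₂(C₂ + 1), by
`IsHarnackBall.radius_le`; this is iterated along the list. -/
theorem harnackBalls_bounds (hf : (frontier Ω).Nonempty) (hC : 1 < C₂) (L : List (Pt n × ℝ)) :
    ∀ B₀ : Pt n × ℝ, (∀ B ∈ B₀ :: L, IsHarnackBall Ω C₂ B) →
      (B₀ :: L).IsChain (fun B B' => (Metric.ball B.1 B.2 ∩ Metric.ball B'.1 B'.2).Nonempty) →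
      ∀ B ∈ B₀ :: L, B.2 ≤ (C₂ * (C₂ + 1)) ^ L.length * B₀.2 ∧
        B₀.2 ≤ (C₂ * (C₂ + 1)) ^ L.length * B.2 ∧
        ∀ w ∈ Metric.ball B.1 B.2, ∀ w₀ ∈ Metric.ball B₀.1 B₀.2,
          dist w w₀ ≤ 2 * (L.length + 1) * (C₂ * (C₂ + 1)) ^ L.length * B₀.2 := by
  set Λ := C₂ * (C₂ + 1) with hΛ
  have hΛ1 : 1 ≤ Λ := by nlinarith
  have base : ∀ (L : List (Pt n × ℝ)) (B₀ : Pt n × ℝ), IsHarnackBall Ω C₂ B₀ →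
      B₀.2 ≤ Λ ^ L.length * B₀.2 ∧ B₀.2 ≤ Λ ^ L.length * B₀.2 ∧
        ∀ w ∈ Metric.ball B₀.1 B₀.2, ∀ w₀ ∈ Metric.ball B₀.1 B₀.2,
          dist w w₀ ≤ 2 * (L.length + 1) * Λ ^ L.length * B₀.2 := by
    intro L B₀ hB₀
    have hp : 1 ≤ Λ ^ L.length := one_le_pow₀ hΛ1
    have h0 := hB₀.1
    have h1 : B₀.2 ≤ Λ ^ L.length * B₀.2 := by nlinarith
    refine ⟨h1, h1, fun w hw w₀ hw₀ => ?_⟩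
    have h2 := dist_triangle_right w w₀ B₀.1
    rw [Metric.mem_ball] at hw hw₀
    have h3 : 0 ≤ (L.length : ℝ) * (Λ ^ L.length * B₀.2) := by positivity
    nlinarith
  induction L with
  | nil =>
    intro B₀ hB _ B hBm
    obtain rfl : B = B₀ := by simpa using hBm
    exact base [] B (hB B hBm)
  | cons B₁ L ih =>
    intro B₀ hB hc B hBm
    have hB₀ := hB B₀ (by simp)
    rcases List.mem_cons.1 hBm with rfl | hBm'
    · exact base (B₁ :: L) B hB₀
    · have hB₁ := hB B₁ (by simp)
      rw [List.isChain_cons_cons] at hc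
      obtain ⟨h1, h2, h3⟩ := ih B₁ (fun B h => hB B (List.mem_cons_of_mem _ h)) hc.2 B hBm'
      have r1 := hB₀.radius_le hB₁ hf hC hc.1
      have r2 := hB₁.radius_le hB₀ hf hC (by rw [Set.inter_comm]; exact hc.1)
      rw [← hΛ] at r1 r2
      have hp : 1 ≤ Λ ^ L.length := one_le_pow₀ hΛ1
      have h0 := hB₀.1
      have hl : ((B₁ :: L).length : ℝ) = L.length + 1 := by simp
      rw [hl]
      rw [List.length_cons, pow_succ]
      have e1 : Λ ^ L.length * B₁.2 ≤ Λ ^ L.length * Λ * B₀.2 := by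
        rw [mul_assoc]; gcongr
      refine ⟨h1.trans e1, ?_, fun w hw w₀ hw₀ => ?_⟩
      · calc B₀.2 ≤ Λ * B₁.2 := r2
          _ ≤ Λ * (Λ ^ L.length * B.2) := by gcongr
          _ = _ := by ring
      · obtain ⟨v, hv₀, hv₁⟩ := hc.1
        have h4 := h3 w hw v hv₁
        have h5 := dist_triangle_right v w₀ B₀.1
        have h6 := dist_triangle w v w₀
        rw [Metric.mem_ball] at hv₀ hw₀
        have h7 : B₀.2 ≤ Λ ^ L.length * Λ * B₀.2 := by
          have : 1 ≤ Λ ^ L.length * Λ := by nlinarith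
          nlinarith
        have h8 : 2 * ((L.length : ℝ) + 1) * Λ ^ L.length * B₁.2 ≤
            2 * (L.length + 1) * (Λ ^ L.length * Λ * B₀.2) := by
          rw [mul_assoc]; gcongr
        nlinarith

/-- A chain from a point to itself contains a ball of positive radius, which must have positive
`setDist` to the frontier. For an empty frontier `setDist` is the infimum of the empty set, which is
0. -/
theorem HarnackChainCondition.frontier_nonempty (h : HarnackChainCondition Ω C₁ C₂)
    (hne : Ω.Nonempty) : (frontier Ω).Nonempty := by
  obtain ⟨x, hx⟩ := hne
  obtain ⟨-, hC, h⟩ := h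
  obtain ⟨L, hL, ⟨B, hB, -⟩, -⟩ := h x hx x hx
  have hBL := hL B (List.mem_of_mem_head? hB)
  by_contra hemp
  rw [Set.not_nonempty_iff_eq_empty] at hemp
  have h1 := hBL.2.2.1
  have h0 := hBL.1
  rw [hemp] at h1
  have : setDist (Metric.ball B.1 B.2) ∅ = 0 := by simp [setDist]
  rw [this] at h1
  have : 0 < C₂⁻¹ * (2 * B.2) := by have : 0 < C₂ := by linarith
                                    positivity
  linarith

end

theorem Cube.len_pos {n : ℕ} (Q : Cube n) : 0 < Q.len := zpow_pos (by norm_num) _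

section
variable {n : ℕ} {Ω : Set (Pt n)} {c₀ C₁ C₂ C A K : ℝ} {m₀ : ℕ}
  (S : Construction Ω c₀ C₁ C₂ C A m₀ K) {Q Q' : Cube n} {I J : WCube n}

namespace Construction

/-- The center of a cube of the grid. -/
def ctr (Q : Cube n) : Pt n := S.grid.center Q.1 Q.2

theorem ctr_mem_frontier (hQ : Q ∈ S.𝔻) : S.ctr Q ∈ frontier Ω := S.grid.center_mem _ _ hQ.1

theorem ctr_mem (hC : 1 ≤ C) (hQ : Q ∈ S.𝔻) : S.ctr Q ∈ Q.2 := by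
  refine S.grid.inner _ _ hQ.1 ⟨Metric.mem_ball_self ?_, S.ctr_mem_frontier hQ⟩
  have := Q.len_pos
  rw [Cube.len] at this
  positivity

theorem dist_ctr_lt (hQ : Q ∈ S.𝔻) {x : Pt n} (hx : x ∈ Q.2) : dist x (S.ctr Q) < C * Q.len :=
  (S.grid.outer _ _ hQ.1 hx).1

theorem X_mem (hc₀ : 0 < c₀) (hC : 1 ≤ C) (hA : 1 ≤ A) (hQ : Q ∈ S.𝔻) :
    S.X Q ∈ Ω ∧ dist (S.X Q) (S.ctr Q) < Q.len / 2 := by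
  have hl := Q.len_pos
  obtain ⟨h1, h2⟩ := S.corkscrew Q hQ (Metric.mem_ball_self (by positivity))
  refine ⟨h2, h1.trans_le ?_⟩
  apply div_le_div_of_nonneg_left hl.le (by norm_num) (by linarith)

theorem le_infDist_X (hΩ : IsOpen Ω) (hf : (frontier Ω).Nonempty) (hQ : Q ∈ S.𝔻) :
    c₀ / (800 * A * C) * Q.len ≤ Metric.infDist (S.X Q) (frontier Ω) := by
  refine le_infDist_frontier hΩ hf (subset_trans (Metric.ball_subset_ball (le_of_eq ?_))
    ((S.corkscrew Q hQ).trans Set.inter_subset_right))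
  rw [div_mul_div_comm, div_mul_eq_mul_div]
  congr 1
  ring

theorem infDist_X_lt (hc₀ : 0 < c₀) (hC : 1 ≤ C) (hA : 1 ≤ A) (hQ : Q ∈ S.𝔻) :
    Metric.infDist (S.X Q) (frontier Ω) < Q.len / 2 :=
  (Metric.infDist_le_dist_of_mem (S.ctr_mem_frontier hQ)).trans_lt (S.X_mem hc₀ hC hA hQ).2

theorem len_bounds_of_near (hI : I ∈ whitneyNear S.W m₀ K Q) :
    Q.len ≤ 2 ^ m₀ * I.len ∧ I.len ≤ 2 ^ m₀ * Q.len := by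
  obtain ⟨-, h1, h2, -⟩ := hI
  rw [Cube.len, WCube.len, ← zpow_natCast, ← zpow_add₀ (by norm_num), ← zpow_add₀ (by norm_num)]
  constructor <;> apply zpow_le_zpow_right₀ (by norm_num) <;> omega

theorem dist_center_le_of_near (hC : 1 ≤ C) (hQ : Q ∈ S.𝔻) (hI : I ∈ whitneyNear S.W m₀ K Q) :
    dist I.center (S.ctr Q) ≤ (K + 1 + C + unitDiam n * 2 ^ m₀) * Q.len := by
  have hl := Q.len_pos
  obtain ⟨a, ha, b, hb, hab⟩ := exists_dist_lt_of_setDist_lt (d := K * Q.len + Q.len)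
    ⟨I.center, I.center_mem_dilate one_pos.le⟩ ⟨_, S.ctr_mem hC hQ⟩
    (lt_of_le_of_lt hI.2.2.2 (lt_add_of_pos_right _ hl))
  have h1 := I.dist_le_of_mem_dilate (I.center_mem_dilate (a := 0) le_rfl) ha
  have h2 := S.dist_ctr_lt hQ hb
  have h3 := dist_triangle4 I.center a b (S.ctr Q)
  have h4 := (S.len_bounds_of_near hI).2
  have h5 : unitDiam n * ((0 + 1) * I.len / 2) ≤ unitDiam n * (2 ^ m₀ * Q.len) := by
    have := I.len_pos
    have := unitDiam_pos n
    gcongr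
    linarith
  linarith

theorem near_subset_wStar (hQ : Q ∈ S.𝔻) (hI : I ∈ whitneyNear S.W m₀ K Q) : I ∈ S.wStar Q := by
  obtain ⟨-, ⟨B, hB, hIB⟩, -⟩ := S.isChain Q hQ I hI
  exact ⟨hI.1, I, hI, B, List.mem_of_mem_head? hB, I.center, I.center_mem_dilate one_pos.le, hIB⟩

end Construction
end

set_option maxHeartbeats 1000000 in
/-- The balls of the chains defining the Whitney region `U_Q` are bounded in number, and are of
size `ℓ(Q)` and near `Q`. -/
theorem exists_chain_bounds (n : ℕ) {c₀ C₁ C₂ C A : ℝ} (K : ℝ) (m₀ : ℕ) (hc₀ : 0 < c₀)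
    (hC₁ : 1 < C₁) (hC₂ : 1 < C₂) (hC : 1 ≤ C) (hA : 1 ≤ A) :
    ∃ b : ℝ, 1 ≤ b ∧ ∀ {Ω : Set (Pt n)} (S : Construction Ω c₀ C₁ C₂ C A m₀ K), IsOpen Ω →
      (frontier Ω).Nonempty → ∀ Q ∈ S.𝔻, ∀ I ∈ whitneyNear S.W m₀ K Q,
      ((S.chain Q I).length : ℝ) ≤ b ∧ ∀ B ∈ S.chain Q I, B.2 ≤ b * Q.len ∧
        ∀ w ∈ Metric.ball B.1 B.2, Q.len ≤ b * Metric.infDist w (frontier Ω) ∧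
          Metric.infDist w (frontier Ω) ≤ b * Q.len ∧ dist w (S.ctr Q) ≤ b * Q.len := by
  set κ := unitDiam n with hκ
  have hκ0 : 0 < κ := unitDiam_pos n
  set Λ := C₂ * (C₂ + 1) with hΛ
  have hΛ1 : 1 ≤ Λ := by nlinarith
  set d₀ := |K| + 1 + C + κ * 2 ^ m₀ with hd₀
  have hd₀0 : 0 < d₀ := by positivity
  set a := min (4 * κ / 2 ^ m₀) (c₀ / (800 * A * C)) with ha
  have ha0 : 0 < a := lt_min (by positivity) (by positivity)
  -- Both X(I) and X_Q are at distance at least a ℓ(Q) from ∂Ω and at most (d₀ + 1) ℓ(Q) from each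
  -- other, so the chain between them has at most N balls.
  set N : ℕ := ⌈C₁ * (2 + posLog ((d₀ + 1) / a))⌉₊ with hN
  set ρ := C₂ * (42 * κ * 2 ^ m₀) with hρ
  have hρ0 : 0 < ρ := by positivity
  set b₁ := 2 * (C₂ + 1) * Λ ^ N * ρ with hb₁
  set b₂ := C₂ * (C₂ + 1) * Λ ^ N * 2 ^ m₀ / κ with hb₂
  set b₃ := 2 * (N + 1) * Λ ^ N * ρ + d₀ with hb₃
  have p1 : 0 ≤ b₁ := by positivity
  have p2 : 0 ≤ b₂ := by positivity
  have p3 : 0 ≤ b₃ := by positivity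
  refine ⟨N + 1 + b₁ + b₂ + b₃, by have : (0 : ℝ) ≤ N := Nat.cast_nonneg N
                                   linarith, ?_⟩
  intro Ω S hΩ hf Q hQ I hI
  have hN0 : (0 : ℝ) ≤ N := Nat.cast_nonneg N
  have hl := Q.len_pos
  have hIl := I.len_pos
  obtain ⟨hlow, hup⟩ := S.len_bounds_of_near hI
  have hcen := S.dist_center_le_of_near hC hQ hI
  have hX := S.X_mem hc₀ hC hA hQ
  have hδX := S.le_infDist_X hΩ hf hQ
  have hδI := S.whitney.le_infDist hf hI.1 (t := 0) (by norm_num) (z := I.center)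
    (I.center_mem_dilate (by norm_num))
  have hδI' := S.whitney.infDist_le hf hI.1 (t := 0) (by norm_num) (z := I.center)
    (I.center_mem_dilate (by norm_num))
  have hcen' : dist I.center (S.ctr Q) ≤ d₀ * Q.len := by
    refine hcen.trans ?_
    rw [hd₀]
    gcongr
    exact le_abs_self K
  obtain ⟨hball, ⟨B₀, hB₀, hIB₀⟩, -, hchain, hlen⟩ := S.isChain Q hQ I hI
  have hmin : a * Q.len ≤ min (Metric.infDist I.center (frontier Ω))
      (Metric.infDist (S.X Q) (frontier Ω)) := by
    refine le_min ?_ ?_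
    · calc a * Q.len ≤ 4 * κ / 2 ^ m₀ * (2 ^ m₀ * I.len) := by
            gcongr; exact min_le_left _ _
        _ = 4 * κ * I.len := by field_simp
        _ ≤ _ := hδI
    · refine le_trans ?_ hδX
      gcongr
      exact min_le_right _ _
  have hdist : dist I.center (S.X Q) ≤ (d₀ + 1) * Q.len := by
    have := dist_triangle_right I.center (S.X Q) (S.ctr Q)
    linarith [hX.2]
  have hlenN : ((S.chain Q I).length : ℝ) ≤ N := by
    refine le_trans hlen (le_trans ?_ (Nat.le_ceil _))
    gcongr
    apply posLog_mono
    · exact div_nonneg dist_nonneg (le_min Metric.infDist_nonneg Metric.infDist_nonneg)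
    · calc _ ≤ (d₀ + 1) * Q.len / (a * Q.len) := by gcongr
        _ = _ := by field_simp
  refine ⟨by linarith, ?_⟩
  obtain ⟨L, hL⟩ : ∃ L, S.chain Q I = B₀ :: L := by
    cases hc : S.chain Q I with
    | nil => rw [hc] at hB₀; simp at hB₀
    | cons B L => rw [hc] at hB₀; simp at hB₀; exact ⟨L, by rw [hB₀]⟩
  rw [hL] at hball hchain hlenN ⊢
  have hLN : L.length ≤ N := by
    have : (L.length : ℝ) + 1 ≤ N := by simpa using hlenN
    have h' : (L.length : ℝ) ≤ N := by linarith
    exact_mod_cast h'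
  have hLN' : (L.length : ℝ) ≤ N := by exact_mod_cast hLN
  have hpow : Λ ^ L.length ≤ Λ ^ N := pow_le_pow_right₀ hΛ1 hLN
  have hH : ∀ B ∈ B₀ :: L, IsHarnackBall Ω C₂ B := hball
  have hH₀ := hH B₀ (by simp)
  have q1 : B₀.2 ≤ ρ * Q.len := by
    have := hH₀.two_mul_le hf hC₂ hIB₀
    have h0 := hH₀.1
    calc B₀.2 ≤ C₂ * Metric.infDist I.center (frontier Ω) := by linarith
      _ ≤ C₂ * (42 * κ * (2 ^ m₀ * Q.len)) := by gcongr; exact hδI'.trans (by gcongr)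
      _ = _ := by rw [hρ]; ring
  have q2 : 2 * κ * Q.len ≤ (C₂ + 1) * 2 ^ m₀ * B₀.2 := by
    have h1 := hH₀.infDist_le hf hIB₀
    have h2 : 4 * κ * Q.len ≤ 2 ^ m₀ * (2 * (C₂ + 1) * B₀.2) := by
      calc 4 * κ * Q.len ≤ 4 * κ * (2 ^ m₀ * I.len) := by gcongr
        _ = 2 ^ m₀ * (4 * κ * I.len) := by ring
        _ ≤ _ := mul_le_mul_of_nonneg_left (hδI.trans h1) (by positivity)
    linarith
  intro B hB
  obtain ⟨e1, e2, e3⟩ := harnackBalls_bounds hf hC₂ L B₀ hH hchain B hB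
  have hBH := hH B hB
  have hB0 := hBH.1
  have hB₀0 := hH₀.1
  have e1' : B.2 ≤ Λ ^ N * ρ * Q.len := by
    calc B.2 ≤ Λ ^ L.length * B₀.2 := e1
      _ ≤ Λ ^ N * (ρ * Q.len) := by gcongr
      _ = _ := by ring
  have e2' : B₀.2 ≤ Λ ^ N * B.2 := e2.trans (by gcongr)
  have hbig : ∀ u v : ℝ, u ≤ v → 0 ≤ Q.len → u * Q.len ≤ v * Q.len := fun u v h1 h2 => by gcongr
  have hpos3 : 0 ≤ Λ ^ N * ρ := by positivity
  refine ⟨e1'.trans (hbig _ _ ?_ hl.le), fun w hw => ⟨?_, ?_, ?_⟩⟩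
  · have : Λ ^ N * ρ ≤ b₁ := by rw [hb₁]; nlinarith
    linarith
  · have f1 := hBH.two_mul_le hf hC₂ hw
    have f2 : Q.len ≤ b₂ * Metric.infDist w (frontier Ω) := by
      have : 2 * κ * Q.len ≤ (C₂ + 1) * 2 ^ m₀ * (Λ ^ N * B.2) := q2.trans (by gcongr)
      have g : 2 * κ * Q.len ≤ 2 * κ * (b₂ * Metric.infDist w (frontier Ω)) := by
        calc _ ≤ (C₂ + 1) * 2 ^ m₀ * (Λ ^ N * B.2) := this
          _ ≤ (C₂ + 1) * 2 ^ m₀ * (Λ ^ N * (C₂ * Metric.infDist w (frontier Ω))) := by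
              gcongr; linarith
          _ ≤ 2 * ((C₂ + 1) * 2 ^ m₀ * (Λ ^ N * (C₂ * Metric.infDist w (frontier Ω)))) := by
              have : 0 ≤ (C₂ + 1) * 2 ^ m₀ * (Λ ^ N * (C₂ * Metric.infDist w (frontier Ω))) := by
                have := Metric.infDist_nonneg (x := w) (s := frontier Ω)
                positivity
              linarith
          _ = _ := by rw [hb₂]; field_simp
      exact le_of_mul_le_mul_left g (by positivity)
    refine f2.trans (mul_le_mul_of_nonneg_right (by linarith) Metric.infDist_nonneg)
  · have f1 := hBH.infDist_le hf hw
    refine f1.trans (le_trans ?_ (hbig b₁ _ (by linarith) hl.le))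
    calc _ ≤ 2 * (C₂ + 1) * (Λ ^ N * ρ * Q.len) := by gcongr
      _ = _ := by rw [hb₁]; ring
  · have f1 := e3 w hw I.center hIB₀
    have f2 := dist_triangle w I.center (S.ctr Q)
    have f3 : 2 * ((L.length : ℝ) + 1) * Λ ^ L.length * B₀.2 ≤
        2 * (N + 1) * Λ ^ N * (ρ * Q.len) := by
      have := hH₀.1
      gcongr
    refine le_trans ?_ (hbig b₃ _ (by linarith) hl.le)
    rw [hb₃]
    linarith

/-- The cubes of `𝒲_Q^*` are of size `ℓ(Q)` and near `Q`. -/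
theorem exists_wStar_bounds (n : ℕ) {c₀ C₁ C₂ C A : ℝ} (K : ℝ) (m₀ : ℕ) (hc₀ : 0 < c₀)
    (hC₁ : 1 < C₁) (hC₂ : 1 < C₂) (hC : 1 ≤ C) (hA : 1 ≤ A) :
    ∃ b : ℝ, 1 ≤ b ∧ ∀ {Ω : Set (Pt n)} (S : Construction Ω c₀ C₁ C₂ C A m₀ K), IsOpen Ω →
      (frontier Ω).Nonempty → ∀ Q ∈ S.𝔻, ∀ J ∈ S.wStar Q,
      Q.len ≤ b * J.len ∧ J.len ≤ b * Q.len ∧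
        ∀ t ≤ 1, ∀ z ∈ J.dilate (1 + t), dist z (S.ctr Q) ≤ b * Q.len := by
  obtain ⟨b, hb, h⟩ := exists_chain_bounds n K m₀ hc₀ hC₁ hC₂ hC hA
  set κ := unitDiam n with hκ
  have hκ1 : 1 ≤ κ := one_le_unitDiam n
  refine ⟨42 * κ * b, by nlinarith, ?_⟩
  intro Ω S hΩ hf Q hQ J hJ
  obtain ⟨hJW, I, hI, B, hB, w, hwJ, hwB⟩ := hJ
  obtain ⟨h1, h2, h3⟩ := (h S hΩ hf Q hQ I hI).2 B hB |>.2 w hwB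
  have hwJ' : w ∈ J.dilate (1 + 0) := by rw [add_zero]; exact hwJ
  have a1 := S.whitney.le_infDist hf hJW (t := 0) (by norm_num) hwJ'
  have a2 := S.whitney.infDist_le hf hJW (t := 0) (by norm_num) hwJ'
  have hl := Q.len_pos
  have hJl := J.len_pos
  have e : κ * J.len ≤ b * Q.len / 4 := by linarith
  have e' : J.len ≤ κ * J.len := by nlinarith
  have hbQ : 0 < b * Q.len := by positivity
  refine ⟨?_, ?_, fun t ht z hz => ?_⟩
  · calc Q.len ≤ b * (42 * κ * J.len) := h1.trans (by gcongr)
      _ = _ := by ring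
  · nlinarith
  · have f1 := J.dist_le_of_mem_dilate hz hwJ
    have f2 := dist_triangle z w (S.ctr Q)
    have f3 : unitDiam n * ((1 + t + 1) * J.len / 2) ≤ 3 / 2 * (κ * J.len) := by
      rw [← hκ]; nlinarith
    nlinarith

/-! ### Chains of points in Whitney regions -/

/-- Each ball is convex with diameter at most 2R, hence is crossed by m hops; the passage to the
next ball takes place at a common point. -/
theorem reach_of_balls {n : ℕ} {D : Set (Pt n)} {s R : ℝ} {m : ℕ} (hm : 2 * R < m * (s / 2))
    (L : List (Pt n × ℝ)) : ∀ B₀ : Pt n × ℝ,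
      (∀ B ∈ B₀ :: L, B.2 ≤ R ∧ ∀ w ∈ Metric.ball B.1 B.2,
        w ∈ D ∧ s ≤ Metric.infDist w (frontier D)) →
      (B₀ :: L).IsChain (fun B B' => (Metric.ball B.1 B.2 ∩ Metric.ball B'.1 B'.2).Nonempty) →
      ∀ x ∈ Metric.ball B₀.1 B₀.2, ∀ B ∈ (B₀ :: L).getLast?, ∀ y ∈ Metric.ball B.1 B.2,
        Reach D (m * (L.length + 1)) x y := by
  have base : ∀ B : Pt n × ℝ, (B.2 ≤ R ∧ ∀ w ∈ Metric.ball B.1 B.2,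
      w ∈ D ∧ s ≤ Metric.infDist w (frontier D)) → ∀ x ∈ Metric.ball B.1 B.2,
      ∀ y ∈ Metric.ball B.1 B.2, Reach D m x y := by
    intro B hB x hx y hy
    refine reach_of_segment (fun w hw => hB.2 w ((convex_ball B.1 B.2).segment_subset hx hy hw)) ?_
    have := dist_triangle_right x y B.1
    rw [Metric.mem_ball] at hx hy
    linarith [hB.1]
  induction L with
  | nil =>
    intro B₀ hB _ x hx B hBl y hy
    obtain rfl : B₀ = B := by simpa using hBl
    simpa using base B₀ (hB B₀ (by simp)) x hx y hy
  | cons B₁ L ih =>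
    intro B₀ hB hc x hx B hBl y hy
    rw [List.isChain_cons_cons] at hc
    obtain ⟨w, hw₀, hw₁⟩ := hc.1
    have h1 := base B₀ (hB B₀ (by simp)) x hx w hw₀
    have h2 := ih B₁ (fun B h => hB B (List.mem_cons_of_mem _ h)) hc.2 w hw₁ B
      (by rwa [List.getLast?_cons_cons] at hBl) y hy
    have := h1.trans h2
    convert this using 1
    simp
    ring

theorem WCube.convex_dilate {n : ℕ} (I : WCube n) (a : ℝ) : Convex ℝ (I.dilate a) := by
  intro x hx y hy p q hp hq hpq i
  have h1 := abs_le.1 (hx i)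
  have h2 := abs_le.1 (hy i)
  have e : (p • x + q • y) i - I.center i =
      p * (x i - I.center i) + q * (y i - I.center i) := by
    simp only [PiLp.add_apply, PiLp.smul_apply, smul_eq_mul]
    linear_combination (I.center i) * hpq
  rw [e, abs_le]
  have e2 : a * I.len / 2 = p * (a * I.len / 2) + q * (a * I.len / 2) := by
    rw [← add_mul, hpq, one_mul]
  constructor
  · nlinarith [mul_le_mul_of_nonneg_left h1.1 hp, mul_le_mul_of_nonneg_left h2.1 hq]
  · nlinarith [mul_le_mul_of_nonneg_left h1.2 hp, mul_le_mul_of_nonneg_left h2.2 hq]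

theorem WCube.ball_subset_openDilate {n : ℕ} {I : WCube n} {t : ℝ} {x : Pt n} (hx : x ∈ I.toSet) :
    Metric.ball x (t * I.len / 2) ⊆ I.openDilate (1 + t) := by
  intro w hw i
  have h1 := (abs_sub_apply_le_dist w x i).trans_lt hw
  have h2 : |x i - I.center i| ≤ 1 * I.len / 2 := hx i
  have := abs_sub_le (w i) (x i) (I.center i)
  linarith

section
variable {n : ℕ} {Ω : Set (Pt n)} {W V : Set (WCube n)} {t : ℝ}

theorem IsWhitney.cubeUnion_subset (hW : IsWhitney Ω W) (hf : (frontier Ω).Nonempty)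
    (hV : V ⊆ W) (ht : t ≤ 1) : cubeUnion V t ⊆ Ω := by
  intro x hx
  obtain ⟨I, hI, hxI⟩ := mem_cubeUnion.1 hx
  exact hW.dilate_subset hf (hV hI) ht (I.openDilate_subset _ hxI)

theorem IsWhitney.frontier_cubeUnion_nonempty (hW : IsWhitney Ω W) (hf : (frontier Ω).Nonempty)
    (hV : V ⊆ W) (ht0 : 0 < t) (ht : t ≤ 1) (hne : V.Nonempty) :
    (frontier (cubeUnion V t)).Nonempty := by
  rw [nonempty_frontier_iff]
  refine ⟨?_, ?_⟩
  · obtain ⟨I, hI⟩ := hne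
    exact ⟨I.center, mem_cubeUnion.2 ⟨I, hI, I.dilate_subset_openDilate (a := 0) (by linarith)
      (I.center_mem_dilate le_rfl)⟩⟩
  · intro h
    have := hW.cubeUnion_subset hf hV ht
    rw [h, Set.univ_subset_iff] at this
    rw [this] at hf
    simp at hf

theorem IsWhitney.infDist_cubeUnion_le (hW : IsWhitney Ω W) (hΩ : IsOpen Ω)
    (hf : (frontier Ω).Nonempty) (hV : V ⊆ W) (ht : t ≤ 1) {x : Pt n} (hx : x ∈ cubeUnion V t) :
    Metric.infDist x (frontier (cubeUnion V t)) ≤ Metric.infDist x (frontier Ω) :=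
  le_infDist_frontier hΩ hf
    ((ball_infDist_frontier_subset hx).trans (hW.cubeUnion_subset hf hV ht))

end

/-- The centers of the cubes of `𝒲_Q^*` are connected to `X_Q` by a bounded number of hops. -/
theorem exists_reach_X (n : ℕ) {c₀ C₁ C₂ C A t : ℝ} (K : ℝ) (m₀ : ℕ) (hc₀ : 0 < c₀)
    (hC₁ : 1 < C₁) (hC₂ : 1 < C₂) (hC : 1 ≤ C) (hA : 1 ≤ A) (ht0 : 0 < t) (ht : t ≤ 1) :
    ∃ N : ℕ, ∀ {Ω : Set (Pt n)} (S : Construction Ω c₀ C₁ C₂ C A m₀ K), IsOpen Ω →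
      (frontier Ω).Nonempty → ∀ Q ∈ S.𝔻, ∀ V ⊆ S.W, S.wStar Q ⊆ V → ∀ J ∈ S.wStar Q,
      Reach (cubeUnion V t) N J.center (S.X Q) := by
  obtain ⟨b₁, hb₁, h₁⟩ := exists_chain_bounds n K m₀ hc₀ hC₁ hC₂ hC hA
  obtain ⟨b, hb, h₂⟩ := exists_wStar_bounds n K m₀ hc₀ hC₁ hC₂ hC hA
  set κ := unitDiam n with hκ
  have hκ0 : 0 < κ := unitDiam_pos n
  obtain ⟨m₁, hm₁⟩ := exists_nat_gt (8 * b * b₁ / t)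
  obtain ⟨m₂, hm₂⟩ := exists_nat_gt (4 * b * (κ * b) / t)
  obtain ⟨k, hk⟩ := exists_nat_ge b₁
  refine ⟨m₂ + m₁ * k, ?_⟩
  intro Ω S hΩ hf Q hQ V hV hQV J hJ
  set D := cubeUnion V t with hD
  have hDo : IsOpen D := isOpen_cubeUnion V t
  have hDf : (frontier D).Nonempty :=
    S.whitney.frontier_cubeUnion_nonempty hf hV ht0 ht ⟨J, hQV hJ⟩
  have hl := Q.len_pos
  set s := t * Q.len / (2 * b) with hs
  have hdeep : ∀ J' ∈ S.wStar Q, ∀ w ∈ J'.toSet, w ∈ D ∧ s ≤ Metric.infDist w (frontier D) := by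
    intro J' hJ' w hw
    have hsub : Metric.ball w s ⊆ D := by
      refine (Metric.ball_subset_ball ?_).trans ((WCube.ball_subset_openDilate hw).trans
        (openDilate_subset_cubeUnion (hQV hJ')))
      rw [hs, div_le_div_iff₀ (by positivity) (by positivity)]
      have := (h₂ S hΩ hf Q hQ J' hJ').1
      calc t * Q.len * 2 ≤ t * (b * J'.len) * 2 := by gcongr
        _ = _ := by ring
    exact ⟨hsub (Metric.mem_ball_self (by positivity)), le_infDist_frontier hDo hDf hsub⟩
  obtain ⟨hJW, I, hI, B, hB, w, hwJ, hwB⟩ := id hJ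
  have hlen := (h₁ S hΩ hf Q hQ I hI).1
  have hballs := (h₁ S hΩ hf Q hQ I hI).2
  obtain ⟨hgood, -, ⟨Bl, hBl, hXl⟩, hchain, -⟩ := S.isChain Q hQ I hI
  -- J meets the ball B of the chain; only the part of the chain from B on to X_Q is followed.
  obtain ⟨L₁, L₂, hL⟩ := List.append_of_mem hB
  have hr1 : Reach D m₂ J.center w := by
    refine reach_of_segment (s := s) (fun u hu => hdeep J hJ u ((J.convex_dilate 1).segment_subset
      (J.center_mem_dilate one_pos.le) hwJ hu)) ?_
    have d1 := J.dist_le_of_mem_dilate (J.center_mem_dilate (a := 0) le_rfl) hwJ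
    have d2 := (h₂ S hΩ hf Q hQ J hJ).2.1
    have d3 : 0 < κ * b * Q.len := by positivity
    rw [div_lt_iff₀ ht0] at hm₂
    calc dist J.center w ≤ κ * ((0 + 1) * J.len / 2) := d1
      _ ≤ κ * ((0 + 1) * (b * Q.len) / 2) := by gcongr
      _ < κ * b * Q.len := by linarith
      _ = 4 * b * (κ * b) * (Q.len / (4 * b)) := by field_simp
      _ ≤ m₂ * t * (Q.len / (4 * b)) := by gcongr
      _ = m₂ * (s / 2) := by rw [hs]; field_simp; norm_num
  have hr2 : Reach D (m₁ * (L₂.length + 1)) w (S.X Q) := by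
    refine reach_of_balls (s := s) (R := b₁ * Q.len) ?_ L₂ B (fun B' hB' => ?_) ?_ w hwB Bl ?_ _ hXl
    · rw [div_lt_iff₀ ht0] at hm₁
      calc 2 * (b₁ * Q.len) = 8 * b * b₁ * (Q.len / (4 * b)) := by field_simp; norm_num
        _ < m₁ * t * (Q.len / (4 * b)) := by gcongr
        _ = m₁ * (s / 2) := by rw [hs]; field_simp; norm_num
    · have hB'' : B' ∈ S.chain Q I := by rw [hL]; exact List.mem_append_right _ hB'
      refine ⟨(hballs B' hB'').1, fun u hu => ?_⟩
      -- By definition 𝒲_Q^* contains every Whitney cube that meets a ball of the chain, so the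
      -- whole chain runs well inside the region.
      obtain ⟨J', hJ', huJ'⟩ := S.whitney.exists_mem ((hgood B' hB'').2.1 hu)
      exact hdeep J' ⟨hJ', I, hI, B', hB'', u, huJ', hu⟩ u huJ'
    · rw [hL] at hchain
      exact (List.isChain_append.1 hchain).2.1
    · rw [hL, List.getLast?_append_of_ne_nil _ (by simp)] at hBl
      exact hBl
  refine (hr1.trans hr2).mono hDo hDf ?_
  have : L₂.length + 1 ≤ k := by
    have e : (S.chain Q I).length = L₁.length + (L₂.length + 1) := by rw [hL]; simp
    have : (S.chain Q I).length ≤ k := by exact_mod_cast hlen.trans hk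
    omega
  gcongr

/-- The Whitney cube containing `X_Q` belongs to `𝒲_{Q'}` for the cubes `Q'` of the same or the
previous generation near `Q`. -/
def Construction.IsWide {n : ℕ} {Ω : Set (Pt n)} {c₀ C₁ C₂ C A K : ℝ} {m₀ : ℕ}
    (S : Construction Ω c₀ C₁ C₂ C A m₀ K) (M : ℝ) : Prop :=
  ∀ Q ∈ S.𝔻, ∀ Q' ∈ S.𝔻, Q'.1 ≤ Q.1 → Q.1 ≤ Q'.1 + 1 →
    dist (S.ctr Q) (S.ctr Q') ≤ M * Q'.len → ∃ I ∈ whitneyNear S.W m₀ K Q', S.X Q ∈ I.toSet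

/-- The distance of X_Q to ∂Ω is comparable to ℓ(Q), which fixes the size of the Whitney cube
containing X_Q up to the factor 2^p; the extra 1 in the threshold allows Q to be one generation
later than Q'. Since X_Q is within ℓ(Q)/2 of x_Q, K ≥ M + 1 suffices. -/
theorem exists_isWide (n : ℕ) {c₀ C A : ℝ} (C₁ C₂ : ℝ) (hc₀ : 0 < c₀) (hC : 1 ≤ C) (hA : 1 ≤ A) :
    ∃ mMin : ℕ, ∀ (m₀ : ℕ) (K M : ℝ), mMin ≤ m₀ → M + 1 ≤ K →
      ∀ {Ω : Set (Pt n)} (S : Construction Ω c₀ C₁ C₂ C A m₀ K), IsOpen Ω → (frontier Ω).Nonempty →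
      S.IsWide M := by
  set κ := unitDiam n with hκ
  have hκ1 : 1 ≤ κ := one_le_unitDiam n
  obtain ⟨p, hp⟩ := pow_unbounded_of_one_lt (42 * κ * (800 * A * C) / c₀) (one_lt_two (α := ℝ))
  refine ⟨p + 1, ?_⟩
  intro m₀ K M hm hK Ω S hΩ hf Q hQ Q' hQ' h1 h2 hd
  obtain ⟨hXΩ, hXd⟩ := S.X_mem hc₀ hC hA hQ
  obtain ⟨I, hI, hXI⟩ := S.whitney.exists_mem hXΩ
  refine ⟨I, ⟨hI, ?_, ?_, ?_⟩, hXI⟩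
  all_goals
    have hXI' : S.X Q ∈ I.dilate (1 + 0) := by rw [add_zero]; exact hXI
    have a1 := S.whitney.le_infDist hf hI (t := 0) (by norm_num) hXI'
    have a2 := S.whitney.infDist_le hf hI (t := 0) (by norm_num) hXI'
    have b1 := S.infDist_X_lt hc₀ hC hA hQ
    have b2 := S.le_infDist_X hΩ hf hQ
    have hl := Q.len_pos
    have hIl := I.len_pos
    have hl' := Q'.len_pos
  · have : I.len ≤ Q.len := by nlinarith
    rw [WCube.len, Cube.len, zpow_le_zpow_iff_right₀ one_lt_two] at this
    omega
  · have e : c₀ * Q.len ≤ 42 * κ * (800 * A * C) * I.len := by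
      have := b2.trans a2
      rw [div_mul_eq_mul_div, div_le_iff₀ (by positivity)] at this
      linarith
    rw [div_lt_iff₀ hc₀] at hp
    have e2 : c₀ * Q.len ≤ c₀ * (2 ^ p * I.len) := by
      calc c₀ * Q.len ≤ 42 * κ * (800 * A * C) * I.len := e
        _ ≤ 2 ^ p * c₀ * I.len := by gcongr
        _ = _ := by ring
    have e3 := le_of_mul_le_mul_left e2 hc₀
    rw [WCube.len, Cube.len, ← zpow_natCast, ← zpow_add₀ (by norm_num),
      zpow_le_zpow_iff_right₀ one_lt_two] at e3
    omega
  · refine (setDist_le hXI (S.ctr_mem hC hQ')).trans ?_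
    have t1 := dist_triangle (S.X Q) (S.ctr Q) (S.ctr Q')
    have t2 : Q.len ≤ Q'.len := by
      rw [Cube.len, Cube.len]
      exact zpow_le_zpow_right₀ one_lt_two.le (by omega)
    nlinarith

/-- Corkscrew points of neighboring cubes are connected by a bounded number of hops. -/
theorem exists_reach_neighbor (n : ℕ) {c₀ C₁ C₂ C A t : ℝ} (K : ℝ) (m₀ : ℕ) (hc₀ : 0 < c₀)
    (hC₁ : 1 < C₁) (hC₂ : 1 < C₂) (hC : 1 ≤ C) (hA : 1 ≤ A) (ht0 : 0 < t) (ht : t ≤ 1) :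
    ∃ N : ℕ, ∀ {Ω : Set (Pt n)} (S : Construction Ω c₀ C₁ C₂ C A m₀ K), IsOpen Ω →
      (frontier Ω).Nonempty → ∀ Q ∈ S.𝔻, ∀ Q' ∈ S.𝔻,
      (∃ I ∈ whitneyNear S.W m₀ K Q', S.X Q ∈ I.toSet) → ∀ V ⊆ S.W, S.wStar Q' ⊆ V →
      Reach (cubeUnion V t) N (S.X Q) (S.X Q') := by
  obtain ⟨N, hN⟩ := exists_reach_X n K m₀ hc₀ hC₁ hC₂ hC hA ht0 ht
  obtain ⟨m, hm⟩ := exists_nat_gt (4 * unitDiam n / t)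
  refine ⟨m + N, ?_⟩
  intro Ω S hΩ hf Q hQ Q' hQ' ⟨I, hI, hXI⟩ V hV hQV
  have hI' := S.near_subset_wStar hQ' hI
  set D := cubeUnion V t with hD
  have hDo : IsOpen D := isOpen_cubeUnion V t
  have hDf : (frontier D).Nonempty :=
    S.whitney.frontier_cubeUnion_nonempty hf hV ht0 ht ⟨I, hQV hI'⟩
  have hIl := I.len_pos
  have hdeep : ∀ w ∈ I.toSet, w ∈ D ∧ t * I.len / 2 ≤ Metric.infDist w (frontier D) := by
    intro w hw
    have hsub : Metric.ball w (t * I.len / 2) ⊆ D :=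
      (WCube.ball_subset_openDilate hw).trans (openDilate_subset_cubeUnion (hQV hI'))
    exact ⟨hsub (Metric.mem_ball_self (by positivity)), le_infDist_frontier hDo hDf hsub⟩
  refine Reach.trans (y := I.center) ?_ (hN S hΩ hf Q' hQ' V hV hQV I hI')
  refine reach_of_segment (fun u hu => hdeep u ((I.convex_dilate 1).segment_subset hXI
      (I.center_mem_dilate one_pos.le) hu)) ?_
  have d1 := I.dist_le_of_mem_dilate hXI (I.center_mem_dilate (a := 0) le_rfl)
  have hκ := unitDiam_pos n
  rw [div_lt_iff₀ ht0] at hm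
  have : 0 < unitDiam n * I.len := by positivity
  calc dist (S.X Q) I.center ≤ unitDiam n * ((1 + 0) * I.len / 2) := d1
    _ < 4 * unitDiam n * (I.len / 4) := by linarith
    _ ≤ m * t * (I.len / 4) := by gcongr
    _ = _ := by ring

/-! ### Coherent families of cubes -/

namespace Construction

section
variable {n : ℕ} {Ω : Set (Pt n)} {c₀ C₁ C₂ C A K : ℝ} {m₀ : ℕ}

/-- A family `E` of cubes is coherent, with generations in the upper set `T`, if it contains with a
cube also its ancestors with generation in `T`, and its cubes of the first generation in `T`, if
there is one, are near each other. -/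
structure IsCoherent (S : Construction Ω c₀ C₁ C₂ C A m₀ K) (M : ℝ) (T : Set ℤ)
    (E : Set (Cube n)) : Prop where
  subset : E ⊆ S.𝔻
  nonempty : E.Nonempty
  gen_mem : ∀ Q ∈ E, Q.1 ∈ T
  upper : ∀ j ∈ T, ∀ k, j ≤ k → k ∈ T
  ancestor : ∀ Q ∈ E, ∀ j ∈ T, j ≤ Q.1 → ∃ Q' ∈ E, Q'.1 = j ∧ Q.2 ⊆ Q'.2
  top : ∀ j ∈ T, j - 1 ∉ T → ∀ Q ∈ E, ∀ Q' ∈ E, Q.1 = j → Q'.1 = j →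
    dist (S.ctr Q) (S.ctr Q') ≤ M * Q'.len

/-- The Whitney cubes of the regions `U_Q`, `Q ∈ E`. -/
def family (S : Construction Ω c₀ C₁ C₂ C A m₀ K) (E : Set (Cube n)) : Set (WCube n) :=
  ⋃ Q ∈ E, S.wStar Q

variable {S : Construction Ω c₀ C₁ C₂ C A m₀ K} {M : ℝ} {T : Set ℤ} {E : Set (Cube n)}

theorem family_subset : S.family E ⊆ S.W := by
  intro J hJ
  obtain ⟨Q, -, hJQ⟩ := Set.mem_iUnion₂.1 hJ
  exact hJQ.1

theorem wStar_subset_family {Q : Cube n} (hQ : Q ∈ E) : S.wStar Q ⊆ S.family E :=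
  Set.subset_biUnion_of_mem (u := fun Q => S.wStar Q) hQ

theorem mem_family {J : WCube n} : J ∈ S.family E ↔ ∃ Q ∈ E, J ∈ S.wStar Q := by
  simp [family]

/-- The parent of a cube is near the cube. -/
theorem dist_ctr_le_of_subset {Q Q' : Cube n} (hC : 1 ≤ C) (hM : C ≤ M) (hQ : Q ∈ S.𝔻)
    (hQ' : Q' ∈ S.𝔻) (h : Q.2 ⊆ Q'.2) : dist (S.ctr Q) (S.ctr Q') ≤ M * Q'.len := by
  have := S.dist_ctr_lt hQ' (h (S.ctr_mem hC hQ))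
  have hl := Q'.len_pos
  nlinarith

theorem IsCoherent.exists_mem_near (hE : S.IsCoherent M T E) (hwide : S.IsWide M) (hC : 1 ≤ C)
    (hM : C ≤ M) {Q : Cube n} (hQ : Q ∈ E) : ∃ I ∈ S.wStar Q, S.X Q ∈ I.toSet := by
  obtain ⟨I, hI, hXI⟩ := hwide Q (hE.subset hQ) Q (hE.subset hQ) le_rfl (by omega)
    (dist_ctr_le_of_subset hC hM (hE.subset hQ) (hE.subset hQ) subset_rfl)
  exact ⟨I, S.near_subset_wStar (hE.subset hQ) hI, hXI⟩

theorem IsCoherent.family_nonempty (hE : S.IsCoherent M T E) (hwide : S.IsWide M) (hC : 1 ≤ C)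
    (hM : C ≤ M) : (S.family E).Nonempty := by
  obtain ⟨Q, hQ⟩ := hE.nonempty
  obtain ⟨I, hI, -⟩ := hE.exists_mem_near hwide hC hM hQ
  exact ⟨I, wStar_subset_family hQ hI⟩

/-- The climb passes through one generation at a time; coherence keeps the intermediate ancestors in
`E`, and nestedness keeps them inside Q'. -/
theorem IsCoherent.reach_ancestor (hE : S.IsCoherent M T E) (hC : 1 ≤ C) (hM : C ≤ M)
    {D : Set (Pt n)} {N : ℕ}
    (hN : ∀ Q ∈ E, ∀ Q' ∈ E, Q'.1 ≤ Q.1 → Q.1 ≤ Q'.1 + 1 →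
      dist (S.ctr Q) (S.ctr Q') ≤ M * Q'.len → Reach D N (S.X Q) (S.X Q'))
    {Q' : Cube n} (hQ' : Q' ∈ E) (k : ℕ) : ∀ Q ∈ E, Q.1 = Q'.1 + k → Q.2 ⊆ Q'.2 →
      Reach D (N * (k + 1)) (S.X Q) (S.X Q') := by
  induction k with
  | zero =>
    intro Q hQ hk hsub
    rw [zero_add, mul_one]
    simp only [Nat.cast_zero, add_zero] at hk
    exact hN Q hQ Q' hQ' hk.ge (by omega)
      (dist_ctr_le_of_subset hC hM (hE.subset hQ) (hE.subset hQ') hsub)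
  | succ k ih =>
    intro Q hQ hk hsub
    push_cast at hk
    obtain ⟨P, hP, hP1, hQP⟩ := hE.ancestor Q hQ (Q.1 - 1)
      (hE.upper _ (hE.gen_mem Q' hQ') _ (by omega)) (by omega)
    have hPsub : P.2 ⊆ Q'.2 := by
      rcases S.grid.nested Q'.1 P.1 (by omega) P.2 (hE.subset hP).1 Q'.2 (hE.subset hQ').1 with h | h
      · exact h
      · have hx := S.ctr_mem hC (hE.subset hQ)
        exact absurd (hsub hx) (Set.disjoint_left.1 h (hQP hx))
    have h1 := hN Q hQ P hP (by omega) (by omega)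
      (dist_ctr_le_of_subset hC hM (hE.subset hQ) (hE.subset hP) hQP)
    have h2 := ih P hP (by omega) hPsub
    have := h1.trans h2
    convert this using 1
    ring

/-- The generation `j` may lie before the first one in `T`; the search from `j` upwards then stops
at the first generation of `T`. -/
theorem _root_.Sawtooth.exists_min_gen {T : Set ℤ} (k : ℕ) : ∀ j : ℤ, j + k ∈ T →
    ∃ i ∈ T, j ≤ i ∧ i ≤ j + k ∧ (i = j ∨ i - 1 ∉ T) := by
  induction k with
  | zero => intro j hj; exact ⟨j, by simpa using hj, le_rfl, by simp, Or.inl rfl⟩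
  | succ k ih =>
    intro j hj
    push_cast at hj ⊢
    obtain ⟨i, hi, h1, h2, h3⟩ := ih (j + 1) (by rw [add_assoc, add_comm 1]; exact hj)
    by_cases hjT : j ∈ T
    · exact ⟨j, hjT, le_rfl, by omega, Or.inl rfl⟩
    · refine ⟨i, hi, by omega, by omega, Or.inr ?_⟩
      rcases h3 with rfl | h3
      · simpa using hjT
      · exact h3

/-- Two cubes have ancestors in the family of a given size, or of the first generation. -/
theorem IsCoherent.exists_common_gen (hE : S.IsCoherent M T E) {Q Q' : Cube n} (hQ : Q ∈ E)
    (hQ' : Q' ∈ E) {L : ℝ} (hL : Q.len ≤ L) (hL' : Q'.len ≤ L) :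
    ∃ P ∈ E, ∃ P' ∈ E, P'.1 = P.1 ∧ P.1 ≤ Q.1 ∧ P.1 ≤ Q'.1 ∧ Q.2 ⊆ P.2 ∧ Q'.2 ⊆ P'.2 ∧
      P.len ≤ 2 * L ∧ (L ≤ P.len ∨ P.1 - 1 ∉ T) := by
  have hL0 : 0 < L := Q.len_pos.trans_le hL
  -- The cubes of generation -(m + 1) have length 2^{m+1}, which lies in [L, 2L).
  obtain ⟨m, hm1, hm2⟩ := exists_mem_Ioc_zpow hL0 (one_lt_two (α := ℝ))
  have hj : ∀ P : Cube n, P.len ≤ L → -(m + 1) ≤ P.1 := by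
    intro P hP
    have := hP.trans hm2
    rw [Cube.len, zpow_le_zpow_iff_right₀ one_lt_two] at this
    omega
  obtain ⟨d, hd⟩ := Int.eq_ofNat_of_zero_le
    (sub_nonneg.2 (le_min (hj Q hL) (hj Q' hL')))
  obtain ⟨i, hiT, hi1, hi2, hi3⟩ := exists_min_gen (T := T) d (-(m + 1)) (by
    rw [← hd]
    rcases min_choice Q.1 Q'.1 with h | h <;> rw [h]
    · simpa using hE.gen_mem Q hQ
    · simpa using hE.gen_mem Q' hQ')
  have hi2' : i ≤ min Q.1 Q'.1 := by rw [← hd] at hi2; linarith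
  obtain ⟨P, hP, hP1, hQP⟩ := hE.ancestor Q hQ i hiT (hi2'.trans (min_le_left _ _))
  obtain ⟨P', hP', hP1', hQP'⟩ := hE.ancestor Q' hQ' i hiT (hi2'.trans (min_le_right _ _))
  refine ⟨P, hP, P', hP', by rw [hP1, hP1'], by rw [hP1]; exact hi2'.trans (min_le_left _ _),
    by rw [hP1]; exact hi2'.trans (min_le_right _ _), hQP, hQP', ?_, ?_⟩
  · have h1 : P.len ≤ (2 : ℝ) ^ (m + 1) := by
      rw [Cube.len, hP1]
      exact zpow_le_zpow_right₀ one_lt_two.le (by omega)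
    rw [zpow_add_one₀ (by norm_num)] at h1
    linarith
  · rcases hi3 with h | h
    · left
      rw [Cube.len, hP1, h, neg_neg]
      exact hm2
    · right
      rwa [hP1]

end

end Construction

/-! ### Harnack chains in the regions of coherent families. -/

/-- From a point in the region of `Q` to the corkscrew point of an ancestor of `Q`. -/
theorem exists_reach_up (n : ℕ) {c₀ C₁ C₂ C A t M : ℝ} (K : ℝ) (m₀ : ℕ) (hc₀ : 0 < c₀)
    (hC₁ : 1 < C₁) (hC₂ : 1 < C₂) (hC : 1 ≤ C) (hA : 1 ≤ A) (ht0 : 0 < t) (ht : t ≤ 1)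
    (hM : C ≤ M) {β : ℝ} (hβ : 0 < β) :
    ∃ k : ℝ, 0 < k ∧ ∀ {Ω : Set (Pt n)} (S : Construction Ω c₀ C₁ C₂ C A m₀ K), IsOpen Ω →
      (frontier Ω).Nonempty → S.IsWide M → ∀ {T : Set ℤ} {E : Set (Cube n)}, S.IsCoherent M T E →
      ∀ Q ∈ E, ∀ J ∈ S.wStar Q, ∀ x ∈ J.openDilate (1 + t), ∀ d : ℝ, 0 < d → J.len ≤ β * d →
      ∀ P ∈ E, Q.2 ⊆ P.2 → P.1 ≤ Q.1 → P.len ≤ β * d →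
      ∃ N : ℕ, (N : ℝ) ≤
        k * (1 + posLog (d / Metric.infDist x (frontier (cubeUnion (S.family E) t)))) ∧
        Reach (cubeUnion (S.family E) t) N x (S.X P) := by
  set κ := unitDiam n with hκ
  have hκ1 : 1 ≤ κ := one_le_unitDiam n
  obtain ⟨b, hb, hbd⟩ := exists_wStar_bounds n K m₀ hc₀ hC₁ hC₂ hC hA
  obtain ⟨c, hc, hcone⟩ := exists_reach_of_cone (M := 2 * κ) (by linarith)
  obtain ⟨N₁, hN₁⟩ := exists_reach_X n K m₀ hc₀ hC₁ hC₂ hC hA ht0 ht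
  obtain ⟨N₂, hN₂⟩ := exists_reach_neighbor n K m₀ hc₀ hC₁ hC₂ hC hA ht0 ht
  set γ := β * (42 * κ * b) with hγ
  have hγ0 : 0 < γ := by positivity
  refine ⟨c * (1 + posLog β) + N₁ + N₂ * (1 + posLog γ), ?_, ?_⟩
  · have := posLog_nonneg β
    have := posLog_nonneg γ
    positivity
  intro Ω S hΩ hf hwide T E hE Q hQ J hJ x hx d hd hJd P hP hQP hPQ hPd
  set D := cubeUnion (S.family E) t with hD
  have hDo : IsOpen D := isOpen_cubeUnion _ t
  have hJE : J ∈ S.family E := Construction.wStar_subset_family hQ hJ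
  have hDf : (frontier D).Nonempty := S.whitney.frontier_cubeUnion_nonempty hf
    Construction.family_subset ht0 ht ⟨J, hJE⟩
  have hxD : x ∈ D := openDilate_subset_cubeUnion hJE hx
  set δ := Metric.infDist x (frontier D) with hδ
  have hδ0 : 0 < δ := infDist_frontier_pos hDo hDf hxD
  have hδΩ : δ ≤ Metric.infDist x (frontier Ω) := S.whitney.infDist_cubeUnion_le hΩ hf
    Construction.family_subset ht hxD
  have hδJ := hδΩ.trans (S.whitney.infDist_le hf hJ.1 ht (J.openDilate_subset _ hx))
  have hJl := J.len_pos
  obtain ⟨hQJ, hJQ, -⟩ := hbd S hΩ hf Q (hE.subset hQ) J hJ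
  -- The open cube is convex and contains the ball of radius ℓ(J)/2 about its center, so the cone
  -- from x over that ball stays inside.
  obtain ⟨N, hNc, hNr⟩ := hcone (z := J.center) (s := J.len / 2) hDo hDf hxD (by positivity)
    (by
      refine (J.dist_le_of_mem_dilate (J.openDilate_subset _ hx)
        (J.center_mem_dilate (a := 0) le_rfl)).trans ?_
      rw [← hκ]
      calc κ * ((1 + t + 0) * J.len / 2) ≤ κ * ((1 + 1 + 0) * J.len / 2) := by gcongr
        _ = _ := by ring)
    (fun τ h0 h1 => (J.ball_lineMap_subset hx (fun i => by
      rw [sub_self, abs_zero]; nlinarith) h0 h1).trans (openDilate_subset_cubeUnion hJE))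
  have hr1 := hN₁ S hΩ hf Q (hE.subset hQ) (S.family E) Construction.family_subset
    (Construction.wStar_subset_family hQ) J hJ
  obtain ⟨k, hk⟩ := Int.eq_ofNat_of_zero_le (sub_nonneg.2 hPQ)
  have hr2 := hE.reach_ancestor hC hM (D := D) (N := N₂) (fun Q hQ Q' hQ' h1 h2 h3 =>
    hN₂ S hΩ hf Q (hE.subset hQ) Q' (hE.subset hQ')
      (hwide Q (hE.subset hQ) Q' (hE.subset hQ') h1 h2 h3) _ Construction.family_subset
      (Construction.wStar_subset_family hQ')) hP k Q hQ (by linarith) hQP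
  refine ⟨N + N₁ + N₂ * (k + 1), ?_, (hNr.trans hr1).trans hr2⟩
  set p := posLog (d / δ) with hp
  have hp0 : 0 ≤ p := posLog_nonneg _
  have e1 : posLog (J.len / 2 / δ) ≤ posLog β + p := by
    refine (posLog_mono (by positivity) ?_).trans (posLog_mul_le hβ (by positivity))
    rw [← mul_div_assoc]
    gcongr
    linarith
  -- The number k of generations climbed is log₂(ℓ(P)/ℓ(Q)). As δ ≤ 42κ ℓ(J) ≤ 42κ b ℓ(Q) and ℓ(P) ≤
  -- β d, the ratio is at most γ d/δ.
  have e2 : (k : ℝ) ≤ posLog γ + p := by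
    have h1 : (2 : ℝ) ^ k = P.len / Q.len := by
      rw [Cube.len, Cube.len, ← zpow_sub₀ (by norm_num), ← zpow_natCast]
      congr 1
      omega
    have h2 : (2 : ℝ) ^ k ≤ γ * (d / δ) := by
      rw [h1, ← mul_div_assoc, div_le_div_iff₀ Q.len_pos hδ0]
      have : δ ≤ 42 * κ * (b * Q.len) := hδJ.trans (by gcongr)
      calc P.len * δ ≤ β * d * (42 * κ * (b * Q.len)) := by gcongr
        _ = _ := by rw [hγ]; ring
    have h3 : (k : ℝ) = Real.logb 2 ((2 : ℝ) ^ k) := by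
      rw [Real.logb_pow, Real.logb_self_eq_one (by norm_num), mul_one]
    rw [h3]
    exact (logb_le_posLog _).trans ((posLog_mono (by positivity) h2).trans
      (posLog_mul_le hγ0 (by positivity)))
  push_cast
  have q1 := posLog_nonneg β
  have q2 := posLog_nonneg γ
  calc (N : ℝ) + N₁ + N₂ * (k + 1)
      ≤ c * (1 + (posLog β + p)) + N₁ + N₂ * (posLog γ + p + 1) := by
        gcongr
        exact hNc.trans (by gcongr)
    _ ≤ _ := by
        have : 0 ≤ c * posLog β * p := by positivity
        have : 0 ≤ (N₁ : ℝ) * p := by positivity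
        have : 0 ≤ N₂ * posLog γ * p := by positivity
        nlinarith

set_option maxHeartbeats 600000 in
/-- The Harnack chain condition for the regions of coherent families. -/
theorem exists_harnack (n : ℕ) {c₀ C₁ C₂ C A t M : ℝ} (K : ℝ) (m₀ : ℕ) (hc₀ : 0 < c₀)
    (hC₁ : 1 < C₁) (hC₂ : 1 < C₂) (hC : 1 ≤ C) (hA : 1 ≤ A) (ht0 : 0 < t) (ht : t ≤ 1 / 256)
    (hM : 2 * C + 1 ≤ M) :
    ∃ k : ℝ, 1 < k ∧ ∀ {Ω : Set (Pt n)} (S : Construction Ω c₀ C₁ C₂ C A m₀ K), IsOpen Ω →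
      (frontier Ω).Nonempty → S.IsWide M → ∀ {T : Set ℤ} {E : Set (Cube n)}, S.IsCoherent M T E →
      ∀ x ∈ cubeUnion (S.family E) t, ∀ y ∈ cubeUnion (S.family E) t,
      ∃ N : ℕ, (N : ℝ) + 1 ≤
        k * (2 + posLog (dist x y / min (Metric.infDist x (frontier (cubeUnion (S.family E) t)))
          (Metric.infDist y (frontier (cubeUnion (S.family E) t))))) ∧
        Reach (cubeUnion (S.family E) t) N x y := by
  set κ := unitDiam n with hκ
  have hκ1 : 1 ≤ κ := one_le_unitDiam n
  have ht1 : t ≤ 1 := by linarith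
  obtain ⟨b, hb, hbd⟩ := exists_wStar_bounds n K m₀ hc₀ hC₁ hC₂ hC hA
  obtain ⟨c, hc, hcone⟩ := exists_reach_of_cone (M := 3 * κ / t) (by
    rw [one_le_div ht0]; linarith)
  -- Twice the scale L = 1300 b² d at which the common generation is chosen below.
  set β := 2600 * b ^ 2 with hβ
  have hb2 : b ≤ b ^ 2 := by nlinarith
  obtain ⟨k₁, hk₁, hup⟩ := exists_reach_up n K m₀ hc₀ hC₁ hC₂ hC hA ht0 ht1
    (by linarith : C ≤ M) (β := β) (by positivity)
  obtain ⟨N₂, hN₂⟩ := exists_reach_neighbor n K m₀ hc₀ hC₁ hC₂ hC hA ht0 ht1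
  refine ⟨2 * c + 2 * k₁ + N₂ + 2, by
    have : (0 : ℝ) ≤ N₂ := Nat.cast_nonneg _
    linarith, ?_⟩
  intro Ω S hΩ hf hwide T E hE x hx y hy
  set D := cubeUnion (S.family E) t with hD
  have hDo : IsOpen D := isOpen_cubeUnion _ t
  obtain ⟨J, hJE, hxJ⟩ := mem_cubeUnion.1 hx
  obtain ⟨J', hJE', hyJ'⟩ := mem_cubeUnion.1 hy
  have hDf : (frontier D).Nonempty := S.whitney.frontier_cubeUnion_nonempty hf
    Construction.family_subset ht0 ht1 ⟨J, hJE⟩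
  have hδx : 0 < Metric.infDist x (frontier D) := infDist_frontier_pos hDo hDf hx
  have hδy : 0 < Metric.infDist y (frontier D) := infDist_frontier_pos hDo hDf hy
  set δx := Metric.infDist x (frontier D)
  set δy := Metric.infDist y (frontier D)
  set d := dist x y with hd
  have hd0 : 0 ≤ d := dist_nonneg
  set p := posLog (d / min δx δy) with hp
  have hp0 : 0 ≤ p := posLog_nonneg _
  have hN₂0 : (0 : ℝ) ≤ N₂ := Nat.cast_nonneg _
  have hpx : ∀ s, 0 ≤ s → s ≤ d → posLog (s / δx) ≤ p := fun s h0 hs =>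
    posLog_mono (by positivity) (div_le_div₀ hd0 hs (lt_min hδx hδy) (min_le_left _ _))
  have hpy : ∀ s, 0 ≤ s → s ≤ d → posLog (s / δy) ≤ p := fun s h0 hs =>
    posLog_mono (by positivity) (div_le_div₀ hd0 hs (lt_min hδx hδy) (min_le_right _ _))
  rcases hd0.eq_or_lt with h0 | hdpos
  · have : x = y := dist_eq_zero.1 h0.symm
    subst this
    refine ⟨0, ?_, Reach.refl x hx⟩
    push_cast
    nlinarith
  have hxJ' := J.openDilate_subset _ hxJ
  have hyJ'' := J'.openDilate_subset _ hyJ'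
  have hJl := J.len_pos
  have hJl' := J'.len_pos
  -- For points much closer than the size of their cubes, reaching the centers could cost
  -- log(ℓ(J)/δ) hops, which d/δ does not control; they are joined through the overlap of the cubes
  -- instead.
  by_cases hnear : d ≤ J.len / 56
  · obtain ⟨z, s, hs0, hsd, hds, hzJ, hzJ', hxz, hyz⟩ := S.whitney.exists_overlap hf
      (Construction.family_subset hJE) (Construction.family_subset hJE') ht0 ht hxJ' hyJ'' hdpos hnear
    have hMs : 3 * κ * d ≤ 3 * κ / t * s := by
      rw [div_mul_eq_mul_div, mul_div_assoc]
      gcongr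
    obtain ⟨N, hN, hNr⟩ := hcone hDo hDf hx hs0 (hxz.trans hMs) fun τ h0 h1 =>
      (J.ball_lineMap_subset hxJ hzJ h0 h1).trans (openDilate_subset_cubeUnion hJE)
    obtain ⟨N', hN', hNr'⟩ := hcone hDo hDf hy hs0 (hyz.trans hMs) fun τ h0 h1 =>
      (J'.ball_lineMap_subset hyJ' hzJ' h0 h1).trans (openDilate_subset_cubeUnion hJE')
    refine ⟨N + N', ?_, hNr.trans hNr'.symm⟩
    have e1 : (N : ℝ) ≤ c * (1 + p) := hN.trans (by gcongr; exact hpx s hs0.le hsd)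
    have e2 : (N' : ℝ) ≤ c * (1 + p) := hN'.trans (by gcongr; exact hpy s hs0.le hsd)
    push_cast
    linarith [mul_nonneg hc.le hp0, mul_nonneg hk₁.le hp0, mul_nonneg hN₂0 hp0]
  · rw [not_le] at hnear
    obtain ⟨Q, hQ, hJQ⟩ := Construction.mem_family.1 hJE
    obtain ⟨Q', hQ', hJQ'⟩ := Construction.mem_family.1 hJE'
    have a1 := S.whitney.infDist_le hf hJQ.1 ht1 hxJ'
    have a2 := S.whitney.le_infDist hf hJQ'.1 ht1 hyJ''
    have a3 : Metric.infDist y (frontier Ω) ≤ Metric.infDist x (frontier Ω) + d := by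
      rw [hd, dist_comm]; exact Metric.infDist_le_infDist_add_dist
    have s1 : J.len ≤ 600 * d := by linarith
    have s2 : J'.len ≤ 600 * d := by
      have : κ * J'.len ≤ κ * (600 * d) := by nlinarith
      exact le_of_mul_le_mul_left this (by linarith)
    obtain ⟨b1, -, b3⟩ := hbd S hΩ hf Q (hE.subset hQ) J hJQ
    obtain ⟨b1', -, b3'⟩ := hbd S hΩ hf Q' (hE.subset hQ') J' hJQ'
    have l1 : b * Q.len ≤ 600 * b ^ 2 * d := by
      calc b * Q.len ≤ b * (b * (600 * d)) := by gcongr; exact b1.trans (by gcongr)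
        _ = _ := by ring
    have l2 : b * Q'.len ≤ 600 * b ^ 2 * d := by
      calc b * Q'.len ≤ b * (b * (600 * d)) := by gcongr; exact b1'.trans (by gcongr)
        _ = _ := by ring
    have hQl := Q.len_pos
    have hQl' := Q'.len_pos
    have hd' : d ≤ b ^ 2 * d := by nlinarith
    -- The distance of the centers of Q and Q' is at most bℓ(Q) + d + bℓ(Q') ≤ 1201 b² d ≤ L.
    -- Ancestors of length at least L thus have centers within (2C + 1)ℓ(P) of each other.
    obtain ⟨P, hP, P', hP', hPP, hPQ, hPQ', hsub, hsub', hPL, hPT⟩ :=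
      hE.exists_common_gen hQ hQ' (L := 1300 * b ^ 2 * d) (by nlinarith) (by nlinarith)
    have hlen : P'.len = P.len := by rw [Cube.len, Cube.len, hPP]
    have hβd : P.len ≤ β * d := by rw [hβ]; linarith
    obtain ⟨N, hN, hNr⟩ := hup S hΩ hf hwide hE Q hQ J hJQ x hxJ d hdpos
      (s1.trans (by rw [hβ]; nlinarith)) P hP hsub hPQ hβd
    obtain ⟨N', hN', hNr'⟩ := hup S hΩ hf hwide hE Q' hQ' J' hJQ' y hyJ' d hdpos
      (s2.trans (by rw [hβ]; nlinarith)) P' hP' hsub' (by rw [hPP]; exact hPQ') (by rw [hlen]; exact hβd)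
    have hdist : dist (S.ctr P) (S.ctr P') ≤ M * P'.len := by
      rcases hPT with h | h
      · have e1 := S.dist_ctr_lt (hE.subset hP) (hsub (S.ctr_mem hC (hE.subset hQ)))
        have e2 := S.dist_ctr_lt (hE.subset hP') (hsub' (S.ctr_mem hC (hE.subset hQ')))
        have e3 := b3 t ht1 x hxJ'
        have e4 := b3' t ht1 y hyJ''
        have t1 := dist_triangle4 (S.ctr P) (S.ctr Q) (S.ctr Q') (S.ctr P')
        have t2 := dist_triangle4 (S.ctr Q) x y (S.ctr Q')
        rw [dist_comm (S.ctr P) (S.ctr Q)] at t1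
        rw [dist_comm (S.ctr Q) x] at t2
        have hP0 := P.len_pos
        rw [hlen] at e2 ⊢
        have hMP : (2 * C + 1) * P.len ≤ M * P.len := by gcongr
        linarith
      · exact hE.top P.1 (hE.gen_mem P hP) h P hP P' hP' rfl hPP
    have hmid := hN₂ S hΩ hf P (hE.subset hP) P' (hE.subset hP')
      (hwide P (hE.subset hP) P' (hE.subset hP') hPP.le (by omega) hdist) _
      Construction.family_subset (Construction.wStar_subset_family hP')
    refine ⟨N + N₂ + N', ?_, (hNr.trans hmid).trans hNr'.symm⟩
    have e1 : (N : ℝ) ≤ k₁ * (1 + p) := hN.trans (by gcongr; exact hpx d hd0 le_rfl)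
    have e2 : (N' : ℝ) ≤ k₁ * (1 + p) := hN'.trans (by gcongr; exact hpy d hd0 le_rfl)
    push_cast
    linarith [mul_nonneg hc.le hp0, mul_nonneg hk₁.le hp0, mul_nonneg hN₂0 hp0]

/-! ### Corkscrews and capacity density for the regions of coherent families -/

theorem ediam_frontier_le {n : ℕ} {D : Set (Pt n)} : Metric.ediam (frontier D) ≤ Metric.ediam D :=
  (Metric.ediam_mono frontier_subset_closure).trans (Metric.ediam_closure D).le

theorem Cube.len_le_len {n : ℕ} {P Q : Cube n} (h : P.1 ≤ Q.1) : Q.len ≤ P.len :=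
  zpow_le_zpow_right₀ one_lt_two.le (by omega)

/-- The region of a coherent family is of the size of the cubes of the first generation. -/
theorem Construction.IsCoherent.ediam_le {n : ℕ} {Ω : Set (Pt n)} {c₀ C₁ C₂ C A K : ℝ} {m₀ : ℕ}
    {S : Construction Ω c₀ C₁ C₂ C A m₀ K} {M : ℝ} {T : Set ℤ} {E : Set (Cube n)}
    (hE : S.IsCoherent M T E) (hC : 1 ≤ C) {b t : ℝ} (hb : 1 ≤ b)
    (hbd : ∀ Q ∈ S.𝔻, ∀ J ∈ S.wStar Q, ∀ z ∈ J.dilate (1 + t), dist z (S.ctr Q) ≤ b * Q.len)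
    {P : Cube n} (hP : P ∈ E) (hPT : P.1 - 1 ∉ T) :
    Metric.ediam (cubeUnion (S.family E) t) ≤ ENNReal.ofReal (2 * (b + C + M) * P.len) := by
  have key : ∀ w ∈ cubeUnion (S.family E) t, dist w (S.ctr P) ≤ (b + C + M) * P.len := by
    intro w hw
    obtain ⟨J, hJ, hwJ⟩ := mem_cubeUnion.1 hw
    obtain ⟨Q, hQ, hJQ⟩ := Construction.mem_family.1 hJ
    have hPQ : P.1 ≤ Q.1 := by
      by_contra h
      exact hPT (hE.upper _ (hE.gen_mem Q hQ) _ (by omega))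
    obtain ⟨P', hP', hPP, hsub⟩ := hE.ancestor Q hQ P.1 (hE.gen_mem P hP) hPQ
    have e1 := hbd Q (hE.subset hQ) J hJQ w (J.openDilate_subset _ hwJ)
    have e2 := S.dist_ctr_lt (hE.subset hP') (hsub (S.ctr_mem hC (hE.subset hQ)))
    have e3 := hE.top P.1 (hE.gen_mem P hP) hPT P' hP' P hP hPP rfl
    have e4 := Cube.len_le_len hPQ
    have e5 : P'.len = P.len := by rw [Cube.len, Cube.len, hPP]
    rw [e5] at e2
    have e6 : b * Q.len ≤ b * P.len := by gcongr
    have := dist_triangle4 w (S.ctr Q) (S.ctr P') (S.ctr P)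
    linarith
  refine Metric.ediam_le fun x hx y hy => ?_
  rw [edist_dist]
  apply ENNReal.ofReal_le_ofReal
  have := dist_triangle_right x y (S.ctr P)
  linarith [key x hx, key y hy]

/-- The Corkscrew condition for the regions of coherent families. -/
theorem exists_corkscrew (n : ℕ) {c₀ C₁ C₂ C A t M : ℝ} (K : ℝ) (m₀ : ℕ) (hc₀ : 0 < c₀)
    (hC₁ : 1 < C₁) (hC₂ : 1 < C₂) (hC : 1 ≤ C) (hA : 1 ≤ A) (ht0 : 0 < t) (ht : t ≤ 1)
    (hM : C ≤ M) :
    ∃ c : ℝ, ∀ {Ω : Set (Pt n)} (S : Construction Ω c₀ C₁ C₂ C A m₀ K), IsOpen Ω →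
      (frontier Ω).Nonempty → S.IsWide M → ∀ {T : Set ℤ} {E : Set (Cube n)}, S.IsCoherent M T E →
      CorkscrewCondition (cubeUnion (S.family E) t) c := by
  set κ := unitDiam n with hκ
  have hκ1 : 1 ≤ κ := one_le_unitDiam n
  obtain ⟨b, hb, hbd⟩ := exists_wStar_bounds n K m₀ hc₀ hC₁ hC₂ hC hA
  -- With ℓ(Q) ≤ ηr and ℓ(P) ≤ 2ηr, the point X_P is within 2(b + C + 1)ηr = r/4 of z. The smaller
  -- η' covers ancestors of the first generation, which may be shorter than ηr.
  set η := 1 / (8 * (b + C + 1)) with hη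
  set η' := min η (1 / (2 * (b + C + M))) with hη'
  have hη0 : 0 < η := by positivity
  have hη'0 : 0 < η' := lt_min hη0 (by have : 0 < b + C + M := by linarith
                                       positivity)
  have hη'η : η' ≤ η := min_le_left _ _
  have hηe : (b + C + 1) * η = 1 / 8 := by rw [hη]; field_simp
  set c := min (1 / (8 * κ)) (t * η' / (2 * b)) with hc
  have hc0 : 0 < c := lt_min (by positivity) (by positivity)
  have hc8 : c ≤ 1 / 8 := (min_le_left _ _).trans
    (one_div_le_one_div_of_le (by norm_num) (by linarith))
  refine ⟨c, ?_⟩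
  intro Ω S hΩ hf hwide T E hE
  set D := cubeUnion (S.family E) t with hD
  refine ⟨hc0, by linarith, fun x hx r hr hrd => ?_⟩
  obtain ⟨z, hzD, hxz⟩ := Metric.mem_closure_iff.1 (frontier_subset_closure hx) (r / 4) (by linarith)
  obtain ⟨J, hJ, hzJ⟩ := mem_cubeUnion.1 hzD
  obtain ⟨Q, hQ, hJQ⟩ := Construction.mem_family.1 hJ
  have hQ' := hE.subset hQ
  obtain ⟨b1, b2, b3⟩ := hbd S hΩ hf Q hQ' J hJQ
  have hcr : c * r ≤ r / 8 := by nlinarith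
  have hJl := J.len_pos
  by_cases hlen : Q.len ≤ η * r
  · obtain ⟨P, hP, -, -, -, hPQ, -, hsub, -, hPL, hPT⟩ := hE.exists_common_gen hQ hQ hlen hlen
    have hP' := hE.subset hP
    have hPl := P.len_pos
    have hPr : η' * r ≤ P.len := by
      rcases hPT with h | h
      · exact le_trans (by gcongr) h
      -- The climb stopped at the first generation, so the whole region has diameter at most a
      -- multiple of ℓ(P), while r is less than that diameter.
      · have h1 := hE.ediam_le hC hb (fun Q hQ J hJ z hz => (hbd S hΩ hf Q hQ J hJ).2.2 t ht z hz)
          hP h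
        have h2 := hrd.trans_le (ediam_frontier_le.trans h1)
        rw [ENNReal.ofReal_lt_ofReal_iff_of_nonneg hr.le] at h2
        have h3 : 0 < b + C + M := by linarith
        calc η' * r ≤ 1 / (2 * (b + C + M)) * (2 * (b + C + M) * P.len) := by
              gcongr
              exact min_le_right _ _
          _ = P.len := by field_simp
    obtain ⟨I, hI, hXI⟩ := hE.exists_mem_near hwide hC hM hP
    have i1 := (hbd S hΩ hf P hP' I hI).1
    have hXd := (S.X_mem hc₀ hC hA hP').2
    have e1 := S.dist_ctr_lt hP' (hsub (S.ctr_mem hC hQ'))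
    have e2 := b3 t ht z (J.openDilate_subset _ hzJ)
    have hXx : dist (S.X P) x ≤ r / 2 := by
      have t1 := dist_triangle4 (S.X P) (S.ctr P) (S.ctr Q) z
      have t2 := dist_triangle (S.X P) z x
      rw [dist_comm (S.ctr P), dist_comm (S.ctr Q) z] at t1
      rw [dist_comm] at hxz
      have g1 : C * P.len ≤ C * (2 * (η * r)) := by gcongr
      have g2 : b * Q.len ≤ b * (η * r) := by gcongr
      have g3 : (b + C + 1) * (η * r) = r / 8 := by rw [← mul_assoc, hηe]; ring
      have g4 : 0 ≤ b * (η * r) := by positivity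
      have g5 : 0 ≤ η * r := by positivity
      linarith
    refine ⟨S.X P, Set.subset_inter (Metric.ball_subset_ball' (by linarith)) ?_⟩
    refine (Metric.ball_subset_ball ?_).trans ((WCube.ball_subset_openDilate hXI).trans
      (openDilate_subset_cubeUnion (Construction.wStar_subset_family hP hI)))
    calc c * r ≤ t * η' / (2 * b) * r := by gcongr; exact min_le_right _ _
      _ = t * (η' * r) / (2 * b) := by ring
      _ ≤ t * (b * I.len) / (2 * b) := by
          have := hPr.trans i1
          gcongr t * ?_ / (2 * b)
      _ = _ := by field_simp
  · rw [not_le] at hlen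
    -- The cube J itself has size at least a multiple of r here; the Corkscrew point lies on the
    -- segment from z to its center, where the cone contains balls.
    set τ := min 1 (r / (4 * κ * J.len)) with hτ
    have hτ0 : 0 < τ := lt_min one_pos (by positivity)
    have hτ1 : τ ≤ 1 := min_le_left _ _
    have hdz : dist z J.center ≤ κ * J.len := by
      refine (J.dist_le_of_mem_dilate (J.openDilate_subset _ hzJ)
        (J.center_mem_dilate (a := 0) le_rfl)).trans ?_
      rw [← hκ]
      calc κ * ((1 + t + 0) * J.len / 2) ≤ κ * ((1 + 1 + 0) * J.len / 2) := by gcongr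
        _ = _ := by ring
    have hpd : dist (AffineMap.lineMap z J.center τ) z ≤ r / 4 := by
      rw [dist_lineMap_left, Real.norm_of_nonneg hτ0.le]
      calc τ * dist z J.center ≤ r / (4 * κ * J.len) * (κ * J.len) := by
            gcongr
            exact min_le_right _ _
        _ = _ := by field_simp
    refine ⟨AffineMap.lineMap z J.center τ, Set.subset_inter (Metric.ball_subset_ball' ?_) ?_⟩
    · have := dist_triangle (AffineMap.lineMap z J.center τ) z x
      rw [dist_comm z x] at this
      linarith
    · refine (Metric.ball_subset_ball ?_).trans ((J.ball_lineMap_subset (s := J.len / 2) hzJ (fun i => by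
        rw [sub_self, abs_zero]; nlinarith) hτ0 hτ1).trans (openDilate_subset_cubeUnion hJ))
      rcases min_choice 1 (r / (4 * κ * J.len)) with h | h
      · rw [hτ, h]
        calc c * r ≤ t * η' / (2 * b) * r := by gcongr; exact min_le_right _ _
          _ ≤ 1 * η / (2 * b) * r := by gcongr
          _ = η * r / (2 * b) := by ring
          _ ≤ b * J.len / (2 * b) := by
              have := hlen.le.trans b1
              gcongr ?_ / (2 * b)
          _ = _ := by field_simp
      · rw [hτ, h]
        calc c * r ≤ 1 / (8 * κ) * r := by gcongr; exact min_le_left _ _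
          _ = _ := by field_simp; norm_num

/-- The region of a coherent family is at most of the size of `∂Ω`. -/
theorem Construction.ediam_cubeUnion_le {n : ℕ} {Ω : Set (Pt n)} {c₀ C₁ C₂ C A K : ℝ} {m₀ : ℕ}
    (S : Construction Ω c₀ C₁ C₂ C A m₀ K) {E : Set (Cube n)} (hE : E ⊆ S.𝔻) {b t : ℝ} (hb : 1 ≤ b)
    (hA : 1 ≤ A)
    (hbd : ∀ Q ∈ S.𝔻, ∀ J ∈ S.wStar Q, ∀ z ∈ J.dilate (1 + t), dist z (S.ctr Q) ≤ b * Q.len) :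
    Metric.ediam (cubeUnion (S.family E) t) ≤
      ENNReal.ofReal (800 * A * b + 1) * Metric.ediam (frontier Ω) := by
  have key : ∀ w ∈ cubeUnion (S.family E) t, ∃ x ∈ frontier Ω,
      edist w x ≤ ENNReal.ofReal (400 * A * b) * Metric.ediam (frontier Ω) := by
    intro w hw
    obtain ⟨J, hJ, hwJ⟩ := mem_cubeUnion.1 hw
    obtain ⟨Q, hQ, hJQ⟩ := Construction.mem_family.1 hJ
    have hQ' := hE hQ
    refine ⟨S.ctr Q, S.ctr_mem_frontier hQ', ?_⟩
    have h1 := hbd Q hQ' J hJQ w (J.openDilate_subset _ hwJ)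
    have h2 := hQ'.2
    rw [edist_dist]
    calc ENNReal.ofReal (dist w (S.ctr Q)) ≤ ENNReal.ofReal (b * Q.len) :=
          ENNReal.ofReal_le_ofReal h1
      _ = ENNReal.ofReal b * ENNReal.ofReal Q.len := ENNReal.ofReal_mul (by linarith)
      _ ≤ ENNReal.ofReal b * (ENNReal.ofReal (400 * A) * Metric.ediam (frontier Ω)) := by gcongr
      _ = _ := by
          rw [← mul_assoc, ← ENNReal.ofReal_mul (by linarith)]
          congr 2
          ring
  refine Metric.ediam_le fun x hx y hy => ?_
  obtain ⟨x', hx', hxx⟩ := key x hx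
  obtain ⟨y', hy', hyy⟩ := key y hy
  have h3 : edist x' y' ≤ Metric.ediam (frontier Ω) := Metric.edist_le_ediam_of_mem hx' hy'
  have e : ENNReal.ofReal (800 * A * b + 1) =
      ENNReal.ofReal (400 * A * b) + 1 + ENNReal.ofReal (400 * A * b) := by
    rw [← ENNReal.ofReal_one, ← ENNReal.ofReal_add (by positivity) (by positivity),
      ← ENNReal.ofReal_add (by positivity) (by positivity)]
    congr 1
    ring
  rw [e, add_mul, add_mul, one_mul]
  refine (edist_triangle4 x x' y' y).trans ?_
  rw [edist_comm y' y]
  gcongr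

/-- The capacity density condition for the regions of families of cubes. -/
theorem exists_capacityDensity {n : ℕ} (hn : 2 ≤ n) {c₀ C₁ C₂ c₁ C A t : ℝ} (K : ℝ) (m₀ : ℕ)
    (hc₀ : 0 < c₀) (hC₁ : 1 < C₁) (hC₂ : 1 < C₂) (hc₁ : 0 < c₁) (hC : 1 ≤ C) (hA : 1 ≤ A)
    (ht0 : 0 < t) (ht : t ≤ 1 / 64) :
    ∃ c : ℝ, ∀ {Ω : Set (Pt n)} (S : Construction Ω c₀ C₁ C₂ C A m₀ K), IsOpen Ω →
      (frontier Ω).Nonempty → CapacityDensity Ω c₁ → ∀ E ⊆ S.𝔻,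
      CapacityDensity (cubeUnion (S.family E) t) c := by
  set κ := unitDiam n with hκ
  have hκ1 : 1 ≤ κ := one_le_unitDiam n
  obtain ⟨b, hb, hbd⟩ := exists_wStar_bounds n K m₀ hc₀ hC₁ hC₂ hC hA
  -- Since r < diam ∂D ≤ (800Ab + 1) diam ∂Ω, this θ gives θr < diam ∂Ω, so that the condition for Ω
  -- applies at scale θr.
  set θ := 1 / (2 * (800 * A * b + 1)) with hθ
  have hθ0 : 0 < θ := by positivity
  have hAb : 1 ≤ A * b := by nlinarith
  have hθ1 : θ ≤ 1 / 2 := one_div_le_one_div_of_le (by norm_num) (by nlinarith)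
  have hθe : (800 * A * b + 1) * θ = 1 / 2 := by rw [hθ]; field_simp
  obtain ⟨k₁, hk₁, h₁⟩ := exists_cap_ratio_of_cap_ratio hn hθ0 (by linarith) hc₁
  obtain ⟨k₂, hk₂, h₂⟩ := exists_cap_ratio_of_ball hn (θ := 1 / (3200 * κ)) (by positivity)
  refine ⟨min k₁ k₂, ?_⟩
  intro Ω S hΩ hf hcdc E hE
  set D := cubeUnion (S.family E) t with hD
  have hDΩ : D ⊆ Ω := S.whitney.cubeUnion_subset hf Construction.family_subset (by linarith)
  refine ⟨lt_min hk₁ hk₂, fun x hx r hr hrd => ?_⟩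
  -- Near ∂Ω the complement of Ω is large in capacity; away from ∂Ω the complement of the region
  -- contains a ball.
  by_cases hδ : Metric.infDist x (frontier Ω) ≤ r / 2
  · obtain ⟨x', hx', hd⟩ := isClosed_frontier.exists_infDist_eq_dist hf x
    refine (ENNReal.ofReal_le_ofReal (min_le_left _ _)).trans
      (h₁ x x' r _ (Metric.closedBall x' (θ * r) \ Ω) hr ?_ Set.sdiff_subset ?_)
    · refine Set.sdiff_subset_sdiff (Metric.closedBall_subset_closedBall' ?_) hDΩ
      rw [dist_comm, ← hd]
      nlinarith
    · refine hcdc.2 x' hx' (θ * r) (by positivity) ?_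
      have h3 := hrd.trans_le (ediam_frontier_le.trans (S.ediam_cubeUnion_le hE hb hA
        fun Q hQ J hJ z hz => (hbd S hΩ hf Q hQ J hJ).2.2 t (by linarith) z hz))
      by_contra hcon
      rw [not_lt] at hcon
      have h4 := h3.trans_le (mul_le_mul_right hcon _)
      rw [← ENNReal.ofReal_mul (by positivity), ← mul_assoc, hθe,
        ENNReal.ofReal_lt_ofReal_iff_of_nonneg hr.le] at h4
      linarith
  · rw [not_le] at hδ
    have hxD : x ∉ D := by
      rw [(isOpen_cubeUnion _ t).frontier_eq] at hx
      exact hx.2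
    obtain ⟨y, hy, hdisj⟩ := S.whitney.exists_ball_disjoint hf Construction.family_subset ht0 ht hxD
      (half_pos hr) hδ.le
    refine (ENNReal.ofReal_le_ofReal (min_le_right _ _)).trans (h₂ x y r _ hr ?_)
    have hsub : Metric.closedBall y (1 / (3200 * κ) * r) ⊆
        Metric.ball y (r / 2 / (800 * unitDiam n)) := by
      apply Metric.closedBall_subset_ball
      rw [← hκ, one_div_mul_eq_div, div_div]
      apply div_lt_div_of_pos_left hr (by positivity)
      nlinarith
    intro w hw
    refine ⟨?_, fun hwD => ?_⟩
    · have := Metric.mem_ball.1 (hy (hsub hw))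
      rw [Metric.mem_closedBall]
      linarith
    · obtain ⟨J, hJ, hwJ⟩ := mem_cubeUnion.1 hwD
      exact Set.disjoint_left.1 (hdisj J hJ) (hsub hw) (J.openDilate_subset _ hwJ)

/-- The regions of coherent families are 1-sided NTA domains satisfying the capacity density
condition. -/
theorem exists_isNTAWithCDC {n : ℕ} (hn : 2 ≤ n) {c₀ C₁ C₂ c₁ C A t M : ℝ} (K : ℝ) (m₀ : ℕ)
    (hc₀ : 0 < c₀) (hC₁ : 1 < C₁) (hC₂ : 1 < C₂) (hc₁ : 0 < c₁) (hC : 1 ≤ C) (hA : 1 ≤ A)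
    (ht0 : 0 < t) (ht : t ≤ 1 / 256) (hM : 2 * C + 1 ≤ M) :
    ∃ c₀' C₁' C₂' c₁' : ℝ, ∀ {Ω : Set (Pt n)} (S : Construction Ω c₀ C₁ C₂ C A m₀ K), IsOpen Ω →
      (frontier Ω).Nonempty → CapacityDensity Ω c₁ → S.IsWide M → ∀ {T : Set ℤ} {E : Set (Cube n)},
      S.IsCoherent M T E → IsNTAWithCDC (cubeUnion (S.family E) t) c₀' C₁' C₂' c₁' := by
  obtain ⟨a, ha⟩ := exists_corkscrew n K m₀ hc₀ hC₁ hC₂ hC hA ht0 (by linarith)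
    (by linarith : C ≤ M)
  obtain ⟨k, hk, hh⟩ := exists_harnack n K m₀ hc₀ hC₁ hC₂ hC hA ht0 ht hM
  obtain ⟨c, hc⟩ := exists_capacityDensity hn K m₀ hc₀ hC₁ hC₂ hc₁ hC hA ht0 (by linarith)
  refine ⟨a, k, 2, c, ?_⟩
  intro Ω S hΩ hf hcdc hwide T E hE
  have hDo : IsOpen (cubeUnion (S.family E) t) := isOpen_cubeUnion _ t
  have hDf : (frontier (cubeUnion (S.family E) t)).Nonempty :=
    S.whitney.frontier_cubeUnion_nonempty hf Construction.family_subset ht0 (by linarith)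
      (hE.family_nonempty hwide hC (by linarith))
  refine ⟨⟨hDo, ?_, ha S hΩ hf hwide hE, hk, by norm_num, fun x hx y hy => ?_⟩,
    hc S hΩ hf hcdc E hE.subset⟩
  · refine isConnected_of_reach hDo hDf (nonempty_frontier_iff.1 hDf).1 fun x hx y hy => ?_
    obtain ⟨N, -, hN⟩ := hh S hΩ hf hwide hE x hx y hy
    exact ⟨N, hN⟩
  · obtain ⟨N, hN, hr⟩ := hh S hΩ hf hwide hE x hx y hy
    exact hr.exists_isHarnackChain hDo hDf hN

/-! ### Carleson boxes and sawtooth regions -/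

namespace Construction

variable {n : ℕ} {Ω : Set (Pt n)} {c₀ C₁ C₂ C A K t : ℝ} {m₀ : ℕ}
  (S : Construction Ω c₀ C₁ C₂ C A m₀ K) {Q : Cube n} {F : Set (Cube n)}

theorem interior_iUnion_U (hΩ : IsOpen Ω) (hf : (frontier Ω).Nonempty) (ht0 : 0 < t)
    (ht : t ≤ 1 / 64) (E : Set (Cube n)) :
    interior (⋃ Q ∈ E, S.U t Q) = cubeUnion (S.family E) t := by
  rw [← S.whitney.interior_iUnion_dilate hΩ hf family_subset ht0 ht]
  congr 1
  simp only [U, family, Set.biUnion_iUnion]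

theorem below_eq_localSaw_empty : S.below Q = S.localSaw ∅ Q := by
  simp [localSaw]

/-- An open ball that misses all the cubes also misses the closures of the boxes. So a point of Ω
outside the open cubes is not interior to the union of closures. -/
theorem interior_iUnion_closure (hΩ : IsOpen Ω) (hf : (frontier Ω).Nonempty) (ht0 : 0 < t)
    (ht : t ≤ 1 / 64) (B : Set (Cube n)) :
    interior (⋃ Q ∈ B, closure (S.carlesonBox t Q) ∩ Ω) =
      cubeUnion (S.family (⋃ Q ∈ B, S.below Q)) t := by
  have hbox : ∀ Q, S.carlesonBox t Q = cubeUnion (S.family (S.below Q)) t := fun Q =>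
    S.interior_iUnion_U hΩ hf ht0 ht _
  have hmono : ∀ Q ∈ B, S.family (S.below Q) ⊆ S.family (⋃ Q ∈ B, S.below Q) := fun Q hQ =>
    Set.biUnion_subset_biUnion_left (Set.subset_biUnion_of_mem (u := fun Q => S.below Q) hQ)
  apply Set.Subset.antisymm
  · intro x hx
    by_contra hxV
    obtain ⟨r, hr, hball⟩ := Metric.mem_nhds_iff.1 (mem_interior_iff_mem_nhds.1 hx)
    obtain ⟨-, -, -, hxΩ⟩ := Set.mem_iUnion₂.1 (interior_subset hx)
    have hδ := infDist_frontier_pos hΩ hf hxΩ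
    have hs := lt_min hr hδ
    obtain ⟨y, hy, hd⟩ := S.whitney.exists_ball_disjoint hf family_subset ht0 ht hxV hs
      (min_le_right _ _)
    have hρ := div_pos hs (mul_pos (by norm_num : (0 : ℝ) < 800) (unitDiam_pos n))
    obtain ⟨Q, hQ, hyQ, -⟩ := Set.mem_iUnion₂.1
      (hball (Metric.ball_subset_ball (min_le_left _ _) (hy (Metric.mem_ball_self hρ))))
    obtain ⟨z, hz, hyz⟩ := Metric.mem_closure_iff.1 hyQ _ hρ
    rw [hbox] at hz
    obtain ⟨J, hJ, hzJ⟩ := mem_cubeUnion.1 hz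
    exact Set.disjoint_left.1 (hd J (hmono Q hQ hJ)) (Metric.mem_ball'.2 hyz)
      (J.openDilate_subset _ hzJ)
  · refine interior_maximal ?_ (isOpen_cubeUnion _ t)
    intro x hx
    have hxΩ := S.whitney.cubeUnion_subset hf family_subset (by linarith) hx
    obtain ⟨J, hJ, hxJ⟩ := mem_cubeUnion.1 hx
    obtain ⟨Q', hQ', hJQ'⟩ := mem_family.1 hJ
    obtain ⟨Q, hQ, hQQ'⟩ := Set.mem_iUnion₂.1 hQ'
    refine Set.mem_biUnion hQ ⟨subset_closure ?_, hxΩ⟩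
    rw [hbox]
    exact mem_cubeUnion.2 ⟨J, mem_family.2 ⟨Q', hQQ', hJQ'⟩, hxJ⟩

theorem exists_ancestor {P : Cube n} (hP : P ∈ S.𝔻) {j : ℤ} (hj : j ≤ P.1) :
    ∃ P' : Set (Pt n), P' ∈ S.grid.gen j ∧ P.2 ⊆ P' := by
  rcases hj.eq_or_lt with rfl | hj
  · exact ⟨P.2, hP.1, subset_rfl⟩
  · exact (S.grid.ancestor j P.1 hj P.2 hP.1).exists

/-- Discretized Carleson regions contain all descendants of their cubes; hence their removal leaves
a sawtooth closed under ancestors. -/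
theorem mem_below_of_subset {P P' R : Cube n} (hP : P ∈ S.𝔻) (hsub : P.2 ⊆ P'.2) (hle : P'.1 ≤ P.1)
    (h : P' ∈ S.below R) : P ∈ S.below R :=
  ⟨hP, h.2.1.trans hle, hsub.trans h.2.2⟩

/-- A cube of an earlier generation than `P`, but not than `Q ∈ 𝔻`, containing `P ⊆ Q`. -/
theorem exists_ancestor_below (hC : 1 ≤ C) {P : Cube n} (hQ : Q ∈ S.𝔻) (hP : P ∈ S.below Q) {j : ℤ}
    (hQj : Q.1 ≤ j) (hj : j ≤ P.1) : ∃ P' ∈ S.below Q, P'.1 = j ∧ P.2 ⊆ P'.2 := by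
  obtain ⟨P', hP', hsub⟩ := S.exists_ancestor hP.1 hj
  refine ⟨(j, P'), ⟨⟨hP', le_trans ?_ hQ.2⟩, hQj, ?_⟩, rfl, hsub⟩
  · exact ENNReal.ofReal_le_ofReal (Cube.len_le_len (P := Q) (Q := (j, P')) hQj)
  · rcases S.grid.nested Q.1 j hQj P' hP' Q.2 hQ.1 with h | h
    · exact h
    · have hx := S.ctr_mem hC hP.1
      exact absurd (hP.2.2 hx) (Set.disjoint_left.1 h (hsub hx))

theorem isCoherent_localSaw (hC : 1 ≤ C) (hQ : Q ∈ S.𝔻) (hne : (S.localSaw F Q).Nonempty) :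
    S.IsCoherent (6 * C) {j | Q.1 ≤ j} (S.localSaw F Q) where
  subset := fun P hP => hP.1.1
  nonempty := hne
  gen_mem := fun P hP => hP.1.2.1
  upper := fun j hj k hjk => le_trans hj hjk
  ancestor := by
    intro P hP j hj hjP
    obtain ⟨P', hP', hj', hsub⟩ := S.exists_ancestor_below hC hQ hP.1 hj hjP
    refine ⟨P', ⟨hP', fun h => hP.2 ?_⟩, hj', hsub⟩
    obtain ⟨R, hR, hP'R⟩ := Set.mem_iUnion₂.1 h
    exact Set.mem_biUnion hR (S.mem_below_of_subset hP.1.1 hsub (by rw [hj']; exact hjP) hP'R)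
  top := by
    intro j hj hj' P hP P' hP' h h'
    have hjQ : j = Q.1 := by
      have h1 : Q.1 ≤ j := hj
      have h2 : ¬ Q.1 ≤ j - 1 := hj'
      omega
    have e1 := S.dist_ctr_lt hQ (hP.1.2.2 (S.ctr_mem hC hP.1.1))
    have e2 := S.dist_ctr_lt hQ (hP'.1.2.2 (S.ctr_mem hC hP'.1.1))
    have e3 := dist_triangle_right (S.ctr P) (S.ctr P') (S.ctr Q)
    have e4 : P'.len = Q.len := by rw [Cube.len, Cube.len, h', hjQ]
    have e5 : 0 < C * Q.len := mul_pos (by linarith) Q.len_pos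
    rw [e4]
    linarith

/-- If ∂Ω is unbounded, every generation is allowed and there is no first one. Otherwise cubes of
the first generation satisfy 400A diam ∂Ω < 2ℓ, so all centers on ∂Ω are near each other. -/
theorem isCoherent_globalSaw (hC : 1 ≤ C) (hA : 1 ≤ A) (hne : (S.globalSaw F).Nonempty) :
    S.IsCoherent (6 * C) {j | ENNReal.ofReal ((2 : ℝ) ^ (-j)) ≤
      ENNReal.ofReal (400 * A) * Metric.ediam (frontier Ω)} (S.globalSaw F) where
  subset := fun P hP => hP.1
  nonempty := hne
  gen_mem := fun P hP => hP.1.2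
  upper := fun j hj k hjk => le_trans (ENNReal.ofReal_le_ofReal
    (zpow_le_zpow_right₀ one_lt_two.le (by omega))) hj
  ancestor := by
    intro P hP j hj hjP
    obtain ⟨P', hP', hsub⟩ := S.exists_ancestor hP.1 hjP
    refine ⟨(j, P'), ⟨⟨hP', hj⟩, fun h => hP.2 ?_⟩, rfl, hsub⟩
    obtain ⟨R, hR, hP'R⟩ := Set.mem_iUnion₂.1 h
    exact Set.mem_biUnion hR (S.mem_below_of_subset hP.1 hsub hjP hP'R)
  top := by
    intro j hj hj' P hP P' hP' h h'
    have h1 : edist (S.ctr P) (S.ctr P') ≤ Metric.ediam (frontier Ω) :=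
      Metric.edist_le_ediam_of_mem (S.ctr_mem_frontier hP.1) (S.ctr_mem_frontier hP'.1)
    have h2 : ENNReal.ofReal (400 * A) * Metric.ediam (frontier Ω) <
        ENNReal.ofReal ((2 : ℝ) ^ (-(j - 1))) := not_le.1 hj'
    have h3 := (mul_le_mul_right h1 (ENNReal.ofReal (400 * A))).trans_lt h2
    rw [edist_dist, ← ENNReal.ofReal_mul (by linarith),
      ENNReal.ofReal_lt_ofReal_iff (zpow_pos (by norm_num) _)] at h3
    have h4 : (2 : ℝ) ^ (-(j - 1)) = 2 * P'.len := by
      rw [Cube.len, h', neg_sub, sub_eq_add_neg, zpow_add₀ (by norm_num), zpow_one]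
    rw [h4] at h3
    have hl := P'.len_pos
    have h5 := dist_nonneg (x := S.ctr P) (y := S.ctr P')
    nlinarith

theorem gen_eq_of_mem_ballCubes {x : Pt n} {r : ℝ} {Q Q' : Cube n} (hQ : Q ∈ S.ballCubes x r)
    (hQ' : Q' ∈ S.ballCubes x r) : Q.1 = Q'.1 := by
  have h1 := hQ.2.1.trans_le hQ'.2.2.1
  have h2 := hQ'.2.1.trans_le hQ.2.2.1
  rw [zpow_lt_zpow_iff_right₀ one_lt_two] at h1 h2
  omega

/-- A cube of the required generation has length less than 400r < 400A diam ∂Ω, hence belongs to 𝔻,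
and one of them contains x. -/
theorem ballCubes_nonempty {x : Pt n} {r : ℝ} (hx : x ∈ frontier Ω) (hr : 0 < r)
    (hrA : ENNReal.ofReal r < ENNReal.ofReal A * Metric.ediam (frontier Ω)) :
    (S.ballCubes x r).Nonempty := by
  obtain ⟨m, hm1, hm2⟩ := exists_mem_Ioc_zpow (by positivity : 0 < 200 * r) (one_lt_two (α := ℝ))
  have hx' := hx
  rw [← S.grid.cover (-(m + 1))] at hx'
  obtain ⟨Q, hQ, hxQ⟩ := hx'
  refine ⟨(-(m + 1), Q), ⟨hQ, ?_⟩, ?_, ?_, ⟨x, hxQ, Metric.mem_ball_self (by positivity), hx⟩⟩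
  · have h1 : Cube.len ((-(m + 1), Q) : Cube n) ≤ 400 * r := by
      rw [Cube.len, neg_neg, zpow_add_one₀ (by norm_num)]
      linarith
    refine (ENNReal.ofReal_le_ofReal h1).trans ?_
    rw [ENNReal.ofReal_mul (by norm_num), ENNReal.ofReal_mul (by norm_num), mul_assoc]
    gcongr
  · simpa using hm1
  · rw [neg_neg]
    exact hm2

/-- Top cubes lie in cubes of 𝔻^Δ, which meet B(x, 2r) with 200r ≤ ℓ(Q); their centers are within
2Cℓ(Q) + ℓ(Q) of x. This gives 4C + 2 ≤ 6C, the value of M used throughout. -/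
theorem isCoherent_ballCubes {x : Pt n} {r : ℝ} (hC : 1 ≤ C) (hQ : Q ∈ S.ballCubes x r) :
    S.IsCoherent (6 * C) {j | Q.1 ≤ j} (⋃ P ∈ S.ballCubes x r, S.below P) where
  subset := by
    intro P hP
    obtain ⟨R, -, hPR⟩ := Set.mem_iUnion₂.1 hP
    exact hPR.1
  nonempty := ⟨Q, Set.mem_biUnion hQ ⟨hQ.1, le_rfl, subset_rfl⟩⟩
  gen_mem := by
    intro P hP
    obtain ⟨R, hR, hPR⟩ := Set.mem_iUnion₂.1 hP
    change Q.1 ≤ P.1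
    rw [S.gen_eq_of_mem_ballCubes hQ hR]
    exact hPR.2.1
  upper := fun j hj k hjk => le_trans hj hjk
  ancestor := by
    intro P hP j hj hjP
    obtain ⟨R, hR, hPR⟩ := Set.mem_iUnion₂.1 hP
    obtain ⟨P', hP', hj', hsub⟩ := S.exists_ancestor_below hC hR.1 hPR
      (by rw [← S.gen_eq_of_mem_ballCubes hQ hR]; exact hj) hjP
    exact ⟨P', Set.mem_biUnion hR hP', hj', hsub⟩
  top := by
    intro j hj hj' P hP P' hP' h h'
    have hjQ : j = Q.1 := by
      have h1 : Q.1 ≤ j := hj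
      have h2 : ¬ Q.1 ≤ j - 1 := hj'
      omega
    have e4 : P'.len = Q.len := by rw [Cube.len, Cube.len, h', hjQ]
    have hl := Q.len_pos
    have key : ∀ P ∈ ⋃ P ∈ S.ballCubes x r, S.below P,
        dist (S.ctr P) x ≤ 2 * (C * Q.len) + Q.len := by
      intro P hP
      obtain ⟨R, hR, hPR⟩ := Set.mem_iUnion₂.1 hP
      obtain ⟨y, hyR, hyx, -⟩ := hR.2.2.2
      have e5 : R.len = Q.len := by rw [Cube.len, Cube.len, S.gen_eq_of_mem_ballCubes hQ hR]
      have e1 := S.dist_ctr_lt hR.1 (hPR.2.2 (S.ctr_mem hC hPR.1))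
      have e2 := S.dist_ctr_lt hR.1 hyR
      have e3 : 200 * r ≤ Q.len := hQ.2.2.1
      have e6 := dist_triangle4 (S.ctr P) (S.ctr R) y x
      rw [dist_comm (S.ctr R) y] at e6
      rw [Metric.mem_ball] at hyx
      rw [e5] at e1 e2
      linarith
    have e3 := dist_triangle_right (S.ctr P) (S.ctr P') x
    have e6 : Q.len ≤ C * Q.len := by nlinarith
    rw [e4]
    linarith [key P hP, key P' hP']

end Construction

end Sawtooth

end

/-! ### Assembly: the four kinds of regions as regions of coherent families. -/

theorem mainTheorem7 (n : ℕ) (hn : 2 ≤ n) :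
    -- the size of the fattening parameter depends only on the dimension
    ∃ t₀ : ℝ, 0 < t₀ ∧ t₀ < 1 ∧
    ∀ c₀ C₁ C₂ c₁ C A : ℝ, 1 ≤ C → 1 ≤ A →
    -- the parameters of the Whitney regions have to be large enough
    ∃ (mMin : ℕ) (KMin : ℝ),
    ∀ (m₀ : ℕ) (K t : ℝ), mMin ≤ m₀ → KMin ≤ K → 0 < t → t < t₀ →
    -- the constants of the new domains depend on nothing else
    ∃ c₀' C₁' C₂' c₁' : ℝ,
    ∀ (Ω : Set (Pt n)), IsNTAWithCDC Ω c₀ C₁ C₂ c₁ →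
    ∀ S : Construction Ω c₀ C₁ C₂ C A m₀ K,
      (∀ Q ∈ S.𝔻, IsNTAWithCDC (S.carlesonBox t Q) c₀' C₁' C₂' c₁') ∧
      (∀ x ∈ frontier Ω, ∀ r : ℝ, 0 < r →
        ENNReal.ofReal r < ENNReal.ofReal A * Metric.ediam (frontier Ω) →
        IsNTAWithCDC (S.ballBox t x r) c₀' C₁' C₂' c₁') ∧
      (∀ F ⊆ S.𝔻, F.PairwiseDisjoint Prod.snd → (S.globalSaw F).Nonempty →
        IsNTAWithCDC (S.globalSawtooth t F) c₀' C₁' C₂' c₁') ∧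
      (∀ F ⊆ S.𝔻, F.PairwiseDisjoint Prod.snd → ∀ Q ∈ S.𝔻, (S.localSaw F Q).Nonempty →
        IsNTAWithCDC (S.localSawtooth t F Q) c₀' C₁' C₂' c₁') := by
  refine ⟨1 / 256, by norm_num, by norm_num, fun c₀ C₁ C₂ c₁ C A hC hA => ?_⟩
  by_cases hpar : 0 < c₀ ∧ 1 < C₁ ∧ 1 < C₂ ∧ 0 < c₁
  · obtain ⟨hc₀, hC₁, hC₂, hc₁⟩ := hpar
    obtain ⟨mMin, hwide⟩ := exists_isWide n C₁ C₂ hc₀ hC hA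
    -- Wideness with M = 6C requires K ≥ M + 1.
    refine ⟨mMin, 6 * C + 1, fun m₀ K t hm hK ht0 ht => ?_⟩
    obtain ⟨c₀', C₁', C₂', c₁', key⟩ := exists_isNTAWithCDC hn K m₀ hc₀ hC₁ hC₂ hc₁ hC hA ht0 ht.le
      (by linarith : 2 * C + 1 ≤ 6 * C)
    refine ⟨c₀', C₁', C₂', c₁', fun Ω hΩ S => ?_⟩
    have hΩo : IsOpen Ω := hΩ.1.1
    have hf : (frontier Ω).Nonempty := hΩ.1.2.2.2.frontier_nonempty hΩ.1.2.1.nonempty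
    have hw := hwide m₀ K (6 * C) hm hK S hΩo hf
    have ht' : t ≤ 1 / 64 := by linarith
    have hlocal : ∀ F : Set (Cube n), ∀ Q ∈ S.𝔻, (S.localSaw F Q).Nonempty →
        IsNTAWithCDC (interior (⋃ Q' ∈ S.localSaw F Q, S.U t Q')) c₀' C₁' C₂' c₁' := by
      intro F Q hQ hne
      rw [S.interior_iUnion_U hΩo hf ht0 ht']
      exact key S hΩo hf hΩ.2 hw (S.isCoherent_localSaw hC hQ hne)
    refine ⟨fun Q hQ => ?_, fun x hx r hr hrA => ?_, fun F _ _ hne => ?_,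
      fun F _ _ Q hQ hne => hlocal F Q hQ hne⟩
    · have hmem : Q ∈ S.below Q := ⟨hQ, le_rfl, subset_rfl⟩
      rw [Construction.carlesonBox, S.below_eq_localSaw_empty]
      rw [S.below_eq_localSaw_empty] at hmem
      exact hlocal ∅ Q hQ ⟨Q, hmem⟩
    · obtain ⟨Q, hQ⟩ := S.ballCubes_nonempty hx hr hrA
      rw [Construction.ballBox, S.interior_iUnion_closure hΩo hf ht0 ht']
      exact key S hΩo hf hΩ.2 hw (S.isCoherent_ballCubes hC hQ)
    · rw [Construction.globalSawtooth, S.interior_iUnion_U hΩo hf ht0 ht']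
      exact key S hΩo hf hΩ.2 hw (S.isCoherent_globalSaw hC hA hne)
  -- For inadmissible constants no Ω satisfies the hypotheses, so any values serve.
  · refine ⟨0, 0, fun _ _ _ _ _ _ _ => ⟨0, 0, 0, 0, fun Ω hΩ => ?_⟩⟩
    exact absurd ⟨hΩ.1.2.2.1.1, hΩ.1.2.2.2.1, hΩ.1.2.2.2.2.1, hΩ.2.1⟩ hpar
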